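/- **Setting.** Fix $m>0$ and $K\in\mathbb R$. Consider, for $T>0$, the one-dimensional Schrödinger equation on $[0,1]$ with periodic boundary conditions $$\mathrm i\,\partial_t\phi(t,x)=-f_1(t)\,\partial_x^2\phi(t,x)+f_2(t)V(x)\phi(t,x),\qquad f_1=\frac1{2M},\quad f_2=\frac{M\omega^2}{2},\qquad t\in[0,T],$$ where $M,\omega\in C^2([0,T];\mathbb R)$, $M\ge m$, the derivatives of $M$ and $\omega$ of orders $0,1,2$ are bounded by $K$ on $[0,T]$, and $V$ is a real, $1$-periodic $C^4$ function on $\mathbb R$ whose derivatives of orders $0,\dots,4$ are bounded by $K$. Let $\phi$ be a classical solution: $\phi(t,\cdot)$ is $1$-periodic and $C^4$ for each $t\in[0,T]$, $\partial_x^4\phi$ is bounded on $[0,T]\times[0,1]$, the equation holds pointwise, and $\int_0^1|\phi(0,x)|^2dx=1$. Write $S_j=\sup_{t\in[0,T],x\in[0,1]}|\partial_x^j\phi(t,x)|$ for $j=2,4$ and $S_0=\sup_{y\in[0,1]}|\phi(0,y)|$. *Space discretization.* For $n\ge1$ let $H_1$ be the periodic central finite difference matrix for $-\partial_x^2$ at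 the nodes $k/n$, $0\le k\le n-1$, that is, $(H_1v)_k=n^2(2v_k-v_{k+1}-v_{k-1})$ with indices mod $n$, let $H_2=\mathrm{diag}(V(k/n))_{k=0}^{n-1}$ and $H(t)=f_1(t)H_1+f_2(t)H_2$. Let $U(t,0)$ solve $\mathrm i\,\partial_tU(t,0)=H(t)U(t,0)$, $U(0,0)=I$, let $\vec\phi(t)=(\phi(t,k/n))_{k=0}^{n-1}$ and $\vec\psi(T)=U(T,0)\vec\phi(0)$. Let $\|v\|_\star=n^{-1/2}\|v\|_2$, and let $\|\cdot\|$ be the spectral norm of matrices. *Time discretization.* With $L$ equal steps $h=T/L$, one step from $t$ to $t+h$ of the first- and second-order standard ($s$) and generalized ($g$) Trotter formulae is $$U_{s,1}=e^{-\mathrm ihf_2(t+h)H_2}e^{-\mathrm ihf_1(t+h)H_1},\qquad U_{g,1}=e^{-\mathrm i\int_t^{t+h}f_2\,H_2}e^{-\mathrm i\int_t^{t+h}f_1\,H_1},$$ $$U_{s,2}=e^{-\frac{\mathrm ih}2f_1(t+\frac h2)H_1}e^{-\mathrm ihf_2(t+\frac h2)H_2}e^{-\frac{\mathrm ih}2f_1(t+\frac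 h2)H_1},\qquad U_{g,2}=e^{-\mathrm i\int_{t+h/2}^{t+h}f_1\,H_1}e^{-\mathrm i\int_t^{t+h}f_2\,H_2}e^{-\mathrm i\int_t^{t+h/2}f_1\,H_1}.$$ For each scheme $\sigma\in\{(s,1),(g,1),(s,2),(g,2)\}$ let $\widetilde U_\sigma$ be the ordered product of the $L$ steps covering $[0,T]$ (later times on the left), and $\vec\psi_\sigma=\widetilde U_\sigma\vec\phi(0)$. **Theorem.** Put $N_\epsilon=T^{1/2}\epsilon^{-1/2}S_4^{1/2}$ and $$\Lambda^{\rm ope}_{s,1}=\frac{T^3}{\epsilon^2}S_4,\qquad \Lambda^{\rm ope}_{g,1}=\frac{T^{5/2}}{\epsilon^{3/2}}S_4^{1/2},\qquad \Lambda^{\rm ope}_{s,2}=\Lambda^{\rm ope}_{g,2}=\frac{T^2}{\epsilon}S_4^{1/2},$$ $$\Lambda^{\rm vec}_{s,1}=\frac{T^2}{\epsilon}\big((T+1)S_4+S_2+S_0\big),\qquad \Lambda^{\rm vec}_{g,1}=\frac{T^2}{\epsilon}\Big[\big((T+1)S_4+S_2\big)^{1/2}S_0^{1/2}+S_0\Big],$$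 $$\Lambda^{\rm vec}_{s,2}=\Lambda^{\rm vec}_{g,2}=\frac{T^{3/2}}{\epsilon^{1/2}}\big((T+1)S_4+S_2+S_0\big)^{1/2}.$$ There are constants $c,C_{\rm vec}>0$ depending only on $m,K$ and, for every $\kappa\ge c$, a constant $C_{\rm ope}>0$ depending only on $m,K,\kappa$, such that for all $T,M,\omega,V,\phi$ as above there is $\epsilon_0>0$ such that for all $0<\epsilon<\epsilon_0$ and all integers $n\ge1$ with $n\ge cN_\epsilon$: 1. (space) $\|\vec\psi(T)-\vec\phi(T)\|_\star\le\epsilon$. 2. (vector norm estimates) For every scheme $\sigma$ and every integer $L\ge C_{\rm vec}\Lambda^{\rm vec}_\sigma$: $\|\vec\psi_\sigma-\vec\psi(T)\|_\star\le\epsilon$ and $\|\vec\psi_\sigma-\vec\phi(T)\|_\star\le\epsilon$. 3. (operator norm estimates) If moreover $n\le\kappa N_\epsilon$, then for every scheme $\sigma$ and every integer $L\ge C_{\rm ope}\Lambda^{\rm ope}_\sigma$: $\|\widetilde U_\sigma-U(T,0)\|\le\epsilon$ and $\|\vec\psi_\sigma-\vec\phi(T)\|_\star\le\epsilon$. -/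

import Mathlib

open Set MeasureTheory
open scoped Matrix
-- Matrices carry the operator norm induced by the Euclidean 2-norm.
open scoped Matrix.Norms.L2Operator

noncomputable section

namespace TrotterSchrodinger

/-! ### The continuous problem on the unit circle -/

/-- The coefficient `f₁(t) = 1 / (2 M(t))` of the kinetic term. -/
def f₁ (M : ℝ → ℝ) (t : ℝ) : ℝ := 1 / (2 * M t)

/-- The coefficient `f₂(t) = M(t) ω(t)² / 2` of the potential term. -/
def f₂ (M ω : ℝ → ℝ) (t : ℝ) : ℝ := M t * ω t ^ 2 / 2

/-- The assumptions on the effective mass `M`, the frequency `ω` (on `[0, T]`) and the potential `V`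
(a `C⁴` function on the circle `ℝ / ℤ`), with the quantitative bounds `m` and `K`. -/
structure IsModel (m K T : ℝ) (M ω V : ℝ → ℝ) : Prop where
  mass_lower : ∀ t ∈ Icc 0 T, m ≤ M t
  mass_smooth : ContDiffOn ℝ 2 M (Icc 0 T)
  mass_bound : ∀ k ≤ 2, ∀ t ∈ Icc 0 T, |iteratedDerivWithin k M (Icc 0 T) t| ≤ K
  freq_smooth : ContDiffOn ℝ 2 ω (Icc 0 T)
  freq_bound : ∀ k ≤ 2, ∀ t ∈ Icc 0 T, |iteratedDerivWithin k ω (Icc 0 T) t| ≤ K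
  pot_smooth : ContDiff ℝ 4 V
  pot_periodic : Function.Periodic V 1
  pot_bound : ∀ k ≤ 4, ∀ x, |iteratedDeriv k V x| ≤ K

/-- `φ t x` is a normalized classical solution on `[0, T]` of
`i ∂ₜφ = -f₁(t) ∂ₓ²φ + f₂(t) V(x) φ` with periodic boundary conditions, with the spatial regularity
that makes the suprema below finite. -/
structure IsExactSolution (T : ℝ) (M ω V : ℝ → ℝ) (φ : ℝ → ℝ → ℂ) : Prop where
  smooth : ∀ t ∈ Icc 0 T, ContDiff ℝ 4 (φ t)
  periodic : ∀ t ∈ Icc 0 T, Function.Periodic (φ t) 1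
  bounded : ∃ B : ℝ, ∀ t ∈ Icc 0 T, ∀ x, ‖iteratedDeriv 4 (φ t) x‖ ≤ B
  equation : ∀ t ∈ Icc 0 T, ∀ x, HasDerivWithinAt (fun s => φ s x)
    (-Complex.I * (-(f₁ M t : ℂ) * iteratedDeriv 2 (φ t) x + (f₂ M ω t : ℂ) * (V x : ℂ) * φ t x))
    (Icc 0 T) t
  normalized : ∫ x in (0 : ℝ)..1, ‖φ 0 x‖ ^ 2 = 1

/-- `sup |∂ₓʲ φ|` over `t ∈ [0, T]` and `x ∈ [0, 1]`. -/
def supDeriv (j : ℕ) (T : ℝ) (φ : ℝ → ℝ → ℂ) : ℝ :=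
  ⨆ p : Icc (0 : ℝ) T × Icc (0 : ℝ) 1, ‖iteratedDeriv j (φ p.1) p.2‖

/-- `sup |φ(0, y)|` over `y ∈ [0, 1]`. -/
def supInit (φ : ℝ → ℝ → ℂ) : ℝ := ⨆ y : Icc (0 : ℝ) 1, ‖φ 0 y‖

/-! ### Spatial discretization -/

/-- The rescaled 2-norm `n^(-1/2) (∑ₖ |vₖ|²)^(1/2)`. -/
def starNorm {n : ℕ} (v : Fin n → ℂ) : ℝ := √(∑ k, ‖v k‖ ^ 2) / √n

/-- The nodal values `(u(k/n))`, `0 ≤ k ≤ n - 1`. -/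
def sample (n : ℕ) (u : ℝ → ℂ) : Fin n → ℂ := fun k => u ((k : ℝ) / n)

/-- The periodic central finite difference matrix of `-∂ₓ²` : `n²` times the cyclic tridiagonal
matrix with `2` on the diagonal and `-1` at cyclically adjacent indices. -/
def H₁ (n : ℕ) : Matrix (Fin n) (Fin n) ℂ := Matrix.of fun i j =>
  (n : ℂ) ^ 2 * ((if i = j then 2 else 0) - (if (i.val + 1) % n = j.val then 1 else 0)
    - (if (j.val + 1) % n = i.val then 1 else 0))

/-- The diagonal matrix of the nodal values of the potential. -/
def H₂ (n : ℕ) (V : ℝ → ℝ) : Matrix (Fin n) (Fin n) ℂ :=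
  Matrix.diagonal (sample n fun x => (V x : ℂ))

/-- The semi-discretized Hamiltonian `f₁(t) H₁ + f₂(t) H₂`. -/
def hamiltonian (n : ℕ) (M ω V : ℝ → ℝ) (t : ℝ) : Matrix (Fin n) (Fin n) ℂ :=
  (f₁ M t : ℂ) • H₁ n + (f₂ M ω t : ℂ) • H₂ n V

/-- `U` solves `i U'(t) = H(t) U(t)` on `[0, T]`, `U(0) = 1`. -/
def IsPropagator {n : ℕ} (H : ℝ → Matrix (Fin n) (Fin n) ℂ) (T : ℝ)
    (U : ℝ → Matrix (Fin n) (Fin n) ℂ) : Prop :=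
  U 0 = 1 ∧ ∀ t ∈ Icc 0 T, HasDerivWithinAt U ((-Complex.I) • (H t * U t)) (Icc 0 T) t

open Classical in
/-- The evolution operator `t ↦ U(t, 0)` on `[0, T]` (it exists by `isPropagator_propagator`). -/
def propagator {n : ℕ} (H : ℝ → Matrix (Fin n) (Fin n) ℂ) (T : ℝ) :
    ℝ → Matrix (Fin n) (Fin n) ℂ :=
  if h : ∃ U, IsPropagator H T U then h.choose else fun _ => 1

/-- Existence for linear initial value problems. -/
theorem exists_linear_ode {E : Type*} [NormedRing E] [NormedAlgebra ℝ E] [CompleteSpace E]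
    (A : ℝ → E) (T : ℝ) (hT : 0 ≤ T) (hA : ContinuousOn A (Icc 0 T)) :
    ∃ U : ℝ → E, U 0 = 1 ∧ ∀ t ∈ Icc 0 T, HasDerivWithinAt U (A t * U t) (Icc 0 T) t := by
  obtain ⟨K, hK⟩ := isCompact_Icc.exists_bound_of_continuousOn hA
  have hK0 : 0 ≤ K := (norm_nonneg _).trans (hK 0 ⟨le_rfl, hT⟩)
  set B : ℝ → E := IccExtend hT ((Icc 0 T).domRestrict A) with hB
  have hBc : Continuous B := hA.domRestrict.Icc_extend'
  have hBK : ∀ t, ‖B t‖ ≤ K := fun t => hK _ (projIcc 0 T hT t).2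
  let D : ℕ → ℝ → E := fun k =>
    Nat.rec (fun _ => 1) (fun _ d t => ∫ s in (0 : ℝ)..t, B s * d s) k
  have hD0 : ∀ t, D 0 t = 1 := fun _ => rfl
  have hDs : ∀ k t, D (k + 1) t = ∫ s in (0 : ℝ)..t, B s * D k s := fun _ _ => rfl
  have hDc : ∀ k, Continuous (D k) := by
    intro k
    induction k with
    | zero => exact continuous_const
    | succ k ih =>
      exact intervalIntegral.continuous_primitive
        (fun a b => (hBc.mul ih).intervalIntegrable a b) 0
  have hDd : ∀ k t, HasDerivAt (D (k + 1)) (B t * D k t) t := fun k t =>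
    ((hBc.mul (hDc k)).integral_hasStrictDerivAt 0 t).hasDerivAt
  have hDn : ∀ k t, ‖D k t‖ ≤ ‖(1 : E)‖ * ((K * |t|) ^ k / k.factorial) := by
    intro k
    induction k with
    | zero => intro t; simp [hD0]
    | succ k ih =>
      intro t
      rw [hDs]
      have h1 : ‖∫ s in (0 : ℝ)..t, B s * D k s‖ ≤
          ∫ s in uIoc 0 t, ‖(1 : E)‖ * K ^ (k + 1) / k.factorial * |s - 0| ^ k := by
        refine (intervalIntegral.norm_integral_le_integral_norm_uIoc).trans ?_
        refine setIntegral_mono_on ?_ ?_ measurableSet_uIoc ?_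
        · exact (intervalIntegrable_iff.1 ((hBc.mul (hDc k)).norm.intervalIntegrable 0 t))
        · have : Continuous fun s : ℝ =>
            ‖(1 : E)‖ * K ^ (k + 1) / k.factorial * |s - 0| ^ k := by fun_prop
          exact intervalIntegrable_iff.1 (this.intervalIntegrable 0 t)
        · intro s _
          calc ‖B s * D k s‖ ≤ ‖B s‖ * ‖D k s‖ := norm_mul_le _ _
            _ ≤ K * (‖(1 : E)‖ * ((K * |s|) ^ k / k.factorial)) :=
              mul_le_mul (hBK s) (ih s) (norm_nonneg _) hK0
            _ = _ := by rw [sub_zero, mul_pow]; ring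
      refine h1.trans (le_of_eq ?_)
      rw [integral_const_mul, integral_pow_abs_sub_uIoc, Nat.factorial_succ, mul_pow, sub_zero]
      push_cast
      have : ((k : ℝ) + 1) ≠ 0 := by positivity
      have : (k.factorial : ℝ) ≠ 0 := by positivity
      field_simp
  set R := T + 1 with hR
  have hR0 : 0 < R := by positivity
  have hsum : Summable fun k : ℕ => (K * R) ^ k / (k.factorial : ℝ) :=
    Real.summable_pow_div_factorial _
  have hle : ∀ k t, t ∈ Ioo (-R) R → ‖D k t‖ ≤ ‖(1 : E)‖ * ((K * R) ^ k / k.factorial) := by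
    intro k t ht
    have : |t| ≤ R := (abs_lt.2 ht).le
    refine (hDn k t).trans ?_
    gcongr
  have hS : ∀ t ∈ Ioo (-R) R, Summable fun k => D k t := fun t ht =>
    Summable.of_norm_bounded (hsum.mul_left _) fun k => hle k t ht
  refine ⟨fun t => 1 + ∑' k, D (k + 1) t, by simp [hDs], ?_⟩
  intro t ht
  have htR : t ∈ Ioo (-R) R := ⟨by linarith [ht.1], by linarith [ht.2]⟩
  have h := hasDerivAt_tsum_of_isPreconnected (𝕜 := ℝ) (g := fun k => D (k + 1))
    (g' := fun k t => B t * D k t) (t := Ioo (-R) R) (y₀ := 0) (y := t)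
    ((hsum.mul_left ‖(1 : E)‖).mul_left K) isOpen_Ioo isPreconnected_Ioo
    (fun k y _ => hDd k y)
    (fun k y hy => (norm_mul_le _ _).trans
      (mul_le_mul (hBK y) (hle k y hy) (norm_nonneg _) hK0))
    ⟨by linarith, hR0⟩ ((summable_nat_add_iff 1).2 (hS 0 ⟨by linarith, hR0⟩)) htR
  have hAB : B t = A t := by rw [hB, IccExtend_of_mem hT _ ht]; rfl
  have hval : A t * (1 + ∑' k, D (k + 1) t) = ∑' k, B t * D k t := by
    rw [(hS t htR).tsum_mul_left, (hS t htR).tsum_eq_zero_add, hD0, hAB]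
  rw [hval]
  exact (h.const_add 1).hasDerivWithinAt

/-- The evolution operator of a continuous Hamiltonian solves its initial value problem. -/
theorem isPropagator_propagator {n : ℕ} {H : ℝ → Matrix (Fin n) (Fin n) ℂ} {T : ℝ} (hT : 0 ≤ T)
    (hH : ContinuousOn H (Icc 0 T)) : IsPropagator H T (propagator H T) := by
  have h : ∃ U, IsPropagator H T U := by
    obtain ⟨U, h0, h1⟩ := exists_linear_ode (fun t => (-Complex.I) • H t) T hT
      (hH.const_smul (-Complex.I))
    exact ⟨U, h0, fun t ht => by simpa only [Matrix.smul_mul] using h1 t ht⟩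
  unfold propagator
  rw [dif_pos h]
  exact h.choose_spec

/-! ### Trotter formulae -/

/-- `exp(-i a H)`. -/
def expI {n : ℕ} (a : ℝ) (H : Matrix (Fin n) (Fin n) ℂ) : Matrix (Fin n) (Fin n) ℂ :=
  NormedSpace.exp ((-Complex.I * (a : ℂ)) • H)

/-- One step `U(t + h, t)` of the first-order standard Trotter formula for `g₁(t) A + g₂(t) B`. -/
def std₁ {n : ℕ} (g₁ g₂ : ℝ → ℝ) (A B : Matrix (Fin n) (Fin n) ℂ) (h t : ℝ) :
    Matrix (Fin n) (Fin n) ℂ :=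
  expI (h * g₂ (t + h)) B * expI (h * g₁ (t + h)) A

/-- One step `U(t + h, t)` of the first-order generalized Trotter formula. -/
def gen₁ {n : ℕ} (g₁ g₂ : ℝ → ℝ) (A B : Matrix (Fin n) (Fin n) ℂ) (h t : ℝ) :
    Matrix (Fin n) (Fin n) ℂ :=
  expI (∫ s in t..t + h, g₂ s) B * expI (∫ s in t..t + h, g₁ s) A

/-- One step `U(t + h, t)` of the second-order standard Trotter formula. -/
def std₂ {n : ℕ} (g₁ g₂ : ℝ → ℝ) (A B : Matrix (Fin n) (Fin n) ℂ) (h t : ℝ) :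
    Matrix (Fin n) (Fin n) ℂ :=
  expI (h / 2 * g₁ (t + h / 2)) A * expI (h * g₂ (t + h / 2)) B * expI (h / 2 * g₁ (t + h / 2)) A

/-- One step `U(t + h, t)` of the second-order generalized Trotter formula. -/
def gen₂ {n : ℕ} (g₁ g₂ : ℝ → ℝ) (A B : Matrix (Fin n) (Fin n) ℂ) (h t : ℝ) :
    Matrix (Fin n) (Fin n) ℂ :=
  expI (∫ s in (t + h / 2)..(t + h), g₁ s) A * expI (∫ s in t..t + h, g₂ s) B *
    expI (∫ s in t..(t + h / 2), g₁ s) A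

/-- The product of the first `l` steps of size `h`, later times on the left. -/
def steps {n : ℕ} (S : ℝ → ℝ → Matrix (Fin n) (Fin n) ℂ) (h : ℝ) :
    ℕ → Matrix (Fin n) (Fin n) ℂ
  | 0 => 1
  | l + 1 => S h (l * h) * steps S h l

/-- The four Trotter formulae. -/
inductive Scheme
  | standard₁
  | generalized₁
  | standard₂
  | generalized₂

/-- One step of a scheme for the semi-discretized Schrödinger equation. -/
def Scheme.step (σ : Scheme) (n : ℕ) (M ω V : ℝ → ℝ) :
    ℝ → ℝ → Matrix (Fin n) (Fin n) ℂ :=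
  match σ with
  | .standard₁ => std₁ (f₁ M) (f₂ M ω) (H₁ n) (H₂ n V)
  | .generalized₁ => gen₁ (f₁ M) (f₂ M ω) (H₁ n) (H₂ n V)
  | .standard₂ => std₂ (f₁ M) (f₂ M ω) (H₁ n) (H₂ n V)
  | .generalized₂ => gen₂ (f₁ M) (f₂ M ω) (H₁ n) (H₂ n V)

/-- The numerical evolution operator from `0` to `T` with `L` equidistant time steps. -/
def Scheme.evolution (σ : Scheme) (n : ℕ) (M ω V : ℝ → ℝ) (T : ℝ) (L : ℕ) :
    Matrix (Fin n) (Fin n) ℂ :=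
  steps (σ.step n M ω V) (T / L) L

/-! ### Errors -/

/-- Rescaled 2-norm distance at time `T` between the semi-discretized and the exact solution. -/
def spaceError (n : ℕ) (M ω V : ℝ → ℝ) (T : ℝ) (φ : ℝ → ℝ → ℂ) : ℝ :=
  starNorm (propagator (hamiltonian n M ω V) T T *ᵥ sample n (φ 0) - sample n (φ T))

/-- Operator norm distance at time `T` between the numerical and the semi-discretized evolution. -/
def opTimeError (σ : Scheme) (n : ℕ) (M ω V : ℝ → ℝ) (T : ℝ) (L : ℕ) : ℝ :=
  ‖σ.evolution n M ω V T L - propagator (hamiltonian n M ω V) T T‖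

/-- Rescaled 2-norm distance at time `T` between the numerical and the semi-discretized solution. -/
def vecTimeError (σ : Scheme) (n : ℕ) (M ω V : ℝ → ℝ) (T : ℝ) (φ : ℝ → ℝ → ℂ) (L : ℕ) : ℝ :=
  starNorm (σ.evolution n M ω V T L *ᵥ sample n (φ 0) -
    propagator (hamiltonian n M ω V) T T *ᵥ sample n (φ 0))

/-- Rescaled 2-norm distance at time `T` between the numerical and the exact solution. -/
def totalError (σ : Scheme) (n : ℕ) (M ω V : ℝ → ℝ) (T : ℝ) (φ : ℝ → ℝ → ℂ) (L : ℕ) : ℝ :=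
  starNorm (σ.evolution n M ω V T L *ᵥ sample n (φ 0) - sample n (φ T))

/-! ### Step counts -/

/-- The scale `T^(1/2) ε^(-1/2) (sup |∂ₓ⁴ φ|)^(1/2)` of the number of spatial nodes. -/
def nodeScale (T ε : ℝ) (φ : ℝ → ℝ → ℂ) : ℝ := √(T * supDeriv 4 T φ / ε)

/-- The number of steps, up to a constant, obtained from operator norm error bounds. -/
def opSteps (σ : Scheme) (T ε : ℝ) (φ : ℝ → ℝ → ℂ) : ℝ :=
  match σ with
  | .standard₁ => T ^ 3 / ε ^ 2 * supDeriv 4 T φ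
  | .generalized₁ => T ^ (5 / 2 : ℝ) / ε ^ (3 / 2 : ℝ) * √(supDeriv 4 T φ)
  | .standard₂ | .generalized₂ => T ^ 2 / ε * √(supDeriv 4 T φ)

/-- The number of steps, up to a constant, obtained from vector norm error bounds. -/
def vecSteps (σ : Scheme) (T ε : ℝ) (φ : ℝ → ℝ → ℂ) : ℝ :=
  match σ with
  | .standard₁ =>
      T ^ 2 / ε * ((T + 1) * supDeriv 4 T φ + supDeriv 2 T φ + supInit φ)
  | .generalized₁ =>
      T ^ 2 / ε * (√((T + 1) * supDeriv 4 T φ + supDeriv 2 T φ) * √(supInit φ) + supInit φ)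
  | .standard₂ | .generalized₂ =>
      T ^ (3 / 2 : ℝ) / ε ^ (1 / 2 : ℝ) *
        √((T + 1) * supDeriv 4 T φ + supDeriv 2 T φ + supInit φ)

end TrotterSchrodinger

end

/-! The semi-discrete flow and every Trotter step are unitary, so local errors add up without
amplification: the global error is at most L times the local one. Everything thus rests on one step
applied to a solution u of i u' = (f A + g B) u, with A the kinetic and B the potential matrix.

Let F, G be primitives of f, g. In the double interaction picture e^{iGB} e^{iFA} u the derivative
is, up to -i, equal to g e^{iGB} (e^{iFA} B e^{-iFA} - B) e^{iFA} u, of size |F| times the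
commutator [A, B]. Choosing F to vanish at the end of the step gives the first-order generalized
formula and an error h² (`SplitBounds.splitting_error_le`). Choosing F to vanish at the midpoint
gives the second-order one: the leading part of the derivative is then odd about the midpoint and
integrates to zero, leaving h³ (`SplitBounds.symmetric_splitting_error_le`). The standard formulae
differ from the generalized ones only by quadrature errors in the phases.

The constants do not depend on n because commutators lower the order of difference operators: [A, B]
is of first order and bounded by √(‖A v‖ ‖v‖) + ‖v‖, [A, [A, B]] is of second order and bounded by
‖A v‖ + ‖v‖, and [B, [A, B]] is bounded (`ShiftBounds.splitBounds`). The mesh enters only through a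
bound a of A u.

For operator norms u is the propagator and a = 4n², which n ≤ κ N_ε turns into a multiple of T S₄ /
ε. For vector norms u is the semi-discrete solution. Duhamel's principle and Taylor expansion show
that it is within a multiple of T S₄ / n² of the exact nodal values
(`IsModel.norm_propagator_mul_sub_le`); multiplying this by ‖A‖ ≤ 4n² leaves T S₄, so A u is bounded
by T S₄ + S₂ uniformly in n (`IsModel.norm_H₁_mul_propagator_le`). Nodal vectors are embedded
isometrically as first columns of matrices, so both cases are instances of
`Scheme.norm_evolution_mul_sub_le`. -/

namespace TrotterSchrodinger

/-! ### Unitary groups in a C⋆-algebra -/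

section UnitaryGroup

variable {R : Type*} [CStarAlgebra R]

/-- `exp(-i a Z)` in a C⋆-algebra. -/
noncomputable def phase (a : ℝ) (Z : R) : R := NormedSpace.exp ((-Complex.I * (a : ℂ)) • Z)

theorem phase_eq_exp_real_smul (a : ℝ) (Z : R) :
    phase a Z = NormedSpace.exp (a • ((-Complex.I) • Z)) := by
  rw [phase, mul_comm, mul_smul, Complex.coe_smul]

theorem phase_zero (Z : R) : phase 0 Z = 1 := by
  simp [phase]

theorem phase_add (a b : ℝ) (Z : R) : phase (a + b) Z = phase a Z * phase b Z := by
  let +nondep : NormedAlgebra ℚ R := NormedAlgebra.restrictScalars ℚ ℂ R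
  rw [phase, phase, phase, ← NormedSpace.exp_add_of_commute, ← add_smul]
  · push_cast; ring_nf
  · exact ((Commute.refl Z).smul_left _).smul_right _

theorem phase_mul_phase_neg (a : ℝ) (Z : R) : phase a Z * phase (-a) Z = 1 := by
  rw [← phase_add, add_neg_cancel, phase_zero]

theorem phase_mul_phase_neg_mul (a : ℝ) (Z v : R) : phase a Z * (phase (-a) Z * v) = v := by
  rw [← mul_assoc, phase_mul_phase_neg, one_mul]

theorem commute_phase (a : ℝ) (Z : R) : Z * phase a Z = phase a Z * Z := by
  let +nondep : NormedAlgebra ℚ R := NormedAlgebra.restrictScalars ℚ ℂ R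
  exact (((Commute.refl Z).smul_right (-Complex.I * (a : ℂ))).exp_right).eq

theorem hasDerivAt_phase (a : ℝ) (Z : R) :
    HasDerivAt (fun r : ℝ => phase r Z) ((-Complex.I) • (phase a Z * Z)) a := by
  have h := hasDerivAt_exp_smul_const (𝕂 := ℝ) ((-Complex.I) • Z) a
  simp only [phase_eq_exp_real_smul]
  rwa [mul_smul_comm] at h

theorem phase_mem_unitary (a : ℝ) {Z : R} (hZ : IsSelfAdjoint Z) : phase a Z ∈ unitary R := by
  let +nondep : NormedAlgebra ℚ R := NormedAlgebra.restrictScalars ℚ ℂ R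
  refine NormedSpace.exp_mem_unitary_of_mem_skewAdjoint ?_
  rw [skewAdjoint.mem_iff, star_smul, hZ.star_eq, ← neg_smul]
  simp

theorem norm_phase_mul (a : ℝ) {Z : R} (hZ : IsSelfAdjoint Z) (v : R) : ‖phase a Z * v‖ = ‖v‖ :=
  CStarRing.norm_mem_unitary_mul v (phase_mem_unitary a hZ)

theorem norm_mul_phase_mul (a : ℝ) {Z : R} (hZ : IsSelfAdjoint Z) (v : R) :
    ‖Z * (phase a Z * v)‖ = ‖Z * v‖ := by
  rw [← mul_assoc, commute_phase, mul_assoc, norm_phase_mul a hZ]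

theorem norm_I_smul (v : R) : ‖Complex.I • v‖ = ‖v‖ := by
  rw [norm_smul, Complex.norm_I, one_mul]

theorem norm_phase_mul_sub_le (q : ℝ) {Z : R} (hZ : IsSelfAdjoint Z) (v : R) :
    ‖phase q Z * v - v‖ ≤ |q| * ‖Z * v‖ := by
  have h := Convex.norm_image_sub_le_of_norm_hasDerivWithin_le (s := univ) (x := 0) (y := q)
    (f := fun r : ℝ => phase r Z * v) (C := ‖Z * v‖)
    (fun r _ => ((hasDerivAt_phase r Z).mul_const v).hasDerivWithinAt)
    (fun r _ => by
      rw [smul_mul_assoc, mul_assoc, neg_smul, norm_neg, norm_I_smul, norm_phase_mul r hZ])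
    convex_univ (mem_univ _) (mem_univ _)
  simpa [phase_zero, mul_comm] using h

/-- The derivative of a conjugation is the conjugated commutator. Iterating this gives expansions
whose remainders involve only nested commutators, never products of the large operator Z. -/
theorem hasDerivAt_conj_phase (Z X v : R) (r : ℝ) :
    HasDerivAt (fun r : ℝ => phase (-r) Z * (X * (phase r Z * v)))
      (Complex.I • (phase (-r) Z * ((Z * X - X * Z) * (phase r Z * v)))) r := by
  have h1 : HasDerivAt (fun r : ℝ => phase (-r) Z) (Complex.I • (phase (-r) Z * Z)) r := by
    have := HasDerivAt.scomp (h := fun r : ℝ => -r) (h' := -1) r (hasDerivAt_phase (-r) Z)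
      (hasDerivAt_neg r)
    simpa [Function.comp_def] using this
  have h2 : HasDerivAt (fun r : ℝ => X * (phase r Z * v))
      (X * ((-Complex.I) • (phase r Z * Z) * v)) r :=
    ((hasDerivAt_phase r Z).mul_const v).const_mul X
  refine (h1.mul h2).congr_deriv ?_
  rw [← commute_phase r Z]
  simp only [neg_smul, neg_mul, mul_neg, sub_mul, mul_sub, smul_sub, smul_mul_assoc,
    mul_smul_comm, mul_assoc]
  rw [sub_eq_add_neg]

/-- First-order expansion of a conjugation by a unitary group. -/
theorem norm_conj_phase_sub_le {Z : R} (hZ : IsSelfAdjoint Z) (X v : R) (q C : ℝ)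
    (hC : ∀ r, |r| ≤ |q| → ‖(Z * X - X * Z) * (phase r Z * v)‖ ≤ C) :
    ‖phase (-q) Z * (X * (phase q Z * v)) - X * v‖ ≤ C * |q| := by
  have h := Convex.norm_image_sub_le_of_norm_hasDerivWithin_le (s := Icc (-|q|) |q|)
    (x := 0) (y := q) (f := fun r : ℝ => phase (-r) Z * (X * (phase r Z * v))) (C := C)
    (fun r _ => (hasDerivAt_conj_phase Z X v r).hasDerivWithinAt)
    (fun r hr => by
      rw [norm_I_smul, norm_phase_mul _ hZ]
      exact hC r (abs_le.2 hr))
    (convex_Icc _ _) (by simp) (abs_le.1 le_rfl)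
  simpa [phase_zero] using h

/-- Second-order expansion of a conjugation by a unitary group. -/
theorem norm_conj_phase_sub_sub_le {Z : R} (hZ : IsSelfAdjoint Z) (X v : R) (q C : ℝ)
    (hC : ∀ r, |r| ≤ |q| →
      ‖(Z * (Z * X - X * Z) - (Z * X - X * Z) * Z) * (phase r Z * v)‖ ≤ C) :
    ‖phase (-q) Z * (X * (phase q Z * v)) - X * v - q • (Complex.I • ((Z * X - X * Z) * v))‖ ≤
      C * |q| ^ 2 := by
  have hd : ∀ r : ℝ, HasDerivAt (fun r : ℝ => phase (-r) Z * (X * (phase r Z * v)) -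
      r • (Complex.I • ((Z * X - X * Z) * v)))
      (Complex.I • (phase (-r) Z * ((Z * X - X * Z) * (phase r Z * v))) -
        (1 : ℝ) • (Complex.I • ((Z * X - X * Z) * v))) r := fun r =>
    (hasDerivAt_conj_phase Z X v r).sub ((hasDerivAt_id r).smul_const _)
  have hC0 : 0 ≤ C := (norm_nonneg _).trans (hC 0 (by simp))
  have h := Convex.norm_image_sub_le_of_norm_hasDerivWithin_le (s := Icc (-|q|) |q|)
    (x := 0) (y := q) (C := C * |q|) (fun r _ => (hd r).hasDerivWithinAt)
    (fun r hr => by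
      have hr' := abs_le.2 hr
      rw [one_smul, ← smul_sub, norm_I_smul]
      -- The derivative of the remainder is the conjugated commutator minus its value at zero, so
      -- the first-order expansion applies with X replaced by [Z, X].
      refine (norm_conj_phase_sub_le hZ (Z * X - X * Z) v r C
        (fun r' h' => hC r' (h'.trans hr'))).trans ?_
      gcongr)
    (convex_Icc _ _) (by simp) (abs_le.1 le_rfl)
  have e : phase (-q) Z * (X * (phase q Z * v)) - X * v -
      q • (Complex.I • ((Z * X - X * Z) * v)) =
      phase (-q) Z * (X * (phase q Z * v)) - q • (Complex.I • ((Z * X - X * Z) * v)) - X * v := by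
    abel
  rw [e]
  simpa [phase_zero, pow_two, mul_assoc] using h

end UnitaryGroup

/-! ### Local errors of splittings in a C⋆-algebra -/

section Splitting

variable {R : Type*} [CStarAlgebra R]

/-- The commutator bounds that a finite difference Laplacian `A` and a smooth potential `B` satisfy
uniformly in the mesh width. -/
structure SplitBounds (C : ℝ) (A B : R) : Prop where
  one_le : 1 ≤ C
  left_sa : IsSelfAdjoint A
  right_sa : IsSelfAdjoint B
  norm_right : ∀ v, ‖B * v‖ ≤ C * ‖v‖
  -- The geometric mean reflects that the commutator has order one. It is what makes the first-order
  -- generalized formula cheaper than the standard one.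
  norm_comm : ∀ v, ‖(A * B - B * A) * v‖ ≤ C * (√(‖A * v‖ * ‖v‖) + ‖v‖)
  norm_comm_left : ∀ v,
    ‖(A * (A * B - B * A) - (A * B - B * A) * A) * v‖ ≤ C * (‖A * v‖ + ‖v‖)
  norm_comm_right : ∀ v, ‖(B * (A * B - B * A) - (A * B - B * A) * B) * v‖ ≤ C * ‖v‖

/-- On `J`, the functions `f'` and `f''` are the first two derivatives of `f`, and all three are
bounded by `C`. -/
structure C2Bound (C : ℝ) (J : Set ℝ) (f f' f'' : ℝ → ℝ) : Prop where
  deriv₁ : ∀ t ∈ J, HasDerivWithinAt f (f' t) J t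
  deriv₂ : ∀ t ∈ J, HasDerivWithinAt f' (f'' t) J t
  bound₀ : ∀ t ∈ J, |f t| ≤ C
  bound₁ : ∀ t ∈ J, |f' t| ≤ C
  bound₂ : ∀ t ∈ J, |f'' t| ≤ C

/-- `u` solves `i u' = (f A + g B) u` on `J`, with `u` bounded by `b` and `A u` by `a`. -/
structure IsTrajectory (f g : ℝ → ℝ) (A B : R) (J : Set ℝ) (u : ℝ → R) (a b : ℝ) : Prop where
  deriv : ∀ t ∈ J, HasDerivWithinAt u
    ((-Complex.I) • (f t • (A * u t) + g t • (B * u t))) J t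
  bound_left : ∀ t ∈ J, ‖A * u t‖ ≤ a
  bound : ∀ t ∈ J, ‖u t‖ ≤ b

theorem C2Bound.mono {C : ℝ} {J J' : Set ℝ} {f f' f'' : ℝ → ℝ} (h : C2Bound C J f f' f'')
    (hJ : J' ⊆ J) : C2Bound C J' f f' f'' where
  deriv₁ t ht := (h.deriv₁ t (hJ ht)).mono hJ
  deriv₂ t ht := (h.deriv₂ t (hJ ht)).mono hJ
  bound₀ t ht := h.bound₀ t (hJ ht)
  bound₁ t ht := h.bound₁ t (hJ ht)
  bound₂ t ht := h.bound₂ t (hJ ht)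

theorem IsTrajectory.mono {f g : ℝ → ℝ} {A B : R} {J J' : Set ℝ} {u : ℝ → R} {a b : ℝ}
    (h : IsTrajectory f g A B J u a b) (hJ : J' ⊆ J) : IsTrajectory f g A B J' u a b where
  deriv t ht := (h.deriv t (hJ ht)).mono hJ
  bound_left t ht := h.bound_left t (hJ ht)
  bound t ht := h.bound t (hJ ht)

theorem abs_sub_le_of_hasDerivWithinAt {f f' : ℝ → ℝ} {J : Set ℝ} {C x y : ℝ}
    (hf : ∀ t ∈ J, HasDerivWithinAt f (f' t) J t) (hb : ∀ t ∈ J, |f' t| ≤ C) (hJ : Convex ℝ J)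
    (hx : x ∈ J) (hy : y ∈ J) : |f y - f x| ≤ C * |y - x| :=
  Convex.norm_image_sub_le_of_norm_hasDerivWithin_le hf hb hJ hx hy

/-- The error of the tangent line at `c`. -/
theorem C2Bound.abs_sub_tangent_le {C c h s : ℝ} {J : Set ℝ} {f f' f'' : ℝ → ℝ}
    (H : C2Bound C J f f' f'') (hJ : Convex ℝ J) (hc : c ∈ J) (hs : s ∈ J)
    (hh : ∀ t ∈ J, |t - c| ≤ h) : |f s - f c - f' c * (s - c)| ≤ C * h ^ 2 := by
  have hC : 0 ≤ C := (abs_nonneg _).trans (H.bound₀ c hc)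
  have h0 : 0 ≤ h := (abs_nonneg _).trans (hh c hc)
  have key := abs_sub_le_of_hasDerivWithinAt (f := fun t => f t - f' c * (t - c))
    (f' := fun t => f' t - f' c) (J := J) (C := C * h) (x := c) (y := s)
    (fun t ht => by
      simpa using (H.deriv₁ t ht).fun_sub (((hasDerivWithinAt_id t J).sub_const c).const_mul (f' c)))
    (fun t ht => (abs_sub_le_of_hasDerivWithinAt H.deriv₂ H.bound₂ hJ hc ht).trans
      (by gcongr; exact hh t ht)) hJ hc hs
  have e : f s - f c - f' c * (s - c) = f s - f' c * (s - c) - (f c - f' c * (c - c)) := by ring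
  rw [e]
  refine key.trans ?_
  have := hh s hs
  calc C * h * |s - c| ≤ C * h * h := by gcongr
    _ = C * h ^ 2 := by ring

/-- The error of the rectangle rule. -/
theorem C2Bound.abs_primitive_sub_le {C c h x y : ℝ} {J : Set ℝ} {f f' f'' F : ℝ → ℝ}
    (H : C2Bound C J f f' f'') (hF : ∀ t ∈ J, HasDerivWithinAt F (f t) J t) (hJ : Convex ℝ J)
    (hc : c ∈ J) (hx : x ∈ J) (hy : y ∈ J) (hh : ∀ t ∈ J, |t - c| ≤ h) :
    |F y - F x - f c * (y - x)| ≤ C * h * |y - x| := by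
  have hC : 0 ≤ C := (abs_nonneg _).trans (H.bound₀ c hc)
  have key := abs_sub_le_of_hasDerivWithinAt (f := fun t => F t - f c * t)
    (f' := fun t => f t - f c) (J := J) (C := C * h) (x := x) (y := y)
    (fun t ht => by
      simpa using (hF t ht).fun_sub ((hasDerivWithinAt_id t J).const_mul (f c)))
    (fun t ht => (abs_sub_le_of_hasDerivWithinAt H.deriv₁ H.bound₁ hJ hc ht).trans
      (by gcongr; exact hh t ht)) hJ hx hy
  have e : F y - F x - f c * (y - x) = F y - f c * y - (F x - f c * x) := by ring
  rwa [e]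

/-- The error of the midpoint rule. -/
theorem C2Bound.abs_primitive_midpoint_le {C c d : ℝ} {f f' f'' F : ℝ → ℝ} (hd : 0 ≤ d)
    (H : C2Bound C (Icc (c - d) (c + d)) f f' f'')
    (hF : ∀ t ∈ Icc (c - d) (c + d), HasDerivWithinAt F (f t) (Icc (c - d) (c + d)) t) :
    |F (c + d) - F (c - d) - f c * (2 * d)| ≤ 2 * C * d ^ 3 := by
  have hc : c ∈ Icc (c - d) (c + d) := ⟨by linarith, by linarith⟩
  have hx : c - d ∈ Icc (c - d) (c + d) := ⟨by linarith, by linarith⟩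
  have hy : c + d ∈ Icc (c - d) (c + d) := ⟨by linarith, by linarith⟩
  have hh : ∀ t ∈ Icc (c - d) (c + d), |t - c| ≤ d := fun t ht =>
    abs_le.2 ⟨by linarith [ht.1], by linarith [ht.2]⟩
  -- The quadratic term makes the derivative a second-order Taylor remainder; being even about c, it
  -- takes equal values at both endpoints and drops out of the difference.
  have key := abs_sub_le_of_hasDerivWithinAt
    (f := fun t => F t - f c * t - f' c / 2 * (t - c) ^ 2)
    (f' := fun t => f t - f c - f' c * (t - c)) (C := C * d ^ 2)
    (fun t ht => by
      have h1 := ((hasDerivWithinAt_id t (Icc (c - d) (c + d))).sub_const c).pow 2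
      have h2 := ((hF t ht).sub ((hasDerivWithinAt_id t (Icc (c - d) (c + d))).const_mul
        (f c))).sub (h1.const_mul (f' c / 2))
      refine h2.congr_deriv ?_
      simp only [id]
      push_cast
      ring)
    (fun t ht => H.abs_sub_tangent_le (convex_Icc _ _) hc ht hh) (convex_Icc _ _) hx hy
  have e : F (c + d) - F (c - d) - f c * (2 * d) =
      F (c + d) - f c * (c + d) - f' c / 2 * (c + d - c) ^ 2 -
        (F (c - d) - f c * (c - d) - f' c / 2 * (c - d - c) ^ 2) := by ring
  rw [e]
  refine key.trans (le_of_eq ?_)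
  rw [show c + d - (c - d) = 2 * d by ring, abs_of_nonneg (by linarith)]
  ring

theorem hasDerivWithinAt_phase_neg {f F : ℝ → ℝ} (Z : R) {J : Set ℝ} {t : ℝ}
    (hF : HasDerivWithinAt F (f t) J t) :
    HasDerivWithinAt (fun s => phase (-F s) Z)
      ((-f t) • ((-Complex.I) • (phase (-F t) Z * Z))) J t :=
  HasDerivAt.scomp_hasDerivWithinAt (h := fun s => -F s) t (hasDerivAt_phase (-F t) Z) hF.fun_neg

/-- The interaction picture. -/
theorem hasDerivWithinAt_interaction {f g F : ℝ → ℝ} {A B : R} {J : Set ℝ} {u : ℝ → R} {t : ℝ}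
    (hu : HasDerivWithinAt u ((-Complex.I) • (f t • (A * u t) + g t • (B * u t))) J t)
    (hF : HasDerivWithinAt F (f t) J t) :
    HasDerivWithinAt (fun s => phase (-F s) A * u s)
      ((-Complex.I) • (g t • (phase (-F t) A * (B * u t)))) J t := by
  refine ((hasDerivWithinAt_phase_neg A hF).mul hu).congr_deriv ?_
  simp only [neg_smul, smul_neg, mul_neg, smul_add, mul_add, smul_mul_assoc, mul_smul_comm,
    mul_assoc, neg_neg, smul_comm Complex.I]
  abel

/-- The double interaction picture, in which the splitting error is a single derivative. -/
theorem hasDerivWithinAt_double_interaction {f g F G : ℝ → ℝ} {A B : R} {J : Set ℝ} {u : ℝ → R}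
    {t : ℝ} (hu : HasDerivWithinAt u ((-Complex.I) • (f t • (A * u t) + g t • (B * u t))) J t)
    (hF : HasDerivWithinAt F (f t) J t) (hG : HasDerivWithinAt G (g t) J t) :
    HasDerivWithinAt (fun s => phase (-G s) B * (phase (-F s) A * u s))
      ((-Complex.I) • (g t • (phase (-G t) B *
        (phase (-F t) A * (B * (phase (F t) A * (phase (-F t) A * u t))) -
          B * (phase (-F t) A * u t))))) J t := by
  refine ((hasDerivWithinAt_phase_neg B hG).mul (hasDerivWithinAt_interaction hu hF)).congr_deriv ?_
  rw [phase_mul_phase_neg_mul]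
  simp only [neg_smul, smul_neg, mul_neg, smul_sub, mul_sub, smul_mul_assoc, mul_smul_comm,
    mul_assoc, neg_neg, smul_comm Complex.I]
  abel

theorem sqrt_mul_add_le {x y a b : ℝ} (hx : 0 ≤ x) (hy : 0 ≤ y) (hxa : x ≤ a) (hyb : y ≤ b) :
    √(x * y) + y ≤ 2 * (a + b) := by
  have : √(x * y) ≤ (x + y) := by
    rw [Real.sqrt_le_left (by positivity)]
    nlinarith
  linarith

variable {C : ℝ} {A B : R}

theorem SplitBounds.norm_comm_le (H : SplitBounds C A B) {v : R} {a b : ℝ} (ha : ‖A * v‖ ≤ a)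
    (hb : ‖v‖ ≤ b) : ‖(A * B - B * A) * v‖ ≤ C * (2 * (a + b)) :=
  (H.norm_comm v).trans (mul_le_mul_of_nonneg_left
    (sqrt_mul_add_le (norm_nonneg _) (norm_nonneg _) ha hb) (by linarith [H.one_le]))

/-- Local error of a splitting step whose kinetic phase vanishes at some time of the step. -/
theorem SplitBounds.splitting_error_le (H : SplitBounds C A B) {f g F G : ℝ → ℝ} {t₀ t₁ a b δ : ℝ}
    {u : ℝ → R} (ht : t₀ ≤ t₁) (hu : IsTrajectory f g A B (Icc t₀ t₁) u a b)
    (hF : ∀ t ∈ Icc t₀ t₁, HasDerivWithinAt F (f t) (Icc t₀ t₁) t)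
    (hG : ∀ t ∈ Icc t₀ t₁, HasDerivWithinAt G (g t) (Icc t₀ t₁) t) (hG0 : G t₀ = 0)
    (hg : ∀ t ∈ Icc t₀ t₁, |g t| ≤ C) (hFδ : ∀ t ∈ Icc t₀ t₁, |F t| ≤ δ) :
    ‖phase (F t₁) A * (phase (G t₁) B * (phase (-F t₀) A * u t₀)) - u t₁‖ ≤
      C ^ 2 * (√(a * b) + b) * δ * (t₁ - t₀) := by
  have hC := H.one_le
  have hb0 : 0 ≤ b := (norm_nonneg _).trans (hu.bound t₀ (left_mem_Icc.2 ht))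
  have ha0 : 0 ≤ a := (norm_nonneg _).trans (hu.bound_left t₀ (left_mem_Icc.2 ht))
  have hδ0 : 0 ≤ δ := (abs_nonneg _).trans (hFδ t₀ (left_mem_Icc.2 ht))
  have key := Convex.norm_image_sub_le_of_norm_hasDerivWithin_le
    (C := C ^ 2 * (√(a * b) + b) * δ)
    (fun t ht => hasDerivWithinAt_double_interaction (hu.deriv t ht) (hF t ht) (hG t ht))
    (fun t ht => by
      rw [neg_smul, norm_neg, norm_I_smul, norm_smul, norm_phase_mul _ H.right_sa]
      have h1 := norm_conj_phase_sub_le H.left_sa B (phase (-F t) A * u t) (F t)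
        (C * (√(a * b) + b)) (fun r _ => by
          refine (H.norm_comm _).trans ?_
          rw [norm_mul_phase_mul _ H.left_sa, norm_mul_phase_mul _ H.left_sa,
            norm_phase_mul _ H.left_sa, norm_phase_mul _ H.left_sa]
          have := hu.bound t ht
          have := hu.bound_left t ht
          gcongr)
      calc ‖g t‖ * _ ≤ C * (C * (√(a * b) + b) * |F t|) := by
            gcongr
            exact hg t ht
        _ ≤ C * (C * (√(a * b) + b) * δ) := by
            gcongr
            exact hFδ t ht
        _ = _ := by ring)
    (convex_Icc t₀ t₁) (left_mem_Icc.2 ht) (right_mem_Icc.2 ht)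
  -- Undoing the two unitaries at the final time turns the local error into the increment of the
  -- double interaction picture over the step.
  have e : phase (F t₁) A * (phase (G t₁) B * (phase (-F t₀) A * u t₀)) - u t₁ =
      phase (F t₁) A * (phase (G t₁) B * (phase (-G t₀) B * (phase (-F t₀) A * u t₀) -
        phase (-G t₁) B * (phase (-F t₁) A * u t₁))) := by
    rw [mul_sub, mul_sub, phase_mul_phase_neg_mul, phase_mul_phase_neg_mul, hG0, neg_zero,
      phase_zero, one_mul]
  rw [e, norm_phase_mul _ H.left_sa, norm_phase_mul _ H.right_sa, norm_sub_rev]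
  rwa [Real.norm_of_nonneg (sub_nonneg.2 ht)] at key

end Splitting

/-! ### Symmetric splittings and replacement of the phases -/

section Splitting

variable {R : Type*} [CStarAlgebra R] {C : ℝ} {A B : R}

/-- The commutator varies slowly along a trajectory in the interaction picture. -/
theorem SplitBounds.norm_comm_interaction_sub_le (H : SplitBounds C A B) {f g F : ℝ → ℝ}
    {J : Set ℝ} {a b s c : ℝ} {u : ℝ → R} (hJ : Convex ℝ J) (hu : IsTrajectory f g A B J u a b)
    (hF : ∀ t ∈ J, HasDerivWithinAt F (f t) J t) (hg : ∀ t ∈ J, |g t| ≤ C) (hs : s ∈ J)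
    (hc : c ∈ J) :
    ‖(A * B - B * A) * (phase (-F s) A * u s) - (A * B - B * A) * (phase (-F c) A * u c)‖ ≤
      6 * C ^ 3 * (a + b) * |s - c| := by
  have hC := H.one_le
  refine Convex.norm_image_sub_le_of_norm_hasDerivWithin_le
    (fun t ht => (hasDerivWithinAt_interaction (hu.deriv t ht) (hF t ht)).const_mul
      (A * B - B * A)) (fun t ht => ?_) hJ hc hs
  have ha := hu.bound_left t ht
  have hb := hu.bound t ht
  have hBu : ‖phase (-F t) A * (B * u t)‖ ≤ C * b := by
    rw [norm_phase_mul _ H.left_sa]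
    exact (H.norm_right _).trans (by gcongr)
  have hABu : ‖A * (phase (-F t) A * (B * u t))‖ ≤ C * a + C * (2 * (a + b)) := by
    rw [norm_mul_phase_mul _ H.left_sa]
    -- Multiplication by the potential preserves the bound of A u, at the cost of a commutator; this
    -- allows the commutator bound to be applied to B u.
    have e : A * (B * u t) = B * (A * u t) + (A * B - B * A) * u t := by noncomm_ring
    rw [e]
    refine (norm_add_le _ _).trans (add_le_add ((H.norm_right _).trans ?_) (H.norm_comm_le ha hb))
    gcongr
  rw [neg_smul, mul_neg, norm_neg, mul_smul_comm, norm_I_smul, mul_smul_comm, norm_smul]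
  calc ‖g t‖ * _ ≤ C * (C * (2 * ((C * a + C * (2 * (a + b))) + C * b))) := by
        gcongr
        · exact hg t ht
        · exact H.norm_comm_le hABu hBu
    _ = 6 * C ^ 3 * (a + b) := by ring

/-- Local error of a symmetric splitting step. -/
theorem SplitBounds.symmetric_splitting_error_le (H : SplitBounds C A B)
    {f f' f'' g g' g'' F G : ℝ → ℝ} {c d a b : ℝ} {u : ℝ → R} (hd : 0 ≤ d)
    (hf : C2Bound C (Icc (c - d) (c + d)) f f' f'') (hg : C2Bound C (Icc (c - d) (c + d)) g g' g'')
    (hu : IsTrajectory f g A B (Icc (c - d) (c + d)) u a b)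
    (hF : ∀ t ∈ Icc (c - d) (c + d), HasDerivWithinAt F (f t) (Icc (c - d) (c + d)) t)
    (hG : ∀ t ∈ Icc (c - d) (c + d), HasDerivWithinAt G (g t) (Icc (c - d) (c + d)) t)
    (hFc : F c = 0) (hG0 : G (c - d) = 0) :
    ‖phase (F (c + d)) A * (phase (G (c + d)) B * (phase (-F (c - d)) A * u (c - d))) -
      u (c + d)‖ ≤ 30 * C ^ 5 * (a + b) * d ^ 3 := by
  have hC := H.one_le
  have hC0 : 0 ≤ C := by linarith
  set J := Icc (c - d) (c + d) with hJdef
  have hJ : Convex ℝ J := convex_Icc _ _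
  have hcJ : c ∈ J := ⟨by linarith, by linarith⟩
  have hx : c - d ∈ J := ⟨by linarith, by linarith⟩
  have hy : c + d ∈ J := ⟨by linarith, by linarith⟩
  have hh : ∀ t ∈ J, |t - c| ≤ d := fun t ht =>
    abs_le.2 ⟨by linarith [ht.1], by linarith [ht.2]⟩
  have hb0 : 0 ≤ b := (norm_nonneg _).trans (hu.bound c hcJ)
  have ha0 : 0 ≤ a := (norm_nonneg _).trans (hu.bound_left c hcJ)
  have hFb : ∀ t ∈ J, |F t| ≤ C * d := fun t ht => by
    have h := abs_sub_le_of_hasDerivWithinAt hF hf.bound₀ hJ hcJ ht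
    rw [hFc, sub_zero] at h
    exact h.trans (mul_le_mul_of_nonneg_left (hh t ht) hC0)
  have hGb : ∀ t ∈ J, |G t| ≤ C * (2 * d) := fun t ht => by
    have h := abs_sub_le_of_hasDerivWithinAt hG hg.bound₀ hJ hx ht
    rw [hG0, sub_zero] at h
    refine h.trans (mul_le_mul_of_nonneg_left ?_ hC0)
    exact abs_le.2 ⟨by linarith [ht.1], by linarith [ht.2]⟩
  set z := (A * B - B * A) * (phase (-F c) A * u c) with hz
  have hzb : ‖z‖ ≤ C * (2 * (a + b)) :=
    H.norm_comm_le (by rw [norm_mul_phase_mul _ H.left_sa]; exact hu.bound_left c hcJ)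
      (by rw [norm_phase_mul _ H.left_sa]; exact hu.bound c hcJ)
  -- The derivative equals f(c) g(c) (t - c) z up to O(d²). The primitive of this leading term is
  -- subtracted; being even about c, it cancels in the difference of the endpoint values.
  have hder : ∀ t ∈ J, HasDerivWithinAt
      (fun s => phase (-G s) B * (phase (-F s) A * u s) - (f c * g c / 2 * (s - c) ^ 2) • z)
      ((-Complex.I) • (g t • (phase (-G t) B *
        (phase (-F t) A * (B * (phase (F t) A * (phase (-F t) A * u t))) -
          B * (phase (-F t) A * u t)))) - (f c * g c * (t - c)) • z) J t := fun t ht => by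
    have h1 : HasDerivWithinAt (fun s : ℝ => f c * g c / 2 * (s - c) ^ 2) (f c * g c * (t - c))
        J t := by
      refine ((((hasDerivWithinAt_id t J).sub_const c).pow 2).const_mul
        (f c * g c / 2)).congr_deriv ?_
      simp only [id]
      push_cast
      ring
    exact (hasDerivWithinAt_double_interaction (hu.deriv t ht) (hF t ht) (hG t ht)).sub
      (h1.smul_const z)
  have hbd : ∀ t ∈ J, ‖(-Complex.I) • (g t • (phase (-G t) B *
        (phase (-F t) A * (B * (phase (F t) A * (phase (-F t) A * u t))) -
          B * (phase (-F t) A * u t)))) - (f c * g c * (t - c)) • z‖ ≤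
      15 * C ^ 5 * (a + b) * d ^ 2 := fun t ht => by
    set w := phase (-F t) A * u t with hw
    set X := (A * B - B * A) * w with hX
    have hAw : ∀ r, ‖A * (phase r A * w)‖ ≤ a := fun r => by
      rw [norm_mul_phase_mul _ H.left_sa, norm_mul_phase_mul _ H.left_sa]
      exact hu.bound_left t ht
    have hwb : ∀ r, ‖phase r A * w‖ ≤ b := fun r => by
      rw [norm_phase_mul _ H.left_sa, norm_phase_mul _ H.left_sa]
      exact hu.bound t ht
    have hXb : ‖X‖ ≤ C * (2 * (a + b)) :=
      H.norm_comm_le (by simpa [phase_zero] using hAw 0) (by simpa [phase_zero] using hwb 0)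
    have hr1 : ‖phase (-F t) A * (B * (phase (F t) A * w)) - B * w -
        F t • (Complex.I • X)‖ ≤ C * (a + b) * (C * d) ^ 2 := by
      refine (norm_conj_phase_sub_sub_le H.left_sa B w (F t) (C * (a + b)) (fun r _ =>
        (H.norm_comm_left _).trans ?_)).trans ?_
      · have := hAw r
        have := hwb r
        gcongr
      · have := hFb t ht
        gcongr
    set r1 := phase (-F t) A * (B * (phase (F t) A * w)) - B * w - F t • (Complex.I • X) with hr1'
    have hr2 : ‖phase (-G t) B * X - X‖ ≤ C * (2 * d) * (C * (C * (2 * (a + b)))) := by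
      refine (norm_phase_mul_sub_le _ H.right_sa X).trans ?_
      have h1 := hGb t ht
      have h2 := (H.norm_right X).trans (mul_le_mul_of_nonneg_left hXb hC0)
      rw [abs_neg]
      gcongr
    have hr3 : ‖X - z‖ ≤ 6 * C ^ 3 * (a + b) * d :=
      (H.norm_comm_interaction_sub_le hJ hu hF hg.bound₀ ht hcJ).trans (by
        have := hh t ht
        gcongr)
    have hr4 : |g t * F t - f c * g c * (t - c)| ≤ 2 * C ^ 2 * d ^ 2 := by
      have h1 := hf.abs_primitive_sub_le hF hJ hcJ hcJ ht hh
      rw [hFc, sub_zero] at h1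
      have h2 := (abs_sub_le_of_hasDerivWithinAt hg.deriv₁ hg.bound₁ hJ hcJ ht).trans
        (mul_le_mul_of_nonneg_left (hh t ht) hC0)
      have h3 : |F t| ≤ C * d := hFb t ht
      have h4 := hg.bound₀ c hcJ
      have h5 := h1.trans (mul_le_mul_of_nonneg_left (hh t ht) (by positivity))
      have e : g t * F t - f c * g c * (t - c) =
        (g t - g c) * F t + g c * (F t - f c * (t - c)) := by ring
      rw [e]
      refine (abs_add_le _ _).trans ?_
      rw [abs_mul, abs_mul]
      calc _ ≤ (C * d) * (C * d) + C * (C * d * d) := by gcongr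
        _ = _ := by ring
    -- The remainder collects the second-order expansion of the conjugation, the rotation by B, the
    -- drift of the commutator along the trajectory, and the linearization of g F at c. Each is
    -- O(d²); with `C ≥ 1` the constants add to 1 + 4 + 6 + 4 = 15.
    have e : (-Complex.I) • (g t • (phase (-G t) B *
        (phase (-F t) A * (B * (phase (F t) A * w)) - B * w))) - (f c * g c * (t - c)) • z =
        (-Complex.I) • (g t • (phase (-G t) B * r1)) +
        ((g t * F t) • ((phase (-G t) B * X - X) + (X - z)) +
        (g t * F t - f c * g c * (t - c)) • z) := by
      have e1 : phase (-F t) A * (B * (phase (F t) A * w)) - B * w =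
        r1 + F t • (Complex.I • X) := by rw [hr1']; abel
      have e2 : (-Complex.I) • (g t • (phase (-G t) B * (F t • (Complex.I • X)))) =
          (g t * F t) • (phase (-G t) B * X) := by
        rw [mul_smul_comm, mul_smul_comm, smul_comm (-Complex.I) (g t),
          smul_comm (-Complex.I) (F t), smul_smul, smul_smul]
        simp
      rw [e1, mul_add, smul_add, smul_add, e2, sub_smul, smul_add, smul_sub, smul_sub]
      abel
    rw [e]
    have n1 : ‖(-Complex.I) • (g t • (phase (-G t) B * r1))‖ ≤ C * (C * (a + b) * (C * d) ^ 2) := by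
      rw [neg_smul, norm_neg, norm_I_smul, norm_smul, norm_phase_mul _ H.right_sa]
      have := hg.bound₀ t ht
      rw [← Real.norm_eq_abs] at this
      gcongr
    have n2 : ‖(g t * F t) • ((phase (-G t) B * X - X) + (X - z))‖ ≤ (C * (C * d)) *
        (C * (2 * d) * (C * (C * (2 * (a + b)))) + 6 * C ^ 3 * (a + b) * d) := by
      rw [norm_smul, Real.norm_eq_abs, abs_mul]
      have h1 := hg.bound₀ t ht
      have h2 := hFb t ht
      have h3 := (norm_add_le _ _).trans (add_le_add hr2 hr3)
      gcongr
    have n3 : ‖(g t * F t - f c * g c * (t - c)) • z‖ ≤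
        2 * C ^ 2 * d ^ 2 * (C * (2 * (a + b))) := by
      rw [norm_smul, Real.norm_eq_abs]
      gcongr
    refine (norm_add_le _ _).trans ((add_le_add n1 ((norm_add_le _ _).trans
      (add_le_add n2 n3))).trans ?_)
    have h4 : C ^ 4 ≤ C ^ 5 := pow_le_pow_right₀ hC (by norm_num)
    have h3 : C ^ 3 ≤ C ^ 5 := pow_le_pow_right₀ hC (by norm_num)
    have h0 : 0 ≤ (a + b) * d ^ 2 := by positivity
    have := mul_le_mul_of_nonneg_right h4 h0
    have := mul_le_mul_of_nonneg_right h3 h0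
    nlinarith
  have key := Convex.norm_image_sub_le_of_norm_hasDerivWithin_le hder hbd hJ hx hy
  have e : phase (F (c + d)) A * (phase (G (c + d)) B * (phase (-F (c - d)) A * u (c - d))) -
      u (c + d) = phase (F (c + d)) A * (phase (G (c + d)) B *
        (phase (-G (c - d)) B * (phase (-F (c - d)) A * u (c - d)) -
        phase (-G (c + d)) B * (phase (-F (c + d)) A * u (c + d)))) := by
    rw [mul_sub, mul_sub, phase_mul_phase_neg_mul, phase_mul_phase_neg_mul, hG0, neg_zero,
      phase_zero, one_mul]
  rw [e, norm_phase_mul _ H.left_sa, norm_phase_mul _ H.right_sa, norm_sub_rev]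
  have e2 : (c + d - c) ^ 2 = (c - d - c) ^ 2 := by ring
  rw [e2, sub_sub_sub_cancel_right, show c + d - (c - d) = 2 * d by ring,
    Real.norm_of_nonneg (by positivity)] at key
  refine key.trans (le_of_eq ?_)
  ring

/-- Replacing both phases of a first-order splitting step. -/
theorem SplitBounds.norm_first_order_phases_sub_le (H : SplitBounds C A B)
    {α α' β β' a b δ : ℝ} {u : R} (hα : |α - α'| ≤ δ) (hβ : |β - β'| ≤ δ) (ha : ‖A * u‖ ≤ a)
    (hb : ‖u‖ ≤ b) :
    ‖phase β B * (phase α A * u) - phase β' B * (phase α' A * u)‖ ≤ δ * (a + C * b) := by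
  have hδ : 0 ≤ δ := (abs_nonneg _).trans hα
  have h1 : ‖phase (α - α') A * (phase α' A * u) - phase α' A * u‖ ≤ δ * a := by
    refine (norm_phase_mul_sub_le _ H.left_sa _).trans ?_
    rw [norm_mul_phase_mul _ H.left_sa]
    gcongr
  have h2 : ‖phase (β - β') B * (phase β' B * (phase α' A * u)) - phase β' B * (phase α' A * u)‖ ≤
      δ * (C * b) := by
    refine (norm_phase_mul_sub_le _ H.right_sa _).trans ?_
    have h := (H.norm_right (phase β' B * (phase α' A * u)))
    rw [norm_phase_mul _ H.right_sa, norm_phase_mul _ H.left_sa] at h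
    have := h.trans (mul_le_mul_of_nonneg_left hb (by linarith [H.one_le]))
    gcongr
  have e : phase β B * (phase α A * u) - phase β' B * (phase α' A * u) =
      phase β B * (phase (α - α') A * (phase α' A * u) - phase α' A * u) +
      (phase (β - β') B * (phase β' B * (phase α' A * u)) - phase β' B * (phase α' A * u)) := by
    rw [← mul_assoc (phase (α - α') A), ← phase_add, ← mul_assoc (phase (β - β') B), ← phase_add,
      sub_add_cancel, sub_add_cancel, mul_sub]
    abel
  rw [e, mul_add]
  refine (norm_add_le _ _).trans (add_le_add ?_ h2)
  rwa [norm_phase_mul _ H.right_sa]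

/-- Moving a kinetic phase δ from one side of the potential factor to the other gains a factor |β|,
because [A, e^{-iβB}] = e^{-iβB} (e^{iβB} A e^{-iβB} - A) is itself of size |β|. The gain is needed
since the half-step phases agree only up to h². -/
theorem SplitBounds.norm_phase_conj_phase_sub_le (H : SplitBounds C A B) {δ β a b : ℝ} {u : R}
    (hβ : |β| ≤ C) (ha : ‖A * u‖ ≤ a) (hb : ‖u‖ ≤ b) :
    ‖phase δ A * (phase β B * (phase (-δ) A * u)) - phase β B * u‖ ≤
      3 * C ^ 2 * (a + b) * |β| * |δ| := by
  have hC := H.one_le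
  have hb0 : 0 ≤ b := (norm_nonneg _).trans hb
  have ha0 : 0 ≤ a := (norm_nonneg _).trans ha
  have h := norm_conj_phase_sub_le H.left_sa (phase β B) u (-δ) (3 * C ^ 2 * (a + b) * |β|)
    (fun r _ => by
      set y := phase r A * u with hy
      have hya : ‖A * y‖ ≤ a := by rwa [norm_mul_phase_mul _ H.left_sa]
      have hyb : ‖y‖ ≤ b := by rwa [norm_phase_mul _ H.left_sa]
      -- Conjugating back by e^{iqB} costs only the bounded double commutator [B, [A, B]], so no
      -- bound on A e^{-iqB} y is required.
      have h1 : ∀ q, |q| ≤ |β| → ‖(B * A - A * B) * (phase q B * y)‖ ≤ 3 * C ^ 2 * (a + b) := by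
        intro q hq
        have h2 := norm_conj_phase_sub_le H.right_sa (A * B - B * A) y q (C * b) (fun r' _ => by
          refine (H.norm_comm_right _).trans ?_
          rw [norm_phase_mul _ H.right_sa]
          gcongr)
        have h3 := H.norm_comm_le hya hyb
        have e : (B * A - A * B) * (phase q B * y) = -((A * B - B * A) * (phase q B * y)) := by
          noncomm_ring
        rw [e, norm_neg, ← norm_phase_mul (-q) H.right_sa]
        have h4 := norm_le_norm_sub_add (phase (-q) B * ((A * B - B * A) * (phase q B * y)))
          ((A * B - B * A) * y)
        have h5 : C * b * |q| ≤ C * b * C := by gcongr; exact hq.trans hβ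
        have h6 : C ≤ C ^ 2 := by nlinarith
        have h7 := mul_le_mul_of_nonneg_right h6 (add_nonneg ha0 hb0)
        nlinarith [mul_nonneg (sq_nonneg C) ha0]
      have h2 := norm_conj_phase_sub_le H.right_sa A y β _ h1
      have e : (A * phase β B - phase β B * A) * y =
          phase β B * (phase (-β) B * (A * (phase β B * y)) - A * y) := by
        rw [mul_sub, phase_mul_phase_neg_mul]
        noncomm_ring
      rwa [e, norm_phase_mul _ H.right_sa])
  simpa using h

/-- Replacing the phases of a second-order splitting step. -/
theorem SplitBounds.norm_second_order_phases_sub_le (H : SplitBounds C A B)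
    {γ α₁ α₂ β β' a b δ η h : ℝ} {u : R} (hβ : |β| ≤ C) (hβh : |β| ≤ h) (hδ : |α₂ - γ| ≤ δ)
    (hα : |α₁ + α₂ - 2 * γ| ≤ η) (hββ : |β - β'| ≤ η) (ha : ‖A * u‖ ≤ a) (hb : ‖u‖ ≤ b) :
    ‖phase α₂ A * (phase β B * (phase α₁ A * u)) -
      phase γ A * (phase β' B * (phase γ A * u))‖ ≤
      η * (a + C * b) + 3 * C ^ 2 * (a + b) * h * δ := by
  have hC := H.one_le
  have hb0 : 0 ≤ b := (norm_nonneg _).trans hb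
  have ha0 : 0 ≤ a := (norm_nonneg _).trans ha
  have hh0 : 0 ≤ h := (abs_nonneg _).trans hβh
  set v := phase γ A * u with hv
  have hva : ‖A * v‖ ≤ a := by rwa [norm_mul_phase_mul _ H.left_sa]
  have hvb : ‖v‖ ≤ b := by rwa [norm_phase_mul _ H.left_sa]
  set x := phase (α₁ + α₂ - 2 * γ) A * v with hx
  have h1 := H.norm_phase_conj_phase_sub_le (δ := α₂ - γ) (u := x) (a := a) (b := b) hβ
    (by rwa [norm_mul_phase_mul _ H.left_sa]) (by rwa [norm_phase_mul _ H.left_sa])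
  have h2 : ‖phase β B * x - phase β' B * v‖ ≤ η * (a + C * b) := by
    have := H.norm_first_order_phases_sub_le (α := α₁ + α₂ - 2 * γ) (α' := 0) (β := β) (β' := β')
      (δ := η) (by simpa using hα) hββ hva hvb
    rwa [phase_zero, one_mul] at this
  -- The total kinetic phase is accurate to η and is treated as in first order; the imbalance
  -- between the two halves enters only through a conjugation of the potential factor.
  have e : phase α₂ A * (phase β B * (phase α₁ A * u)) -
      phase γ A * (phase β' B * v) = phase γ A * ((phase β B * x - phase β' B * v) +
      (phase (α₂ - γ) A * (phase β B * (phase (-(α₂ - γ)) A * x)) - phase β B * x)) := by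
    have e1 : phase (-(α₂ - γ)) A * x = phase α₁ A * u := by
      rw [hx, hv, ← mul_assoc, ← mul_assoc, ← phase_add, ← phase_add]
      congr 2
      ring
    have e2 : ∀ y, phase α₂ A * y = phase γ A * (phase (α₂ - γ) A * y) := fun y => by
      rw [← mul_assoc, ← phase_add]
      congr 2
      ring
    rw [e1, e2, ← mul_sub]
    congr 1
    abel
  rw [e, norm_phase_mul _ H.left_sa]
  refine (norm_add_le _ _).trans (add_le_add h2 (h1.trans ?_))
  gcongr

end Splitting

/-! ### Local errors of the Trotter formulae -/

theorem hasDerivWithinAt_integral_Icc {f : ℝ → ℝ} {a b p t : ℝ} (hf : ContinuousOn f (Icc a b))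
    (hp : p ∈ Icc a b) (ht : t ∈ Icc a b) :
    HasDerivWithinAt (fun s => ∫ r in p..s, f r) (f t) (Icc a b) t := by
  have : Fact (t ∈ Icc a b) := ⟨ht⟩
  have hi : IntervalIntegrable f volume p t :=
    (hf.mono (uIcc_subset_Icc hp ht)).intervalIntegrable
  exact intervalIntegral.integral_hasDerivWithinAt_right hi
    (hf.stronglyMeasurableAtFilter_nhdsWithin measurableSet_Icc t) (hf t ht)

theorem C2Bound.continuousOn {C : ℝ} {J : Set ℝ} {f f' f'' : ℝ → ℝ} (h : C2Bound C J f f' f'') :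
    ContinuousOn f J := fun t ht => (h.deriv₁ t ht).continuousWithinAt

section Steps

variable {n : ℕ} {A B : Matrix (Fin n) (Fin n) ℂ} {C a b h t : ℝ} {f f' f'' g g' g'' : ℝ → ℝ}
  {u : ℝ → Matrix (Fin n) (Fin n) ℂ}

theorem expI_eq_phase (r : ℝ) (Z : Matrix (Fin n) (Fin n) ℂ) : expI r Z = phase r Z := rfl

theorem C2Bound.abs_integral_le (hf : C2Bound C (Icc t (t + h)) f f' f'') {p s : ℝ}
    (hp : p ∈ Icc t (t + h)) (hs : s ∈ Icc t (t + h)) : |∫ r in p..s, f r| ≤ C * h := by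
  have hC : 0 ≤ C := (abs_nonneg _).trans (hf.bound₀ p hp)
  refine (intervalIntegral.norm_integral_le_of_norm_le_const (f := f) (C := C) fun r hr =>
    hf.bound₀ r (uIcc_subset_Icc hp hs (uIoc_subset_uIcc hr))).trans ?_
  exact mul_le_mul_of_nonneg_left
    (abs_le.2 ⟨by linarith [hp.2, hs.1], by linarith [hp.1, hs.2]⟩) hC

/-- The kinetic primitive is normalized at the end of the step, so the left kinetic factor is
trivial and the splitting is exactly the generalized formula. -/
theorem SplitBounds.gen₁_error_le (H : SplitBounds C A B) (hh : 0 ≤ h)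
    (hf : C2Bound C (Icc t (t + h)) f f' f'') (hg : C2Bound C (Icc t (t + h)) g g' g'')
    (hu : IsTrajectory f g A B (Icc t (t + h)) u a b) :
    ‖gen₁ f g A B h t * u t - u (t + h)‖ ≤ C ^ 3 * (√(a * b) + b) * h ^ 2 := by
  have h0 : t ∈ Icc t (t + h) := ⟨le_rfl, by linarith⟩
  have h1 : t + h ∈ Icc t (t + h) := ⟨by linarith, le_rfl⟩
  have key := H.splitting_error_le (F := fun s => ∫ r in (t + h)..s, f r)
    (G := fun s => ∫ r in t..s, g r) (δ := C * h) (by linarith) hu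
    (fun s hs => hasDerivWithinAt_integral_Icc hf.continuousOn h1 hs)
    (fun s hs => hasDerivWithinAt_integral_Icc hg.continuousOn h0 hs) (by simp) hg.bound₀
    (fun s hs => hf.abs_integral_le h1 hs)
  simp only [intervalIntegral.integral_same, phase_zero, one_mul,
    ← intervalIntegral.integral_symm] at key
  rw [gen₁, mul_assoc]
  refine key.trans (le_of_eq ?_)
  ring

/-- The endpoint rule misses the kinetic phase by O(h²), and this error multiplies A u itself rather
than a commutator. Hence a replaces the geometric mean √(a b). -/
theorem SplitBounds.std₁_error_le (H : SplitBounds C A B) (hh : 0 ≤ h)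
    (hf : C2Bound C (Icc t (t + h)) f f' f'') (hg : C2Bound C (Icc t (t + h)) g g' g'')
    (hu : IsTrajectory f g A B (Icc t (t + h)) u a b) :
    ‖std₁ f g A B h t * u t - u (t + h)‖ ≤ 3 * C ^ 3 * (a + b) * h ^ 2 := by
  have hC := H.one_le
  have h0 : t ∈ Icc t (t + h) := ⟨le_rfl, by linarith⟩
  have h1 : t + h ∈ Icc t (t + h) := ⟨by linarith, le_rfl⟩
  have hb0 : 0 ≤ b := (norm_nonneg _).trans (hu.bound t h0)
  have ha0 : 0 ≤ a := (norm_nonneg _).trans (hu.bound_left t h0)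
  have hq : ∀ {f f' f'' : ℝ → ℝ}, C2Bound C (Icc t (t + h)) f f' f'' →
      |h * f (t + h) - ∫ r in t..t + h, f r| ≤ C * h ^ 2 := fun {f f' f''} hf => by
    have := hf.abs_primitive_sub_le (F := fun s => ∫ r in t..s, f r) (h := h) (c := t + h)
      (x := t) (y := t + h)
      (fun s hs => hasDerivWithinAt_integral_Icc hf.continuousOn h0 hs) (convex_Icc _ _) h1 h0 h1
      (fun s hs => abs_le.2 ⟨by linarith [hs.1], by linarith [hs.2]⟩)
    simp only [intervalIntegral.integral_same, sub_zero, add_sub_cancel_left,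
      abs_of_nonneg hh] at this
    rw [abs_sub_comm, mul_comm h]
    refine this.trans (le_of_eq (by ring))
  have k1 := H.norm_first_order_phases_sub_le (hq hf) (hq hg) (hu.bound_left t h0) (hu.bound t h0)
  have k2 := H.gen₁_error_le hh hf hg hu
  have k3 := sqrt_mul_add_le ha0 hb0 le_rfl le_rfl
  have e : std₁ f g A B h t * u t - u (t + h) =
      (phase (h * g (t + h)) B * (phase (h * f (t + h)) A * u t) -
        phase (∫ r in t..t + h, g r) B * (phase (∫ r in t..t + h, f r) A * u t)) +
      (gen₁ f g A B h t * u t - u (t + h)) := by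
    rw [std₁, gen₁, mul_assoc, mul_assoc]
    simp only [expI_eq_phase]
    abel
  rw [e]
  refine (norm_add_le _ _).trans ((add_le_add k1 k2).trans ?_)
  have c1 : C ≤ C ^ 3 := le_self_pow₀ hC (by norm_num)
  have c2 : C ^ 2 ≤ C ^ 3 := pow_le_pow_right₀ hC (by norm_num)
  calc C * h ^ 2 * (a + C * b) + C ^ 3 * (√(a * b) + b) * h ^ 2
      = (C * a + C ^ 2 * b + C ^ 3 * (√(a * b) + b)) * h ^ 2 := by ring
    _ ≤ (C ^ 3 * a + C ^ 3 * b + C ^ 3 * (2 * (a + b))) * h ^ 2 := by gcongr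
    _ = _ := by ring

/-- The kinetic primitive is normalized at the midpoint, which splits its phase into the two
half-step integrals. -/
theorem SplitBounds.gen₂_error_le (H : SplitBounds C A B) (hh : 0 ≤ h)
    (hf : C2Bound C (Icc t (t + h)) f f' f'') (hg : C2Bound C (Icc t (t + h)) g g' g'')
    (hu : IsTrajectory f g A B (Icc t (t + h)) u a b) :
    ‖gen₂ f g A B h t * u t - u (t + h)‖ ≤ 30 * C ^ 5 * (a + b) * (h / 2) ^ 3 := by
  have e0 : t + h / 2 - h / 2 = t := by ring
  have e1 : t + h / 2 + h / 2 = t + h := by ring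
  have h0 : t ∈ Icc t (t + h) := ⟨le_rfl, by linarith⟩
  have hm : t + h / 2 ∈ Icc t (t + h) := ⟨by linarith, by linarith⟩
  have key := H.symmetric_splitting_error_le (f := f) (g := g) (F := fun s => ∫ r in (t + h / 2)..s, f r)
    (G := fun s => ∫ r in t..s, g r) (c := t + h / 2) (d := h / 2) (a := a) (b := b) (u := u)
    (by linarith) (by rwa [e0, e1]) (by rwa [e0, e1]) (by rwa [e0, e1])
    (by
      rw [e0, e1]
      exact fun s hs => hasDerivWithinAt_integral_Icc hf.continuousOn hm hs)
    (by
      rw [e0, e1]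
      exact fun s hs => hasDerivWithinAt_integral_Icc hg.continuousOn h0 hs)
    (by simp) (by simp)
  rw [e0, e1] at key
  simp only [← intervalIntegral.integral_symm] at key
  rwa [gen₂, mul_assoc, mul_assoc]

/-- The midpoint rule has error O(h³) for the two total phases. The half-step kinetic phases are off
by O(h²), but nearly oppositely, and the imbalance gains a further factor h from the potential
phase. The condition h ≤ 1 keeps that phase below C. -/
theorem SplitBounds.std₂_error_le (H : SplitBounds C A B) (hh : 0 ≤ h) (hh1 : h ≤ 1)
    (hf : C2Bound C (Icc t (t + h)) f f' f'') (hg : C2Bound C (Icc t (t + h)) g g' g'')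
    (hu : IsTrajectory f g A B (Icc t (t + h)) u a b) :
    ‖std₂ f g A B h t * u t - u (t + h)‖ ≤ 5 * C ^ 5 * (a + b) * h ^ 3 := by
  have hC := H.one_le
  have h0 : t ∈ Icc t (t + h) := ⟨le_rfl, by linarith⟩
  have h1 : t + h ∈ Icc t (t + h) := ⟨by linarith, le_rfl⟩
  have hm : t + h / 2 ∈ Icc t (t + h) := ⟨by linarith, by linarith⟩
  have hb0 : 0 ≤ b := (norm_nonneg _).trans (hu.bound t h0)
  have ha0 : 0 ≤ a := (norm_nonneg _).trans (hu.bound_left t h0)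
  have hq : ∀ {f f' f'' : ℝ → ℝ}, C2Bound C (Icc t (t + h)) f f' f'' →
      |(∫ r in t..t + h, f r) - h * f (t + h / 2)| ≤ 2 * C * (h / 2) ^ 3 := fun {f f' f''} hf => by
    have e0 : t + h / 2 - h / 2 = t := by ring
    have e1 : t + h / 2 + h / 2 = t + h := by ring
    have := C2Bound.abs_primitive_midpoint_le (F := fun s => ∫ r in t..s, f r) (C := C)
      (c := t + h / 2) (d := h / 2) (f := f) (f' := f') (f'' := f'') (by linarith)
      (by rwa [e0, e1])
      (by
        rw [e0, e1]
        exact fun s hs => hasDerivWithinAt_integral_Icc hf.continuousOn h0 hs)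
    simp only [e0, e1, intervalIntegral.integral_same, sub_zero] at this
    rwa [show h * f (t + h / 2) = f (t + h / 2) * (2 * (h / 2)) by ring]
  -- The evaluation point is an endpoint of this half-interval, so only second order is available
  -- here.
  have hδ : |(∫ r in (t + h / 2)..(t + h), f r) - h / 2 * f (t + h / 2)| ≤ C * (h / 2) ^ 2 := by
    have := hf.abs_primitive_sub_le (F := fun s => ∫ r in (t + h / 2)..s, f r) (h := h / 2)
      (c := t + h / 2) (x := t + h / 2) (y := t + h)
      (fun s hs => hasDerivWithinAt_integral_Icc hf.continuousOn hm hs) (convex_Icc _ _) hm hm h1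
      (fun s hs => abs_le.2 ⟨by linarith [hs.1], by linarith [hs.2]⟩)
    rw [intervalIntegral.integral_same, sub_zero, show t + h - (t + h / 2) = h / 2 by ring,
      abs_of_nonneg (by linarith : 0 ≤ h / 2), mul_comm (f _)] at this
    exact this.trans (le_of_eq (by ring))
  have hsum : |(∫ r in t..(t + h / 2), f r) + (∫ r in (t + h / 2)..(t + h), f r) -
      2 * (h / 2 * f (t + h / 2))| ≤ 2 * C * (h / 2) ^ 3 := by
    have hi : ∀ {p q}, p ∈ Icc t (t + h) → q ∈ Icc t (t + h) → IntervalIntegrable f volume p q :=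
      fun hp hq' => (hf.continuousOn.mono (uIcc_subset_Icc hp hq')).intervalIntegrable
    rw [intervalIntegral.integral_add_adjacent_intervals (hi h0 hm) (hi hm h1),
      show 2 * (h / 2 * f (t + h / 2)) = h * f (t + h / 2) by ring]
    exact hq hf
  have hβ := hg.abs_integral_le h0 h1
  have k1 := H.norm_second_order_phases_sub_le (h := C * h) (hβ.trans (by nlinarith)) hβ hδ hsum
    (hq hg) (hu.bound_left t h0) (hu.bound t h0)
  have k2 := H.gen₂_error_le hh hf hg hu
  have e : std₂ f g A B h t * u t - u (t + h) = (gen₂ f g A B h t * u t - u (t + h)) -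
      (phase (∫ r in (t + h / 2)..(t + h), f r) A * (phase (∫ r in t..t + h, g r) B *
        (phase (∫ r in t..(t + h / 2), f r) A * u t)) -
        phase (h / 2 * f (t + h / 2)) A * (phase (h * g (t + h / 2)) B *
        (phase (h / 2 * f (t + h / 2)) A * u t))) := by
    rw [std₂, gen₂, mul_assoc, mul_assoc, mul_assoc, mul_assoc]
    simp only [expI_eq_phase]
    abel
  rw [e]
  refine (norm_sub_le _ _).trans ((add_le_add k2 k1).trans ?_)
  have c1 : C ≤ C ^ 5 := le_self_pow₀ hC (by norm_num)
  have c2 : C ^ 2 ≤ C ^ 5 := pow_le_pow_right₀ hC (by norm_num)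
  have c4 : C ^ 4 ≤ C ^ 5 := pow_le_pow_right₀ hC (by norm_num)
  calc 30 * C ^ 5 * (a + b) * (h / 2) ^ 3 + (2 * C * (h / 2) ^ 3 * (a + C * b) +
        3 * C ^ 2 * (a + b) * (C * h) * (C * (h / 2) ^ 2))
      = (30 / 8 * C ^ 5 * (a + b) + (1 / 4 * (C * a + C ^ 2 * b) + 3 / 4 * C ^ 4 * (a + b))) *
          h ^ 3 := by ring
    _ ≤ (30 / 8 * C ^ 5 * (a + b) + (1 / 4 * (C ^ 5 * a + C ^ 5 * b) +
          3 / 4 * C ^ 5 * (a + b))) * h ^ 3 := by gcongr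
    _ ≤ 5 * C ^ 5 * (a + b) * h ^ 3 := by
        have : 0 ≤ C ^ 5 * (a + b) := by positivity
        have : 0 ≤ C ^ 5 * (a + b) * h ^ 3 := by positivity
        linarith

/-- Accumulation of local errors for isometric steps. -/
theorem norm_steps_mul_sub_le {S : ℝ → ℝ → Matrix (Fin n) (Fin n) ℂ} {E : ℝ} {L : ℕ}
    (hS : ∀ h t v, ‖S h t * v‖ = ‖v‖)
    (hloc : ∀ l < L, ‖S h (l * h) * u (l * h) - u (l * h + h)‖ ≤ E) :
    ∀ l ≤ L, ‖steps S h l * u 0 - u (l * h)‖ ≤ l * E := by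
  intro l
  induction l with
  | zero => simp [steps]
  | succ l ih =>
    intro hl
    have e : steps S h (l + 1) * u 0 - u ((l + 1 : ℕ) * h) =
        S h (l * h) * (steps S h l * u 0 - u (l * h)) +
        (S h (l * h) * u (l * h) - u (l * h + h)) := by
      rw [steps, mul_sub, mul_assoc]
      push_cast
      rw [add_mul, one_mul]
      abel
    rw [e]
    refine (norm_add_le _ _).trans ?_
    rw [hS]
    push_cast
    linarith [ih (by omega), hloc l (by omega)]

/-- The factor of the time step in the local error of a scheme. -/
noncomputable def Scheme.localError (σ : Scheme) (C a b h : ℝ) : ℝ :=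
  match σ with
  | .standard₁ => 3 * C ^ 3 * (a + b) * h ^ 2
  | .generalized₁ => C ^ 3 * (√(a * b) + b) * h ^ 2
  | .standard₂ | .generalized₂ => 5 * C ^ 5 * (a + b) * h ^ 3

theorem Scheme.norm_evolution_mul_sub_le (σ : Scheme) {M ω V : ℝ → ℝ} {T : ℝ} {L : ℕ}
    (H : SplitBounds C (H₁ n) (H₂ n V)) (hT : 0 ≤ T) (hL : 0 < L) (hTL : T ≤ L)
    (hf : C2Bound C (Icc 0 T) (f₁ M) f' f'') (hg : C2Bound C (Icc 0 T) (f₂ M ω) g' g'')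
    (hu : IsTrajectory (f₁ M) (f₂ M ω) (H₁ n) (H₂ n V) (Icc 0 T) u a b) :
    ‖σ.evolution n M ω V T L * u 0 - u T‖ ≤ L * σ.localError C a b (T / L) := by
  have hL' : (0 : ℝ) < L := by exact_mod_cast hL
  have hh : 0 ≤ T / L := by positivity
  have hh1 : T / L ≤ 1 := (div_le_one hL').2 hTL
  have hS : ∀ h t v, ‖σ.step n M ω V h t * v‖ = ‖v‖ := by
    intro h t v
    cases σ <;> simp only [Scheme.step, std₁, gen₁, std₂, gen₂, mul_assoc, expI_eq_phase,
      norm_phase_mul _ H.left_sa, norm_phase_mul _ H.right_sa]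
  have key := norm_steps_mul_sub_le (u := u) (E := σ.localError C a b (T / L)) hS
    (L := L) (h := T / L) (fun l hl => by
      have hsub : Icc (l * (T / L)) (l * (T / L) + T / L) ⊆ Icc 0 T := by
        refine Icc_subset_Icc (by positivity) ?_
        have h1 : ((l : ℝ) + 1) ≤ L := by exact_mod_cast hl
        calc l * (T / L) + T / L = (l + 1) * (T / L) := by ring
          _ ≤ L * (T / L) := by gcongr
          _ = T := by field_simp
      cases σ
      · exact H.std₁_error_le hh (hf.mono hsub) (hg.mono hsub) (hu.mono hsub)
      · exact H.gen₁_error_le hh (hf.mono hsub) (hg.mono hsub) (hu.mono hsub)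
      · exact H.std₂_error_le hh hh1 (hf.mono hsub) (hg.mono hsub) (hu.mono hsub)
      · refine (H.gen₂_error_le hh (hf.mono hsub) (hg.mono hsub) (hu.mono hsub)).trans ?_
        have h0 : (0 : ℝ) ∈ Icc 0 T := ⟨le_rfl, hT⟩
        have hb0 : 0 ≤ b := (norm_nonneg _).trans (hu.bound 0 h0)
        have ha0 : 0 ≤ a := (norm_nonneg _).trans (hu.bound_left 0 h0)
        have hC0 : 0 ≤ C := zero_le_one.trans H.one_le
        have : 0 ≤ C ^ 5 * (a + b) * (T / L) ^ 3 := by positivity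
        simp only [Scheme.localError]
        nlinarith) L le_rfl
  rwa [show (L : ℝ) * (T / L) = T by field_simp] at key

end Steps

/-! ### Commutators of difference operators -/

section Difference

variable {R : Type*} [CStarAlgebra R]

/-- Two-sided translates `b k` of `b 0` by a unitary `S`, with small finite differences: the mesh
width is `1 / N`. -/
structure ShiftBounds (K N : ℝ) (S : R) (b : ℤ → R) : Prop where
  nonneg : 0 ≤ K
  pos : 0 < N
  star_mul : star S * S = 1
  mul_star : S * star S = 1
  shift : ∀ k, S * b k = b (k + 1) * S
  commute : ∀ j k, b j * b k = b k * b j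
  diff₀ : ‖b 0‖ ≤ K
  diff₁ : ∀ k, N * ‖b (k + 1) - b k‖ ≤ K
  diff₂ : ∀ k, N ^ 2 * ‖b (k + 2) - 2 * b (k + 1) + b k‖ ≤ K
  diff₃ : ∀ k, N ^ 3 * ‖b (k + 3) - 3 * b (k + 2) + 3 * b (k + 1) - b k‖ ≤ K
  diff₄ : ∀ k, N ^ 4 * ‖b (k + 4) - 4 * b (k + 3) + 6 * b (k + 2) - 4 * b (k + 1) + b k‖ ≤ K

/-- The second difference operator of a unitary shift. -/
noncomputable def shiftLaplacian (N : ℝ) (S : R) : R := N ^ 2 • (2 - (S + star S))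

theorem isSelfAdjoint_shiftLaplacian (N : ℝ) (S : R) : IsSelfAdjoint (shiftLaplacian N S) := by
  rw [IsSelfAdjoint, shiftLaplacian, star_smul, star_sub, star_add, star_star, add_comm (star S)]
  simp

theorem shiftLaplacian_comm (N : ℝ) (S X : R) :
    shiftLaplacian N S * X - X * shiftLaplacian N S =
      -(N ^ 2 • ((S + star S) * X - X * (S + star S))) := by
  rw [shiftLaplacian, smul_mul_assoc, mul_smul_comm, ← smul_sub, ← smul_neg]
  congr 1
  noncomm_ring

theorem shiftLaplacian_comm_comm (N : ℝ) (S X : R) :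
    shiftLaplacian N S * (shiftLaplacian N S * X - X * shiftLaplacian N S) -
      (shiftLaplacian N S * X - X * shiftLaplacian N S) * shiftLaplacian N S =
      N ^ 4 • ((S + star S) * ((S + star S) * X - X * (S + star S)) -
        ((S + star S) * X - X * (S + star S)) * (S + star S)) := by
  rw [shiftLaplacian_comm, shiftLaplacian_comm, mul_neg, neg_mul,
    mul_smul_comm, smul_mul_assoc, ← neg_sub_neg]
  simp only [neg_neg, smul_sub, smul_smul]
  rw [← pow_add]
  abel

namespace ShiftBounds

variable {K N : ℝ} {S : R} {b : ℤ → R}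

theorem star_shift (H : ShiftBounds K N S b) (k : ℤ) : star S * b (k + 1) = b k * star S := by
  calc star S * b (k + 1) = star S * (b (k + 1) * S) * star S := by
        rw [mul_assoc, mul_assoc, H.mul_star, mul_one]
    _ = b k * star S := by rw [← H.shift, ← mul_assoc, H.star_mul, one_mul]

theorem mem_unitary (H : ShiftBounds K N S b) : S ∈ unitary R := ⟨H.star_mul, H.mul_star⟩

theorem star_mem_unitary (H : ShiftBounds K N S b) : star S ∈ unitary R :=
  Unitary.star_mem H.mem_unitary

/-- Summation by parts: (S - 1)*(S - 1) = 2 - S - S*, so the square of the left side is ‖v* A v‖ for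
A the Laplacian. This interpolation inequality is the source of the geometric mean in the commutator
bound. -/
theorem norm_shift_sub_one_mul_le (H : ShiftBounds K N S b) (v : R) :
    N * ‖(S - 1) * v‖ ≤ √(‖shiftLaplacian N S * v‖ * ‖v‖) := by
  have hN := H.pos
  refine Real.le_sqrt_of_sq_le ?_
  have e : star ((S - 1) * v) * ((S - 1) * v) = star v * ((2 - (S + star S)) * v) := by
    have : (star S - 1) * (S - 1) = 2 - (S + star S) := by
      rw [sub_mul, mul_sub, H.star_mul, ← one_add_one_eq_two]
      noncomm_ring
    rw [StarMul.star_mul, star_sub, star_one, mul_assoc, ← mul_assoc (star S - 1), this]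
  have h1 : ‖(S - 1) * v‖ * ‖(S - 1) * v‖ ≤ ‖v‖ * ‖(2 - (S + star S)) * v‖ := by
    rw [← CStarRing.norm_star_mul_self, e]
    exact (norm_mul_le _ _).trans (by rw [norm_star])
  rw [shiftLaplacian, smul_mul_assoc, norm_smul, Real.norm_of_nonneg (by positivity)]
  have := mul_le_mul_of_nonneg_left h1 (sq_nonneg N)
  linarith

theorem norm_star_shift_sub_one_mul (H : ShiftBounds K N S b) (v : R) :
    ‖(star S - 1) * v‖ = ‖(S - 1) * v‖ := by
  have e : (star S - 1) * v = -(star S * ((S - 1) * v)) := by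
    rw [← mul_assoc, mul_sub, H.star_mul]
    noncomm_ring
  rw [e, norm_neg, CStarRing.norm_mem_unitary_mul _ H.star_mem_unitary]

/-- Discrete form of [∂², V] = 2 V' ∂ + V''. The factor N² of the Laplacian is shared between a
difference of b and one of v, or is used up by a second difference of b. -/
theorem comm_eq (H : ShiftBounds K N S b) :
    (S + star S) * b 0 - b 0 * (S + star S) =
      (b 1 - b 0) * (S - 1) - (b 0 - b (-1)) * (star S - 1) + (b 1 - 2 * b 0 + b (-1)) := by
  have h1 := H.shift 0
  have h2 := H.star_shift (-1)
  norm_num at h1 h2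
  rw [add_mul, h1, h2]
  noncomm_ring

theorem norm_comm_le (H : ShiftBounds K N S b) (v : R) :
    ‖(shiftLaplacian N S * b 0 - b 0 * shiftLaplacian N S) * v‖ ≤
      2 * K * (N * ‖(S - 1) * v‖) + K * ‖v‖ := by
  have hN := H.pos
  have d1 := H.diff₁ 0
  have d2 := H.diff₁ (-1)
  have d3 := H.diff₂ (-1)
  norm_num at d1 d2 d3
  rw [shiftLaplacian_comm, neg_mul, norm_neg, H.comm_eq, smul_mul_assoc, norm_smul,
    Real.norm_of_nonneg (by positivity), add_mul, sub_mul, mul_assoc, mul_assoc]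
  have n1 := norm_mul_le (b 1 - b 0) ((S - 1) * v)
  have n2 := norm_mul_le (b 0 - b (-1)) ((star S - 1) * v)
  rw [H.norm_star_shift_sub_one_mul] at n2
  have n3 := norm_mul_le (b 1 - 2 * b 0 + b (-1)) v
  have n4 := norm_add_le ((b 1 - b 0) * ((S - 1) * v) - (b 0 - b (-1)) * ((star S - 1) * v))
    ((b 1 - 2 * b 0 + b (-1)) * v)
  have n5 := norm_sub_le ((b 1 - b 0) * ((S - 1) * v)) ((b 0 - b (-1)) * ((star S - 1) * v))
  have h0 : 0 ≤ N * ‖(S - 1) * v‖ := by positivity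
  calc _ ≤ N ^ 2 * (‖b 1 - b 0‖ * ‖(S - 1) * v‖ + ‖b 0 - b (-1)‖ * ‖(S - 1) * v‖ +
        ‖b 1 - 2 * b 0 + b (-1)‖ * ‖v‖) := by gcongr; linarith
    _ = (N * ‖b 1 - b 0‖) * (N * ‖(S - 1) * v‖) + (N * ‖b 0 - b (-1)‖) * (N * ‖(S - 1) * v‖) +
        (N ^ 2 * ‖b 1 - 2 * b 0 + b (-1)‖) * ‖v‖ := by ring
    _ ≤ K * (N * ‖(S - 1) * v‖) + K * (N * ‖(S - 1) * v‖) + K * ‖v‖ := by gcongr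
    _ = _ := by ring

/-- Discrete form of [V, [∂², V]] = -2 (V')²: since the translates of b commute, only products of
two first differences survive. -/
theorem comm_right_eq (H : ShiftBounds K N S b) :
    b 0 * ((S + star S) * b 0 - b 0 * (S + star S)) -
      ((S + star S) * b 0 - b 0 * (S + star S)) * b 0 =
      -((b 1 - b 0) * ((b 1 - b 0) * S) + (b 0 - b (-1)) * ((b 0 - b (-1)) * star S)) := by
  have h1 := H.shift 0
  have h2 := H.star_shift (-1)
  norm_num at h1 h2
  have c1 : ∀ x, b 1 * (b 0 * x) = b 0 * (b 1 * x) := fun x => by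
    rw [← mul_assoc, H.commute, mul_assoc]
  have c2 : ∀ x, b (-1) * (b 0 * x) = b 0 * (b (-1) * x) := fun x => by
    rw [← mul_assoc, H.commute, mul_assoc]
  simp only [mul_add, add_mul, mul_sub, sub_mul, mul_assoc, h1, h2, c1, c2]
  abel

theorem norm_comm_right_le (H : ShiftBounds K N S b) (v : R) :
    ‖(b 0 * (shiftLaplacian N S * b 0 - b 0 * shiftLaplacian N S) -
      (shiftLaplacian N S * b 0 - b 0 * shiftLaplacian N S) * b 0) * v‖ ≤ 2 * K ^ 2 * ‖v‖ := by
  have hN := H.pos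
  have hK := H.nonneg
  have d1 := H.diff₁ 0
  have d2 := H.diff₁ (-1)
  norm_num at d1 d2
  have e : b 0 * (shiftLaplacian N S * b 0 - b 0 * shiftLaplacian N S) -
      (shiftLaplacian N S * b 0 - b 0 * shiftLaplacian N S) * b 0 =
      N ^ 2 • ((b 1 - b 0) * ((b 1 - b 0) * S) + (b 0 - b (-1)) * ((b 0 - b (-1)) * star S)) := by
    rw [← neg_neg ((b 1 - b 0) * _ + _), ← H.comm_right_eq, shiftLaplacian_comm, mul_neg, neg_mul,
      mul_smul_comm, smul_mul_assoc]
    simp only [smul_neg, smul_sub]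
    abel
  have n1 : ∀ {X U : R}, U ∈ unitary R → ‖X * (X * U) * v‖ ≤ ‖X‖ * (‖X‖ * ‖v‖) :=
    fun {X U} hU => by
      rw [mul_assoc, mul_assoc]
      refine (norm_mul_le _ _).trans ?_
      gcongr
      exact (norm_mul_le _ _).trans (by rw [CStarRing.norm_mem_unitary_mul _ hU])
  rw [e, smul_mul_assoc, norm_smul, Real.norm_of_nonneg (by positivity), add_mul]
  calc _ ≤ N ^ 2 * (‖b 1 - b 0‖ * (‖b 1 - b 0‖ * ‖v‖) +
        ‖b 0 - b (-1)‖ * (‖b 0 - b (-1)‖ * ‖v‖)) := by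
        gcongr
        exact (norm_add_le _ _).trans (add_le_add (n1 H.mem_unitary) (n1 H.star_mem_unitary))
    _ = ((N * ‖b 1 - b 0‖) * (N * ‖b 1 - b 0‖) +
        (N * ‖b 0 - b (-1)‖) * (N * ‖b 0 - b (-1)‖)) * ‖v‖ := by ring
    _ ≤ (K * K + K * K) * ‖v‖ := by gcongr
    _ = _ := by ring

/-- Discrete form of [∂², [∂², V]] = 4 V'' ∂² + 4 V''' ∂ + V''''. The differences of b and of v have
total order four in each term, which absorbs N⁴; the last term is why four derivatives of V are
needed. -/
theorem comm_left_eq (H : ShiftBounds K N S b) :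
    (S + star S) * ((S + star S) * b 0 - b 0 * (S + star S)) -
      ((S + star S) * b 0 - b 0 * (S + star S)) * (S + star S) =
      ((b 2 - 3 * b 1 + 3 * b 0 - b (-1)) + (b 1 - 3 * b 0 + 3 * b (-1) - b (-2))) * (S * S - 1) +
      (b 0 - 2 * b (-1) + b (-2)) * (S * S + star S * star S - 2) +
      (b 2 - 4 * b 1 + 6 * b 0 - 4 * b (-1) + b (-2)) := by
  have p0 := H.shift 0
  have p1 := H.shift 1
  have p2 := H.shift (-1)
  have q0 := H.star_shift (-1)
  have q1 := H.star_shift (-2)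
  have q2 := H.star_shift 0
  norm_num at p0 p1 p2 q0 q1 q2
  have l : ∀ {U x y : R}, U * x = y * U → ∀ z, U * (x * z) = y * (U * z) := fun h z => by
    rw [← mul_assoc, h, mul_assoc]
  simp only [mul_add, add_mul, mul_sub, sub_mul, mul_assoc, p0, q0, l p0, l p1, l p2,
    l q0, l q1, l q2, H.mul_star, H.star_mul, mul_one]
  noncomm_ring

theorem norm_comm_left_le (H : ShiftBounds K N S b) (v : R) :
    ‖(shiftLaplacian N S * (shiftLaplacian N S * b 0 - b 0 * shiftLaplacian N S) -
      (shiftLaplacian N S * b 0 - b 0 * shiftLaplacian N S) * shiftLaplacian N S) * v‖ ≤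
      4 * K * (N * ‖(S - 1) * v‖) + 4 * K * ‖shiftLaplacian N S * v‖ + K * ‖v‖ := by
  have hN := H.pos
  have hK := H.nonneg
  have d1 := H.diff₃ (-1)
  have d2 := H.diff₃ (-2)
  have d3 := H.diff₂ (-2)
  have d4 := H.diff₄ (-2)
  norm_num at d1 d2 d3 d4
  have n1 : ‖(S * S - 1) * v‖ ≤ 2 * ‖(S - 1) * v‖ := by
    have e : (S * S - 1) * v = S * ((S - 1) * v) + (S - 1) * v := by noncomm_ring
    rw [e, two_mul]
    refine (norm_add_le _ _).trans ?_
    rw [CStarRing.norm_mem_unitary_mul _ H.mem_unitary]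
  have n2 : ‖(S * S + star S * star S - 2) * v‖ ≤ 4 * ‖(2 - (S + star S)) * v‖ := by
    set w := (2 - (S + star S)) * v with hw
    have e : (S * S + star S * star S - 2) * v = -(w + w + S * w + star S * w) := by
      -- The second difference of double width factors through the Laplacian, with a cofactor of
      -- norm at most 4.
      have e1 : S * S + star S * star S - 2 = -((2 + S + star S) * (2 - (S + star S))) := by
        have : (1 + 1 + S + star S) * (1 + 1 - (S + star S)) =
          1 + 1 + 1 + 1 - S * S - S * star S - star S * S - star S * star S := by noncomm_ring
        rw [← one_add_one_eq_two, this, H.mul_star, H.star_mul]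
        noncomm_ring
      rw [e1, neg_mul, mul_assoc, ← hw]
      noncomm_ring
    rw [e, norm_neg]
    have h1 := norm_add₃_le (a := w + w) (b := S * w) (c := star S * w)
    rw [CStarRing.norm_mem_unitary_mul _ H.mem_unitary,
      CStarRing.norm_mem_unitary_mul _ H.star_mem_unitary] at h1
    linarith [norm_add_le w w]
  have hA : ‖shiftLaplacian N S * v‖ = N ^ 2 * ‖(2 - (S + star S)) * v‖ := by
    rw [shiftLaplacian, smul_mul_assoc, norm_smul, Real.norm_of_nonneg (by positivity)]
  rw [shiftLaplacian_comm_comm, H.comm_left_eq, smul_mul_assoc, norm_smul,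
    Real.norm_of_nonneg (by positivity), hA, add_mul, add_mul, mul_assoc, mul_assoc]
  set X₁ := b 2 - 3 * b 1 + 3 * b 0 - b (-1)
  set X₂ := b 1 - 3 * b 0 + 3 * b (-1) - b (-2)
  set Y := b 0 - 2 * b (-1) + b (-2)
  set Z := b 2 - 4 * b 1 + 6 * b 0 - 4 * b (-1) + b (-2)
  have m1 := norm_mul_le (X₁ + X₂) ((S * S - 1) * v)
  have m2 := norm_mul_le Y ((S * S + star S * star S - 2) * v)
  have m3 := norm_mul_le Z v
  have m4 := norm_add₃_le (a := (X₁ + X₂) * ((S * S - 1) * v))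
    (b := Y * ((S * S + star S * star S - 2) * v)) (c := Z * v)
  calc _ ≤ N ^ 4 * ((‖X₁‖ + ‖X₂‖) * (2 * ‖(S - 1) * v‖) +
        ‖Y‖ * (4 * ‖(2 - (S + star S)) * v‖) + ‖Z‖ * ‖v‖) := by
        gcongr
        refine m4.trans (add_le_add (add_le_add (m1.trans ?_) (m2.trans ?_)) m3)
        · gcongr
          exact norm_add_le _ _
        · gcongr
    _ = (N ^ 3 * ‖X₁‖ + N ^ 3 * ‖X₂‖) * (2 * (N * ‖(S - 1) * v‖)) +
        (N ^ 2 * ‖Y‖) * (4 * (N ^ 2 * ‖(2 - (S + star S)) * v‖)) + (N ^ 4 * ‖Z‖) * ‖v‖ := by ring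
    _ ≤ (K + K) * (2 * (N * ‖(S - 1) * v‖)) +
        K * (4 * (N ^ 2 * ‖(2 - (S + star S)) * v‖)) + K * ‖v‖ := by gcongr
    _ = _ := by ring

theorem splitBounds (H : ShiftBounds K N S b) (hb : IsSelfAdjoint (b 0)) {C : ℝ} (hC : 1 ≤ C)
    (hCK : 8 * K ≤ C) (hCK2 : 2 * K ^ 2 ≤ C) : SplitBounds C (shiftLaplacian N S) (b 0) where
  one_le := hC
  left_sa := isSelfAdjoint_shiftLaplacian N S
  right_sa := hb
  norm_right v := (norm_mul_le _ _).trans (by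
    gcongr
    linarith [H.diff₀, H.nonneg])
  norm_comm v := by
    have h1 := H.norm_comm_le v
    have h2 := H.norm_shift_sub_one_mul_le v
    have hK := H.nonneg
    have hN := H.pos
    refine h1.trans ?_
    have h3 : 2 * K * (N * ‖(S - 1) * v‖) ≤ C * √(‖shiftLaplacian N S * v‖ * ‖v‖) := by
      gcongr
      linarith
    have h4 : K * ‖v‖ ≤ C * ‖v‖ := by
      gcongr
      linarith
    linarith
  norm_comm_left v := by
    have h1 := H.norm_comm_left_le v
    have h2 := H.norm_shift_sub_one_mul_le v
    have hK := H.nonneg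
    refine h1.trans ?_
    have hx := norm_nonneg (shiftLaplacian N S * v)
    have hy := norm_nonneg v
    have h3 : √(‖shiftLaplacian N S * v‖ * ‖v‖) ≤
        (‖shiftLaplacian N S * v‖ + ‖v‖) / 2 := by
      rw [Real.sqrt_le_left (by positivity)]
      nlinarith [sq_nonneg (‖shiftLaplacian N S * v‖ - ‖v‖)]
    have h4 := mul_le_mul_of_nonneg_left (h2.trans h3) hK
    have h5 := mul_le_mul_of_nonneg_right hCK (add_nonneg hx hy)
    nlinarith [mul_nonneg hK hx, mul_nonneg hK hy]
  norm_comm_right v := (H.norm_comm_right_le v).trans (by gcongr)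

end ShiftBounds

end Difference
/-! ### The discretized Hamiltonian -/

theorem norm_sub_le_of_norm_deriv_le_const {E : Type*} [NormedAddCommGroup E] [NormedSpace ℝ E]
    {g : ℝ → E} {K : ℝ} (hg : Differentiable ℝ g) (hK : ∀ x, ‖deriv g x‖ ≤ K) (x y : ℝ) :
    ‖g y - g x‖ ≤ K * |y - x| :=
  Convex.norm_image_sub_le_of_norm_hasDerivWithin_le
    (fun t _ => (hg t).hasDerivAt.hasDerivWithinAt) (fun t _ => hK t) convex_univ (mem_univ x)
    (mem_univ y)

/-- One difference is peeled off at a time: the k-th derivative of a first difference is a first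
difference of the k-th derivative, and the mean value inequality gains h. -/
theorem norm_fwdDiff_iter_le {E : Type*} [NormedAddCommGroup E] [NormedSpace ℝ E] {K h : ℝ}
    (hh : 0 ≤ h) (k : ℕ) :
    ∀ {g : ℝ → E}, ContDiff ℝ k g → (∀ x, ‖iteratedDeriv k g x‖ ≤ K) →
      ∀ x, ‖(fwdDiff h)^[k] g x‖ ≤ h ^ k * K := by
  induction k generalizing K with
  | zero => intro g _ hK x; simpa using hK x
  | succ k ih =>
    intro g hg hK x
    have hg' : ContDiff ℝ k g := hg.of_le (by exact_mod_cast Nat.le_succ k)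
    have hgs : ContDiff ℝ k fun x => g (x + h) := hg'.comp (contDiff_id.add contDiff_const)
    have hd : Differentiable ℝ (iteratedDeriv k g) :=
      hg.differentiable_iteratedDeriv k (by exact_mod_cast Nat.lt_succ_self k)
    rw [Function.iterate_succ_apply, pow_succ, mul_assoc]
    refine ih (g := fwdDiff h g) (hgs.sub hg') (fun y => ?_) x
    have e : iteratedDeriv k (fwdDiff h g) y = iteratedDeriv k g (y + h) - iteratedDeriv k g y := by
      have : fwdDiff h g = (fun x => g (x + h)) - g := rfl
      rw [this, iteratedDeriv_sub hgs.contDiffAt hg'.contDiffAt, iteratedDeriv_comp_add_const]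
    rw [e]
    refine (norm_sub_le_of_norm_deriv_le_const hd (fun z => ?_) _ _).trans_eq (?_ : K * _ = _)
    · rw [← iteratedDeriv_succ]
      exact hK z
    · rw [add_sub_cancel_left, abs_of_nonneg hh, mul_comm]

variable {n : ℕ}

theorem H₂_sub (g g' : ℝ → ℝ) : H₂ n g - H₂ n g' = H₂ n (fun x => g x - g' x) := by
  ext i j
  by_cases h : i = j
  · subst h; simp [H₂, sample]
  · simp [H₂, h]

theorem H₂_add (g g' : ℝ → ℝ) : H₂ n g + H₂ n g' = H₂ n (fun x => g x + g' x) := by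
  ext i j
  by_cases h : i = j
  · subst h; simp [H₂, sample]
  · simp [H₂, h]

theorem ofNat_mul_H₂ (k : ℕ) [k.AtLeastTwo] (g : ℝ → ℝ) :
    OfNat.ofNat k * H₂ n g = H₂ n (fun x => OfNat.ofNat k * g x) := by
  have : (OfNat.ofNat k : Matrix (Fin n) (Fin n) ℂ) =
      Matrix.diagonal (fun _ => (OfNat.ofNat k : ℂ)) := (Matrix.diagonal_ofNat k).symm
  rw [this, H₂, H₂, Matrix.diagonal_mul_diagonal]
  congr 1
  ext i
  simp [sample]

theorem norm_H₂_le {g : ℝ → ℝ} {K : ℝ} (hK : 0 ≤ K) (hg : ∀ x, |g x| ≤ K) : ‖H₂ n g‖ ≤ K := by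
  rw [H₂, Matrix.l2_opNorm_diagonal, pi_norm_le_iff_of_nonneg hK]
  intro i
  simpa [sample] using hg _

theorem H₂_mul_comm (g g' : ℝ → ℝ) : H₂ n g * H₂ n g' = H₂ n g' * H₂ n g := by
  simp only [H₂, Matrix.diagonal_mul_diagonal, mul_comm]

theorem isSelfAdjoint_H₂ (g : ℝ → ℝ) : IsSelfAdjoint (H₂ n g) := by
  rw [IsSelfAdjoint, Matrix.star_eq_conjTranspose, H₂, Matrix.diagonal_conjTranspose]
  congr 1
  ext i
  simp [sample]

/-- The cyclic shift of the nodes. -/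
noncomputable def shiftMatrix (n : ℕ) [NeZero n] : Matrix (Fin n) (Fin n) ℂ :=
  (Equiv.addRight (1 : Fin n)).permMatrix ℂ

theorem shiftMatrix_apply [NeZero n] (i j : Fin n) :
    shiftMatrix n i j = if i + 1 = j then 1 else 0 := by
  simp [shiftMatrix, Equiv.Perm.permMatrix, PEquiv.toMatrix_apply, eq_comm]

theorem star_shiftMatrix_mul_self [NeZero n] : star (shiftMatrix n) * shiftMatrix n = 1 := by
  rw [shiftMatrix, Matrix.star_eq_conjTranspose, Matrix.conjTranspose_permMatrix,
    ← Matrix.permMatrix_mul, mul_inv_cancel, Matrix.permMatrix_one]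

theorem Fin.val_add_one_mod [NeZero n] (i : Fin n) : (i + 1).val = (i.val + 1) % n := by
  rw [Fin.val_add, Fin.val_one']
  simp

/-- Contributions at coinciding cyclic neighbours add up in the same way on both sides, so n = 1 and
n = 2 are not exceptional. -/
theorem H₁_eq_shiftLaplacian [NeZero n] : H₁ n = shiftLaplacian (n : ℝ) (shiftMatrix n) := by
  ext i j
  have e : ∀ i j : Fin n, (i.val + 1) % n = j.val ↔ i + 1 = j := fun i j => by
    rw [← Fin.val_add_one_mod, Fin.ext_iff]
  have e2 : (2 : Matrix (Fin n) (Fin n) ℂ) i j = if i = j then 2 else 0 :=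
    congrFun (congrFun (Matrix.diagonal_ofNat 2).symm i) j
  simp only [H₁, shiftLaplacian, Matrix.of_apply, Matrix.smul_apply, Matrix.sub_apply,
    Matrix.add_apply, Matrix.star_apply, shiftMatrix_apply, e, e2]
  split_ifs <;> norm_num

theorem sample_succ [NeZero n] {g : ℝ → ℂ} (hg : Function.Periodic g 1) (i : Fin n) :
    sample n g (i + 1) = sample n (fun x => g (x + 1 / n)) i := by
  have hn : (n : ℝ) ≠ 0 := Nat.cast_ne_zero.2 (NeZero.ne n)
  simp only [sample, Fin.val_add_one_mod]
  rcases (Nat.succ_le_of_lt i.2).lt_or_eq with h | h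
  · rw [Nat.mod_eq_of_lt h]
    push_cast
    rw [add_div]
  · have h' : i.val + 1 = n := h
    rw [h', Nat.mod_self, ← add_div, ← Nat.cast_succ, Nat.succ_eq_add_one, h', div_self hn]
    simpa using (hg 0).symm

theorem shiftMatrix_mul_H₂ [NeZero n] {g : ℝ → ℝ} (hg : Function.Periodic g 1) :
    shiftMatrix n * H₂ n g = H₂ n (fun x => g (x + 1 / n)) * shiftMatrix n := by
  ext i j
  rw [H₂, H₂, Matrix.mul_diagonal, Matrix.diagonal_mul, shiftMatrix_apply]
  split_ifs with h
  · rw [← h, sample_succ (g := fun x => (g x : ℂ)) (fun x => by simp only [hg x]), mul_comm]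
  · simp

/-- Translating the periodic function by multiples of 1/n instead of permuting diagonal entries
turns all matrix differences into forward differences of V on the line. -/
theorem shiftBounds_H₂ [NeZero n] {V : ℝ → ℝ} {K : ℝ} (hV : ContDiff ℝ 4 V)
    (hper : Function.Periodic V 1) (hK : ∀ k ≤ 4, ∀ x, |iteratedDeriv k V x| ≤ K) :
    ShiftBounds K n (shiftMatrix n) fun k => H₂ n fun x => V (x + k * (1 / n)) := by
  have hK0 : 0 ≤ K := (abs_nonneg _).trans (hK 0 (by norm_num) 0)
  have hn : (0 : ℝ) < n := Nat.cast_pos.2 (NeZero.pos n)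
  have key : ∀ k : ℕ, k ≤ 4 → ∀ g : ℝ → ℝ, ∀ y : ℝ,
      (∀ x, g x = (fwdDiff (1 / (n : ℝ)))^[k] V (x + y)) → (n : ℝ) ^ k * ‖H₂ n g‖ ≤ K := by
    intro k hk g y hg
    have h := norm_fwdDiff_iter_le (h := 1 / (n : ℝ)) (by positivity) k
      (hV.of_le (by exact_mod_cast hk)) (hK k hk)
    calc (n : ℝ) ^ k * ‖H₂ n g‖ ≤ (n : ℝ) ^ k * ((1 / (n : ℝ)) ^ k * K) := by
          gcongr
          refine norm_H₂_le (by positivity) fun x => ?_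
          rw [hg]
          exact h _
      _ = K := by rw [← mul_assoc, ← mul_pow, mul_one_div_cancel hn.ne', one_pow, one_mul]
  refine ⟨hK0, hn, star_shiftMatrix_mul_self,
    mul_eq_one_comm.1 star_shiftMatrix_mul_self, fun k => ?_, fun j k => H₂_mul_comm _ _,
    ?_, fun k => ?_, fun k => ?_, fun k => ?_, fun k => ?_⟩
  · rw [shiftMatrix_mul_H₂ fun x => by rw [add_right_comm, hper]]
    congr 2
    ext x
    push_cast
    ring_nf
  · exact norm_H₂_le hK0 fun x => by simpa using hK 0 (by norm_num) _
  · simp only [H₂_sub]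
    refine (pow_one (n : ℝ)).symm ▸ key 1 (by norm_num) _ (k * (1 / n)) fun x => ?_
    simp only [Function.iterate_one, fwdDiff]
    push_cast
    ring_nf
  · rw [ofNat_mul_H₂, H₂_sub, H₂_add]
    refine key 2 (by norm_num) _ (k * (1 / n)) fun x => ?_
    simp only [Function.iterate_succ_apply', Function.iterate_zero, id, fwdDiff]
    push_cast
    ring_nf
  · rw [ofNat_mul_H₂, ofNat_mul_H₂, H₂_sub, H₂_add, H₂_sub]
    refine key 3 (by norm_num) _ (k * (1 / n)) fun x => ?_
    simp only [Function.iterate_succ_apply', Function.iterate_zero, id, fwdDiff]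
    push_cast
    ring_nf
  · rw [ofNat_mul_H₂, ofNat_mul_H₂, ofNat_mul_H₂, H₂_sub, H₂_add, H₂_sub, H₂_add]
    refine key 4 (by norm_num) _ (k * (1 / n)) fun x => ?_
    simp only [Function.iterate_succ_apply', Function.iterate_zero, id, fwdDiff]
    push_cast
    ring_nf

theorem splitBounds_H₁_H₂ [NeZero n] {V : ℝ → ℝ} {K C : ℝ} (hV : ContDiff ℝ 4 V)
    (hper : Function.Periodic V 1) (hK : ∀ k ≤ 4, ∀ x, |iteratedDeriv k V x| ≤ K) (hC : 1 ≤ C)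
    (hCK : 8 * K ≤ C) (hCK2 : 2 * K ^ 2 ≤ C) : SplitBounds C (H₁ n) (H₂ n V) := by
  have h := (shiftBounds_H₂ (n := n) hV hper hK).splitBounds (isSelfAdjoint_H₂ _) hC hCK hCK2
  rw [H₁_eq_shiftLaplacian]
  simpa using h

theorem norm_H₁_le [NeZero n] : ‖H₁ n‖ ≤ 4 * (n : ℝ) ^ 2 := by
  have h1 : shiftMatrix n ∈ unitary (Matrix (Fin n) (Fin n) ℂ) :=
    ⟨star_shiftMatrix_mul_self, mul_eq_one_comm.1 star_shiftMatrix_mul_self⟩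
  have h2 : ‖shiftMatrix n‖ ≤ 1 := CStarRing.norm_of_mem_unitary h1 |>.le
  have h3 : ‖(1 : Matrix (Fin n) (Fin n) ℂ)‖ ≤ 1 := CStarRing.norm_one.le
  rw [H₁_eq_shiftLaplacian, shiftLaplacian, norm_smul, Real.norm_of_nonneg (by positivity),
    mul_comm]
  gcongr
  have e : (2 : Matrix (Fin n) (Fin n) ℂ) - (shiftMatrix n + star (shiftMatrix n)) =
    (1 + 1) - (shiftMatrix n + star (shiftMatrix n)) := by rw [one_add_one_eq_two]
  rw [e]
  refine (norm_sub_le _ _).trans ((add_le_add (norm_add_le _ _) (norm_add_le _ _)).trans ?_)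
  rw [norm_star]
  linarith

/-! ### Bounds on the coefficients -/

section Coefficients

variable {C C' : ℝ} {J : Set ℝ} {f f' f'' g g' g'' : ℝ → ℝ}

theorem C2Bound.weaken (h : C2Bound C J f f' f'') (hC : C ≤ C') : C2Bound C' J f f' f'' where
  deriv₁ := h.deriv₁
  deriv₂ := h.deriv₂
  bound₀ t ht := (h.bound₀ t ht).trans hC
  bound₁ t ht := (h.bound₁ t ht).trans hC
  bound₂ t ht := (h.bound₂ t ht).trans hC

theorem C2Bound.of_contDiffOn {T : ℝ} (hT : 0 < T) (hf : ContDiffOn ℝ 2 f (Icc 0 T))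
    (hb : ∀ k ≤ 2, ∀ t ∈ Icc 0 T, |iteratedDerivWithin k f (Icc 0 T) t| ≤ C) :
    C2Bound C (Icc 0 T) f (iteratedDerivWithin 1 f (Icc 0 T))
      (iteratedDerivWithin 2 f (Icc 0 T)) where
  deriv₁ t ht := by
    rw [iteratedDerivWithin_one]
    exact (hf.differentiableOn (by norm_num) t ht).hasDerivWithinAt
  deriv₂ t ht := by
    rw [show iteratedDerivWithin 2 f (Icc 0 T) = derivWithin (iteratedDerivWithin 1 f (Icc 0 T))
      (Icc 0 T) from iteratedDerivWithin_succ]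
    exact (hf.differentiableOn_iteratedDerivWithin (m := 1) (by norm_num)
      (uniqueDiffOn_Icc hT) t ht).hasDerivWithinAt
  bound₀ t ht := by simpa using hb 0 (by norm_num) t ht
  bound₁ := hb 1 (by norm_num)
  bound₂ := hb 2 le_rfl

/-- The factor 4 counts the terms of the second derivative in the Leibniz rule. -/
theorem C2Bound.mul (hf : C2Bound C J f f' f'') (hg : C2Bound C' J g g' g'') :
    C2Bound (4 * C * C') J (fun t => f t * g t) (fun t => f' t * g t + f t * g' t)
      (fun t => (f'' t * g t + f' t * g' t) + (f' t * g' t + f t * g'' t)) where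
  deriv₁ t ht := (hf.deriv₁ t ht).mul (hg.deriv₁ t ht)
  deriv₂ t ht := ((hf.deriv₂ t ht).mul (hg.deriv₁ t ht)).add
    ((hf.deriv₁ t ht).mul (hg.deriv₂ t ht))
  bound₀ t ht := by
    have h1 := mul_le_mul (hf.bound₀ t ht) (hg.bound₀ t ht) (abs_nonneg _)
      ((abs_nonneg _).trans (hf.bound₀ t ht))
    rw [abs_mul]
    linarith [(mul_nonneg (abs_nonneg (f t)) (abs_nonneg (g t))).trans h1]
  bound₁ t ht := by
    have h0 := (abs_nonneg _).trans (hf.bound₀ t ht)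
    have h1 := mul_le_mul (hf.bound₁ t ht) (hg.bound₀ t ht) (abs_nonneg _) h0
    have h2 := mul_le_mul (hf.bound₀ t ht) (hg.bound₁ t ht) (abs_nonneg _) h0
    refine (abs_add_le _ _).trans ?_
    rw [abs_mul, abs_mul]
    linarith [(mul_nonneg (abs_nonneg (f' t)) (abs_nonneg (g t))).trans h1]
  bound₂ t ht := by
    have h0 := (abs_nonneg _).trans (hf.bound₀ t ht)
    have h1 := mul_le_mul (hf.bound₂ t ht) (hg.bound₀ t ht) (abs_nonneg _) h0
    have h2 := mul_le_mul (hf.bound₁ t ht) (hg.bound₁ t ht) (abs_nonneg _) h0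
    have h3 := mul_le_mul (hf.bound₀ t ht) (hg.bound₂ t ht) (abs_nonneg _) h0
    refine (abs_add_le _ _).trans ((add_le_add (abs_add_le _ _) (abs_add_le _ _)).trans ?_)
    simp only [abs_mul]
    linarith

theorem C2Bound.const (c : ℝ) : C2Bound |c| J (fun _ => c) (fun _ => 0) (fun _ => 0) where
  deriv₁ t _ := hasDerivWithinAt_const t J c
  deriv₂ t _ := hasDerivWithinAt_const t J 0
  bound₀ _ _ := le_rfl
  bound₁ _ _ := by simp
  bound₂ _ _ := by simp

theorem C2Bound.inv {m : ℝ} (hm : 0 < m) (hf : C2Bound C J f f' f'') (hlow : ∀ t ∈ J, m ≤ f t) :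
    C2Bound (1 / m + C / m ^ 2 + 2 * C ^ 2 / m ^ 3) J (fun t => (f t)⁻¹)
      (fun t => -f' t / f t ^ 2)
      (fun t => -f'' t / f t ^ 2 + 2 * f' t ^ 2 / f t ^ 3) where
  deriv₁ t ht := (hf.deriv₁ t ht).inv (hm.trans_le (hlow t ht)).ne'
  deriv₂ t ht := by
    have h0 := (hm.trans_le (hlow t ht)).ne'
    refine ((hf.deriv₂ t ht).fun_neg.div ((hf.deriv₁ t ht).fun_pow 2)
      (pow_ne_zero 2 h0)).congr_deriv ?_
    field_simp
    push_cast
    ring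
  bound₀ t ht := by
    have hC : 0 ≤ C := (abs_nonneg _).trans (hf.bound₀ t ht)
    have h0 := hm.trans_le (hlow t ht)
    have h1 : (f t)⁻¹ ≤ 1 / m := by
      rw [one_div]
      exact inv_anti₀ hm (hlow t ht)
    rw [abs_of_pos (by positivity)]
    have : 0 ≤ C / m ^ 2 + 2 * C ^ 2 / m ^ 3 := by positivity
    linarith
  bound₁ t ht := by
    have hC : 0 ≤ C := (abs_nonneg _).trans (hf.bound₀ t ht)
    have h0 := hm.trans_le (hlow t ht)
    have h1 : |-f' t / f t ^ 2| ≤ C / m ^ 2 := by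
      rw [abs_div, abs_neg, abs_of_pos (by positivity : 0 < f t ^ 2)]
      have := hf.bound₁ t ht
      have := hlow t ht
      gcongr
    have : 0 ≤ 1 / m + 2 * C ^ 2 / m ^ 3 := by positivity
    linarith
  bound₂ t ht := by
    have hC : 0 ≤ C := (abs_nonneg _).trans (hf.bound₀ t ht)
    have h0 := hm.trans_le (hlow t ht)
    have hl := hlow t ht
    have h1 : |-f'' t / f t ^ 2| ≤ C / m ^ 2 := by
      rw [abs_div, abs_neg, abs_of_pos (by positivity : 0 < f t ^ 2)]
      have := hf.bound₂ t ht
      gcongr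
    have h2 : |2 * f' t ^ 2 / f t ^ 3| ≤ 2 * C ^ 2 / m ^ 3 := by
      rw [abs_of_nonneg (by positivity), ← sq_abs (f' t)]
      have := hf.bound₁ t ht
      gcongr
    have : 0 ≤ 1 / m := by positivity
    linarith [abs_add_le (-f'' t / f t ^ 2) (2 * f' t ^ 2 / f t ^ 3)]

end Coefficients

/-- A constant that dominates the coefficients and the potential of every model with the bounds
`m` and `K`. -/
noncomputable def modelConst (m K : ℝ) : ℝ :=
  -- The second summand bounds `f₁` (4 · ½ times the bound for 1/M), the third bounds `f₂` (4 · ½ ·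
  -- 4K · 4K²), and the last two serve the commutators.
  1 + 2 * (1 / m + K / m ^ 2 + 2 * K ^ 2 / m ^ 3) + 32 * K ^ 3 + 8 * K + 2 * K ^ 2

theorem IsModel.nonneg {m K T : ℝ} {M ω V : ℝ → ℝ} (h : IsModel m K T M ω V) : 0 ≤ K :=
  (abs_nonneg _).trans (h.pot_bound 0 (by norm_num) 0)

theorem IsModel.c2Bound_f₁ {m K T : ℝ} {M ω V : ℝ → ℝ} (h : IsModel m K T M ω V) (hm : 0 < m)
    (hT : 0 < T) : ∃ f' f'', C2Bound (modelConst m K) (Icc 0 T) (f₁ M) f' f'' := by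
  have hK := h.nonneg
  have h1 := (C2Bound.const (J := Icc 0 T) (1 / 2)).mul
    ((C2Bound.of_contDiffOn hT h.mass_smooth h.mass_bound).inv hm h.mass_lower)
  have e : (fun t => 1 / 2 * (M t)⁻¹) = f₁ M := by
    ext t
    simp [f₁]
    ring
  rw [e] at h1
  refine ⟨_, _, h1.weaken ?_⟩
  rw [modelConst, abs_of_pos (by norm_num)]
  have : 0 ≤ 32 * K ^ 3 + 8 * K + 2 * K ^ 2 := by positivity
  linarith

theorem IsModel.c2Bound_f₂ {m K T : ℝ} {M ω V : ℝ → ℝ} (h : IsModel m K T M ω V) (hm : 0 < m)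
    (hT : 0 < T) : ∃ f' f'', C2Bound (modelConst m K) (Icc 0 T) (f₂ M ω) f' f'' := by
  have hK := h.nonneg
  have hω := C2Bound.of_contDiffOn hT h.freq_smooth h.freq_bound
  have h1 := (C2Bound.const (J := Icc 0 T) (1 / 2)).mul
    ((C2Bound.of_contDiffOn hT h.mass_smooth h.mass_bound).mul (hω.mul hω))
  have e : (fun t => 1 / 2 * (M t * (ω t * ω t))) = f₂ M ω := by
    ext t
    simp [f₂]
    ring
  rw [e] at h1
  refine ⟨_, _, h1.weaken ?_⟩
  rw [modelConst, abs_of_pos (by norm_num)]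
  have : 0 ≤ 1 + 2 * (1 / m + K / m ^ 2 + 2 * K ^ 2 / m ^ 3) + 8 * K + 2 * K ^ 2 := by positivity
  linarith

theorem IsModel.splitBounds {m K T : ℝ} {M ω V : ℝ → ℝ} {n : ℕ} [NeZero n]
    (h : IsModel m K T M ω V) (hm : 0 < m) :
    SplitBounds (modelConst m K) (H₁ n) (H₂ n V) := by
  have hK := h.nonneg
  have h0 : 0 ≤ 1 / m + K / m ^ 2 + 2 * K ^ 2 / m ^ 3 := by positivity
  have h3 : 0 ≤ K ^ 3 := by positivity
  have h2 : 0 ≤ K ^ 2 := by positivity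
  refine splitBounds_H₁_H₂ h.pot_smooth h.pot_periodic h.pot_bound ?_ ?_ ?_ <;>
    rw [modelConst] <;> linarith

/-! ### Nodal vectors as matrices -/

section Columns

variable {n : ℕ} [NeZero n]

/-- The square matrix whose first column is `w` and whose other entries vanish. -/
noncomputable def columnMatrix (n : ℕ) [NeZero n] : (Fin n → ℂ) →L[ℝ] Matrix (Fin n) (Fin n) ℂ :=
  LinearMap.toContinuousLinearMap
    { toFun := fun w => Matrix.vecMulVec w (Pi.single 0 1)
      map_add' := fun v w => Matrix.add_vecMulVec v w _
      map_smul' := fun c w => Matrix.smul_vecMulVec c w _ }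

theorem columnMatrix_apply (w : Fin n → ℂ) :
    columnMatrix n w = Matrix.vecMulVec w (Pi.single 0 1) := rfl

theorem mul_columnMatrix (X : Matrix (Fin n) (Fin n) ℂ) (w : Fin n → ℂ) :
    X * columnMatrix n w = columnMatrix n (X *ᵥ w) := by
  rw [columnMatrix_apply, columnMatrix_apply, Matrix.mul_vecMulVec]

theorem columnMatrix_smul (c : ℂ) (w : Fin n → ℂ) :
    columnMatrix n (c • w) = c • columnMatrix n w := by
  rw [columnMatrix_apply, columnMatrix_apply, Matrix.smul_vecMulVec]

/-- By the C⋆-identity the embedding of nodal vectors is isometric, which transfers estimates in the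
matrix algebra to the Euclidean norm. -/
theorem norm_columnMatrix (w : Fin n → ℂ) : ‖columnMatrix n w‖ = √(∑ k, ‖w k‖ ^ 2) := by
  have e : star (columnMatrix n w) * columnMatrix n w =
      ((∑ k, ‖w k‖ ^ 2 : ℝ) : ℂ) • Matrix.diagonal (Pi.single (0 : Fin n) (1 : ℂ)) := by
    ext i j
    have h : ∀ k, (starRingEnd ℂ) (w k) * w k = ((‖w k‖ ^ 2 : ℝ) : ℂ) := fun k => by
      rw [mul_comm, Complex.mul_conj, Complex.normSq_eq_norm_sq]
    simp only [columnMatrix_apply, Matrix.mul_apply, Matrix.star_apply, Matrix.vecMulVec_apply,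
      Matrix.smul_apply, Matrix.diagonal_apply, Pi.single_apply]
    rcases eq_or_ne i 0 with hi | hi <;> rcases eq_or_ne j 0 with hj | hj
    · simp [hi, hj, h]
    · simp [hi, hj, hj.symm]
    · simp [hi, hj]
    · simp [hi, hj]
  have h1 : ‖columnMatrix n w‖ * ‖columnMatrix n w‖ = ∑ k, ‖w k‖ ^ 2 := by
    rw [← CStarRing.norm_star_mul_self, e, norm_smul, Matrix.l2_opNorm_diagonal, Pi.norm_single,
      norm_one, mul_one, Complex.norm_real, Real.norm_of_nonneg (by positivity)]
  rw [← h1, Real.sqrt_mul_self (norm_nonneg _)]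

theorem starNorm_eq (w : Fin n → ℂ) : starNorm w = ‖columnMatrix n w‖ / √n := by
  rw [starNorm, norm_columnMatrix]

theorem norm_columnMatrix_le {w : Fin n → ℂ} {c : ℝ} (hc : 0 ≤ c) (hw : ∀ k, ‖w k‖ ≤ c) :
    ‖columnMatrix n w‖ ≤ √n * c := by
  rw [norm_columnMatrix, Real.sqrt_le_left (by positivity), mul_pow, Real.sq_sqrt (by positivity)]
  calc ∑ k, ‖w k‖ ^ 2 ≤ ∑ _k : Fin n, c ^ 2 := by
        gcongr with k
        exact hw k
    _ = n * c ^ 2 := by simp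

end Columns

/-! ### Truncation error -/

theorem norm_second_diff_le {E : Type*} [NormedAddCommGroup E] [NormedSpace ℝ E] {g : ℝ → E}
    {K s : ℝ} (hs : 0 ≤ s) (hg : ContDiff ℝ 2 g) (hK : ∀ x, ‖iteratedDeriv 2 g x‖ ≤ K) (x : ℝ) :
    ‖g (x + s) + g (x - s) - (2 : ℝ) • g x‖ ≤ K * s ^ 2 := by
  have h := norm_fwdDiff_iter_le hs 2 hg hK (x - s)
  have e : (fwdDiff s)^[2] g (x - s) = g (x + s) + g (x - s) - (2 : ℝ) • g x := by
    simp only [Function.iterate_succ_apply', Function.iterate_zero, id, fwdDiff, sub_add_cancel,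
      two_smul]
    abel
  rw [← e, mul_comm]
  exact h

/-- The second s-derivative of the expression is the symmetric second difference of g'', of size K
s²; applying the mean value inequality twice gives s⁴, without the sharp factor 1/12. -/
theorem norm_second_diff_sub_le {E : Type*} [NormedAddCommGroup E] [NormedSpace ℝ E] {g : ℝ → E}
    {K s : ℝ} (hs : 0 ≤ s) (hg : ContDiff ℝ 4 g) (hK : ∀ x, ‖iteratedDeriv 4 g x‖ ≤ K) (x : ℝ) :
    ‖g (x + s) + g (x - s) - (2 : ℝ) • g x - s ^ 2 • iteratedDeriv 2 g x‖ ≤ K * s ^ 4 := by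
  have hK0 : 0 ≤ K := (norm_nonneg _).trans (hK 0)
  have d0 : Differentiable ℝ g := hg.differentiable (by norm_num)
  have d1 : Differentiable ℝ (deriv g) := by
    have := hg.differentiable_iteratedDeriv 1 (by norm_num)
    rwa [iteratedDeriv_one] at this
  have hd : ∀ {f : ℝ → E}, Differentiable ℝ f → ∀ r : ℝ,
      HasDerivAt (fun r => f (x + r)) (deriv f (x + r)) r ∧
      HasDerivAt (fun r => f (x - r)) (-deriv f (x - r)) r := fun {f} hf r =>
    ⟨HasDerivAt.comp_const_add x r (hf _).hasDerivAt,
      HasDerivAt.comp_const_sub x r (hf _).hasDerivAt⟩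
  have e2 : iteratedDeriv 2 g = deriv (deriv g) := by
    rw [iteratedDeriv_succ, iteratedDeriv_one]
  have hg2 : ContDiff ℝ 2 (iteratedDeriv 2 g) :=
    by
    rw [iteratedDeriv_eq_iterate]
    exact ContDiff.iterate_deriv' 2 2 hg
  have b2 : ∀ r ∈ Icc 0 s, ‖deriv (deriv g) (x + r) + deriv (deriv g) (x - r) -
      (2 : ℝ) • iteratedDeriv 2 g x‖ ≤ K * s ^ 2 := fun r hr => by
    have := norm_second_diff_le hr.1 hg2 (K := K) (fun y => by
      have : iteratedDeriv 2 (iteratedDeriv 2 g) = iteratedDeriv 4 g := by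
        rw [iteratedDeriv_succ, iteratedDeriv_one, ← iteratedDeriv_succ, ← iteratedDeriv_succ]
      rw [this]
      exact hK y) x
    rw [e2] at this ⊢
    have h2 := hr.2
    have h1 := hr.1
    exact this.trans (by gcongr)
  have b1 : ∀ r ∈ Icc 0 s, ‖deriv g (x + r) - deriv g (x - r) -
      (2 * r) • iteratedDeriv 2 g x‖ ≤ K * s ^ 3 := fun r hr => by
    have key := Convex.norm_image_sub_le_of_norm_hasDerivWithin_le
      (f := fun r => deriv g (x + r) - deriv g (x - r) - (2 * r) • iteratedDeriv 2 g x)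
      (fun r _ => ((((hd d1 r).1.sub (hd d1 r).2).sub
        (((hasDerivAt_id r).const_mul 2).smul_const (iteratedDeriv 2 g x))).congr_deriv
        (by rw [sub_neg_eq_add, mul_one])).hasDerivWithinAt) b2 (convex_Icc 0 s)
      (left_mem_Icc.2 hs) hr
    have h2 := hr.2
    have h1 := hr.1
    simp only [add_zero, sub_zero, sub_self, mul_zero, zero_smul, Real.norm_of_nonneg h1] at key
    refine key.trans ?_
    calc K * s ^ 2 * r ≤ K * s ^ 2 * s := by gcongr
      _ = _ := by ring
  have key := Convex.norm_image_sub_le_of_norm_hasDerivWithin_le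
    (f := fun r => g (x + r) + g (x - r) - (2 : ℝ) • g x - r ^ 2 • iteratedDeriv 2 g x)
    (fun r _ => (((((hd d0 r).1.add (hd d0 r).2).sub_const ((2 : ℝ) • g x)).sub
      (((hasDerivAt_id r).pow 2).smul_const (iteratedDeriv 2 g x))).congr_deriv
      (by simp [sub_eq_add_neg])).hasDerivWithinAt) b1 (convex_Icc 0 s)
    (left_mem_Icc.2 hs) (right_mem_Icc.2 hs)
  have e0 : g x + g x - (2 : ℝ) • g x = 0 := by rw [two_smul, sub_self]
  simp only [add_zero, sub_zero, e0, ne_eq, OfNat.ofNat_ne_zero, not_false_eq_true, zero_pow,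
    zero_smul, Real.norm_of_nonneg hs] at key
  refine key.trans (le_of_eq (by ring))

theorem H₁_mulVec_sample {n : ℕ} [NeZero n] {g : ℝ → ℂ} (hg : Function.Periodic g 1) (i : Fin n) :
    (H₁ n *ᵥ sample n g) i =
      -((n : ℝ) ^ 2 • (g (i / n + 1 / n) + g (i / n - 1 / n) - (2 : ℝ) • g (i / n))) := by
  have h1 : (shiftMatrix n *ᵥ sample n g) i = g (i / n + 1 / n) := by
    rw [Matrix.mulVec, dotProduct]
    simp only [shiftMatrix_apply, ite_mul, one_mul, zero_mul, Finset.sum_ite_eq,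
      Finset.mem_univ, if_true]
    exact sample_succ hg i
  have h2 : (star (shiftMatrix n) *ᵥ sample n g) i = g (i / n - 1 / n) := by
    rw [Matrix.mulVec, dotProduct]
    have hs := sample_succ (n := n) (g := fun x => g (x - 1 / n))
      (fun x => by simp only [add_sub_right_comm, hg (x - 1 / n)]) (i - 1)
    simp only [sub_add_cancel, add_sub_cancel_right] at hs
    simp only [Matrix.star_apply, shiftMatrix_apply, ← eq_sub_iff_add_eq, apply_ite star, star_one,
      star_zero, ite_mul, one_mul, zero_mul, Finset.sum_ite_eq', Finset.mem_univ, if_true]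
    exact hs.symm
  rw [H₁_eq_shiftLaplacian, shiftLaplacian, Matrix.smul_mulVec, Matrix.sub_mulVec,
    Matrix.add_mulVec, show (2 : Matrix (Fin n) (Fin n) ℂ) = 1 + 1 from one_add_one_eq_two.symm,
    Matrix.add_mulVec, Matrix.one_mulVec, Pi.smul_apply,
    Pi.sub_apply, Pi.add_apply, Pi.add_apply, h1, h2, ← smul_neg, two_smul]
  congr 1
  simp only [sample]
  ring

/-! ### Periodic functions and suprema -/

theorem periodic_iteratedDeriv {g : ℝ → ℂ} (hg : Function.Periodic g 1) (j : ℕ) :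
    Function.Periodic (iteratedDeriv j g) 1 := fun x => by
  have h : (fun z => g (z + 1)) = g := funext hg
  have := iteratedDeriv_comp_add_const j g 1
  rw [h] at this
  exact (congrFun this x).symm

/-- The derivative of a periodic function has mean value zero, hence is bounded by a bound of the
second derivative. -/
theorem norm_deriv_le_of_periodic {g : ℝ → ℂ} {B : ℝ} (hg : Function.Periodic g 1)
    (h1 : Differentiable ℝ g) (h2 : Differentiable ℝ (deriv g))
    (hB : ∀ x, ‖deriv (deriv g) x‖ ≤ B) (x : ℝ) : ‖deriv g x‖ ≤ B := by
  have hB0 : 0 ≤ B := (norm_nonneg _).trans (hB 0)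
  have key := Convex.norm_image_sub_le_of_norm_hasDerivWithin_le
    (f := fun s : ℝ => g (x + s) - s • deriv g x) (s := Icc (0 : ℝ) 1) (C := B)
    (fun s _ => ((HasDerivAt.comp_const_add x s (h1 _).hasDerivAt).sub
      ((hasDerivAt_id s).smul_const (deriv g x))).hasDerivWithinAt)
    (fun s hs => by
      rw [one_smul]
      refine (norm_sub_le_of_norm_deriv_le_const h2 hB x (x + s)).trans ?_
      rw [add_sub_cancel_left, abs_of_nonneg hs.1]
      exact mul_le_of_le_one_right hB0 hs.2)
    (convex_Icc 0 1) (left_mem_Icc.2 zero_le_one) (right_mem_Icc.2 zero_le_one)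
  rw [hg x] at key
  simpa using key

section ExactSolution

variable {T : ℝ} {M ω V : ℝ → ℝ} {φ : ℝ → ℝ → ℂ}

/-- Only the fourth derivative is assumed bounded; periodicity passes the bound down to every lower
derivative of positive order. -/
theorem IsExactSolution.norm_iteratedDeriv_le {B t : ℝ} (h : IsExactSolution T M ω V φ)
    (ht : t ∈ Icc 0 T) (hB : ∀ x, ‖iteratedDeriv 4 (φ t) x‖ ≤ B) {j : ℕ} (h1 : 1 ≤ j)
    (h4 : j ≤ 4) : ∀ x, ‖iteratedDeriv j (φ t) x‖ ≤ B := by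
  have step : ∀ k < 3, (∀ x, ‖iteratedDeriv (k + 2) (φ t) x‖ ≤ B) →
      ∀ x, ‖iteratedDeriv (k + 1) (φ t) x‖ ≤ B := fun k hk hb x => by
    have hs := h.smooth t ht
    rw [iteratedDeriv_succ]
    refine norm_deriv_le_of_periodic (periodic_iteratedDeriv (h.periodic t ht) k)
      (hs.differentiable_iteratedDeriv k (by exact_mod_cast (by omega : k < 4))) ?_ (fun y => ?_) x
    · rw [← iteratedDeriv_succ]
      exact hs.differentiable_iteratedDeriv (k + 1) (by exact_mod_cast (by omega : k + 1 < 4))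
    · rw [← iteratedDeriv_succ, ← iteratedDeriv_succ]
      exact hb y
  have h3 := step 2 (by norm_num) hB
  have h2 := step 1 (by norm_num) h3
  have hone := step 0 (by norm_num) h2
  interval_cases j
  · exact hone
  · exact h2
  · exact h3
  · exact hB

/-- A real supremum over an unbounded family is zero by convention, so boundedness has to be
established first; periodicity then extends the bound beyond [0, 1]. -/
theorem IsExactSolution.norm_iteratedDeriv_le_supDeriv (h : IsExactSolution T M ω V φ) {j : ℕ}
    (h1 : 1 ≤ j) (h4 : j ≤ 4) {t : ℝ} (ht : t ∈ Icc 0 T) (x : ℝ) :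
    ‖iteratedDeriv j (φ t) x‖ ≤ supDeriv j T φ := by
  obtain ⟨B, hB⟩ := h.bounded
  have hbdd : BddAbove (range fun p : Icc (0 : ℝ) T × Icc (0 : ℝ) 1 =>
      ‖iteratedDeriv j (φ p.1) p.2‖) := by
    refine ⟨B, ?_⟩
    rintro _ ⟨p, rfl⟩
    exact h.norm_iteratedDeriv_le p.1.2 (hB p.1 p.1.2) h1 h4 _
  obtain ⟨y, hy, hxy⟩ := (periodic_iteratedDeriv (h.periodic t ht) j).exists_mem_Ico₀ one_pos x
  rw [hxy]
  exact le_ciSup hbdd (⟨t, ht⟩, ⟨y, hy.1, hy.2.le⟩)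

theorem supDeriv_nonneg (j : ℕ) (T : ℝ) (φ : ℝ → ℝ → ℂ) : 0 ≤ supDeriv j T φ :=
  Real.iSup_nonneg fun _ => norm_nonneg _

theorem IsExactSolution.norm_le_supInit (h : IsExactSolution T M ω V φ) (hT : 0 ≤ T) (x : ℝ) :
    ‖φ 0 x‖ ≤ supInit φ := by
  have h0 : (0 : ℝ) ∈ Icc 0 T := ⟨le_rfl, hT⟩
  have hc : Continuous fun y : Icc (0 : ℝ) 1 => ‖φ 0 y‖ :=
    ((h.smooth 0 h0).continuous.comp continuous_subtype_val).norm
  obtain ⟨y, hy, hxy⟩ := (h.periodic 0 h0).exists_mem_Ico₀ one_pos x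
  rw [hxy]
  exact le_ciSup (isCompact_range hc).bddAbove (⟨y, hy.1, hy.2.le⟩ : Icc (0 : ℝ) 1)

/-- Follows from normalization. It bounds the vector step counts from below, so that they force T /
L ≤ 1. -/
theorem IsExactSolution.one_le_supInit (h : IsExactSolution T M ω V φ) (hT : 0 ≤ T) :
    1 ≤ supInit φ := by
  have h0 : (0 : ℝ) ∈ Icc 0 T := ⟨le_rfl, hT⟩
  have hS : 0 ≤ supInit φ := (norm_nonneg _).trans (h.norm_le_supInit hT 0)
  have h1 := intervalIntegral.norm_integral_le_of_norm_le_const (a := 0) (b := 1)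
    (f := fun x => ‖φ 0 x‖ ^ 2) (C := supInit φ ^ 2) (fun x _ => by
      rw [Real.norm_of_nonneg (by positivity)]
      gcongr
      exact h.norm_le_supInit hT x)
  rw [h.normalized] at h1
  norm_num at h1
  rwa [abs_of_nonneg hS] at h1

/-- A Riemann sum bound for the initial nodal values. -/
theorem IsExactSolution.starNorm_sample_le {n : ℕ} (h : IsExactSolution T M ω V φ) (hT : 0 ≤ T)
    (hn : 0 < n) (hS : supDeriv 4 T φ ≤ n) : starNorm (sample n (φ 0)) ≤ 2 := by
  have h0 : (0 : ℝ) ∈ Icc 0 T := ⟨le_rfl, hT⟩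
  have hn' : (0 : ℝ) < n := Nat.cast_pos.2 hn
  have hsm := h.smooth 0 h0
  have hc : Continuous fun x => ‖φ 0 x‖ ^ 2 := hsm.continuous.norm.pow 2
  have hd : ∀ x, ‖deriv (φ 0) x‖ ≤ n := fun x => by
    have := h.norm_iteratedDeriv_le h0
      (fun y => h.norm_iteratedDeriv_le_supDeriv (by norm_num) le_rfl h0 y) le_rfl
      (by norm_num : 1 ≤ 4) x
    rw [iteratedDeriv_one] at this
    exact this.trans hS
  -- The slope is at most n, so φ varies by at most 1 on a cell, and (x + 1)² ≤ 2x² + 2. Summing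
  -- over the cells gives 2 · 1 + 2 = 2².
  have hcell : ∀ k < n, ‖φ 0 (k / n)‖ ^ 2 / n ≤
      2 * (∫ x in ((k : ℕ) / n : ℝ)..((k + 1 : ℕ) / n : ℝ), ‖φ 0 x‖ ^ 2) + 2 / n := fun k _ => by
    have hle : ((k : ℕ) / n : ℝ) ≤ ((k + 1 : ℕ) / n : ℝ) := by
      gcongr
      exact Nat.le_succ k
    have hw : ((k + 1 : ℕ) / n : ℝ) - ((k : ℕ) / n : ℝ) = 1 / n := by
      push_cast
      ring
    have hi := intervalIntegral.integral_mono_on (μ := volume) hle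
      (f := fun _ => ‖φ 0 (k / n)‖ ^ 2) (g := fun x => 2 * ‖φ 0 x‖ ^ 2 + 2)
      (continuous_const.intervalIntegrable _ _)
      (((hc.const_mul 2).add continuous_const).intervalIntegrable _ _)
      (fun x hx => by
        have h1 := norm_sub_le_of_norm_deriv_le_const (hsm.differentiable (by norm_num)) hd x (k / n)
        have h2 : |(k : ℝ) / n - x| ≤ 1 / n := by
          rw [abs_sub_comm, abs_of_nonneg (by linarith [hx.1])]
          linarith [hx.2]
        have h3 : ‖φ 0 (k / n) - φ 0 x‖ ≤ 1 := h1.trans <| by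
          calc (n : ℝ) * |(k : ℝ) / n - x| ≤ n * (1 / n) := by gcongr
            _ = 1 := by field_simp
        have h4 := norm_le_norm_sub_add (φ 0 (k / n)) (φ 0 x)
        nlinarith [norm_nonneg (φ 0 (k / n)), norm_nonneg (φ 0 x), sq_nonneg (‖φ 0 x‖ - 1)])
    rw [intervalIntegral.integral_const, intervalIntegral.integral_add
      ((hc.const_mul 2).intervalIntegrable _ _) (continuous_const.intervalIntegrable _ _),
      intervalIntegral.integral_const_mul, intervalIntegral.integral_const, hw, smul_eq_mul,
      smul_eq_mul] at hi
    calc ‖φ 0 (k / n)‖ ^ 2 / n = 1 / n * ‖φ 0 (k / n)‖ ^ 2 := by ring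
      _ ≤ _ := hi
      _ = _ := by ring
  have hsum := Finset.sum_le_sum fun k hk => hcell k (Finset.mem_range.1 hk)
  have hint := intervalIntegral.sum_integral_adjacent_intervals (μ := volume)
    (f := fun x => ‖φ 0 x‖ ^ 2) (a := fun k : ℕ => (k / n : ℝ)) (n := n)
    (fun k _ => hc.intervalIntegrable _ _)
  rw [Finset.sum_add_distrib, ← Finset.mul_sum, hint, Nat.cast_zero, zero_div,
    div_self hn'.ne', h.normalized, ← Finset.sum_div, Finset.sum_const, Finset.card_range,
    nsmul_eq_mul, mul_div_cancel₀ _ hn'.ne'] at hsum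
  rw [starNorm, div_le_iff₀ (by positivity), Real.sqrt_le_left (by positivity), mul_pow,
    Real.sq_sqrt hn'.le, ← div_le_iff₀ hn']
  have e : ∑ k : Fin n, ‖sample n (φ 0) k‖ ^ 2 = ∑ k ∈ Finset.range n, ‖φ 0 (k / n)‖ ^ 2 :=
    Fin.sum_univ_eq_sum_range (fun k : ℕ => ‖φ 0 (k / n)‖ ^ 2) n
  rw [e]
  linarith

end ExactSolution

/-! ### The semi-discretized evolution -/

section Propagator

variable {n : ℕ} {T : ℝ}

theorem IsPropagator.star_mul_self {H U : ℝ → Matrix (Fin n) (Fin n) ℂ} (hU : IsPropagator H T U)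
    (hH : ∀ t ∈ Icc 0 T, IsSelfAdjoint (H t)) {t : ℝ} (ht : t ∈ Icc 0 T) :
    star (U t) * U t = 1 := by
  have key := Convex.norm_image_sub_le_of_norm_hasDerivWithin_le (C := 0)
    (f := fun s => star (U s) * U s)
    (fun s hs => (hU.2 s hs).star.mul (hU.2 s hs))
    (fun s hs => by
      rw [star_smul, StarMul.star_mul, (hH s hs).star_eq, smul_mul_assoc, mul_smul_comm, mul_assoc]
      simp)
    (convex_Icc 0 T) ⟨le_rfl, ht.1.trans ht.2⟩ ht
  rw [zero_mul, norm_le_zero_iff, sub_eq_zero, hU.1] at key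
  simpa using key

theorem IsPropagator.mem_unitary {H U : ℝ → Matrix (Fin n) (Fin n) ℂ} (hU : IsPropagator H T U)
    (hH : ∀ t ∈ Icc 0 T, IsSelfAdjoint (H t)) {t : ℝ} (ht : t ∈ Icc 0 T) :
    U t ∈ unitary (Matrix (Fin n) (Fin n) ℂ) :=
  ⟨hU.star_mul_self hH ht, mul_eq_one_comm.1 (hU.star_mul_self hH ht)⟩

/-- Duhamel's principle. -/
theorem IsPropagator.norm_mul_sub_le {H U Φ τ : ℝ → Matrix (Fin n) (Fin n) ℂ} {E : ℝ}
    (hU : IsPropagator H T U) (hH : ∀ t ∈ Icc 0 T, IsSelfAdjoint (H t))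
    (hΦ : ∀ t ∈ Icc 0 T, HasDerivWithinAt Φ ((-Complex.I) • (H t * Φ t) + τ t) (Icc 0 T) t)
    (hτ : ∀ t ∈ Icc 0 T, ‖τ t‖ ≤ E) {t : ℝ} (ht : t ∈ Icc 0 T) :
    ‖U t * Φ 0 - Φ t‖ ≤ E * t := by
  have h0 : (0 : ℝ) ∈ Icc 0 T := ⟨le_rfl, ht.1.trans ht.2⟩
  have key := Convex.norm_image_sub_le_of_norm_hasDerivWithin_le (C := E)
    (f := fun s => star (U s) * Φ s)
    (fun s hs => (hU.2 s hs).star.mul (hΦ s hs))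
    (fun s hs => by
      have e : star ((-Complex.I) • (H s * U s)) * Φ s +
          star (U s) * ((-Complex.I) • (H s * Φ s) + τ s) = star (U s) * τ s := by
        rw [star_smul, StarMul.star_mul, (hH s hs).star_eq, smul_mul_assoc, mul_add, mul_smul_comm,
          mul_assoc]
        simp
      rw [e, CStarRing.norm_mem_unitary_mul _ (Unitary.star_mem (hU.mem_unitary hH hs))]
      exact hτ s hs)
    (convex_Icc 0 T) h0 ht
  rw [hU.1, star_one, one_mul, sub_zero, Real.norm_of_nonneg ht.1] at key
  rw [← CStarRing.norm_mem_unitary_mul _ (Unitary.star_mem (hU.mem_unitary hH ht)), mul_sub,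
    ← mul_assoc, hU.star_mul_self hH ht, one_mul, norm_sub_rev]
  exact key

end Propagator

section Semidiscrete

variable {n : ℕ} {m K T : ℝ} {M ω V : ℝ → ℝ} {φ : ℝ → ℝ → ℂ}

theorem hamiltonian_mul (t : ℝ) (X : Matrix (Fin n) (Fin n) ℂ) :
    hamiltonian n M ω V t * X = f₁ M t • (H₁ n * X) + f₂ M ω t • (H₂ n V * X) := by
  rw [hamiltonian, add_mul, smul_mul_assoc, smul_mul_assoc, Complex.coe_smul, Complex.coe_smul]

theorem IsModel.isPropagator (h : IsModel m K T M ω V) (hm : 0 < m) (hT : 0 < T) :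
    IsPropagator (hamiltonian n M ω V) T (propagator (hamiltonian n M ω V) T) := by
  obtain ⟨_, _, h1⟩ := h.c2Bound_f₁ hm hT
  obtain ⟨_, _, h2⟩ := h.c2Bound_f₂ hm hT
  refine isPropagator_propagator hT.le ?_
  have e : hamiltonian n M ω V = fun t => f₁ M t • H₁ n + f₂ M ω t • H₂ n V := by
    ext1 t
    rw [hamiltonian, Complex.coe_smul, Complex.coe_smul]
  rw [e]
  exact (h1.continuousOn.smul continuousOn_const).add (h2.continuousOn.smul continuousOn_const)

variable [NeZero n]

theorem isSelfAdjoint_hamiltonian (t : ℝ) : IsSelfAdjoint (hamiltonian n M ω V t) := by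
  have h1 : IsSelfAdjoint (H₁ n) := by
    rw [H₁_eq_shiftLaplacian]
    exact isSelfAdjoint_shiftLaplacian _ _
  rw [hamiltonian, Complex.coe_smul, Complex.coe_smul]
  exact ((IsSelfAdjoint.all (f₁ M t)).smul h1).add
    ((IsSelfAdjoint.all (f₂ M ω t)).smul (isSelfAdjoint_H₂ V))

/-- Taking X = 1 yields the operator norm estimates, and X a column of initial nodal values the
vector norm estimates. -/
theorem IsModel.isTrajectory_mul (h : IsModel m K T M ω V) (hm : 0 < m) (hT : 0 < T)
    (X : Matrix (Fin n) (Fin n) ℂ) {a b : ℝ}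
    (ha : ∀ t ∈ Icc 0 T, ‖H₁ n * (propagator (hamiltonian n M ω V) T t * X)‖ ≤ a)
    (hb : ‖X‖ ≤ b) :
    IsTrajectory (f₁ M) (f₂ M ω) (H₁ n) (H₂ n V) (Icc 0 T)
      (fun t => propagator (hamiltonian n M ω V) T t * X) a b where
  deriv t ht := by
    have := ((h.isPropagator (n := n) hm hT).2 t ht).mul_const X
    rwa [smul_mul_assoc, mul_assoc, hamiltonian_mul] at this
  bound_left := ha
  bound t ht := by
    rwa [CStarRing.norm_mem_unitary_mul _ ((h.isPropagator hm hT).mem_unitary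
      (fun t _ => isSelfAdjoint_hamiltonian t) ht)]

/-- The residual of the nodal values of the exact solution in the semi-discretized equation. -/
theorem IsExactSolution.hasDerivWithinAt_columnMatrix (h : IsExactSolution T M ω V φ) {t : ℝ}
    (ht : t ∈ Icc 0 T) :
    HasDerivWithinAt (fun s => columnMatrix n (sample n (φ s)))
      ((-Complex.I) • (hamiltonian n M ω V t * columnMatrix n (sample n (φ t))) +
        columnMatrix n ((Complex.I * f₁ M t) •
          (H₁ n *ᵥ sample n (φ t) + sample n (iteratedDeriv 2 (φ t))))) (Icc 0 T) t := by
  have h1 : HasDerivWithinAt (fun s => sample n (φ s)) (fun k : Fin n => -Complex.I *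
      (-(f₁ M t : ℂ) * iteratedDeriv 2 (φ t) (k / n) +
        (f₂ M ω t : ℂ) * (V (k / n) : ℂ) * φ t (k / n))) (Icc 0 T) t :=
    hasDerivWithinAt_pi.2 fun k => h.equation t ht _
  refine ((columnMatrix n).hasFDerivAt.comp_hasDerivWithinAt t h1).congr_deriv ?_
  rw [mul_columnMatrix, ← columnMatrix_smul, ← map_add]
  congr 1
  ext k
  have h2 : (H₂ n V *ᵥ sample n (φ t)) k = (V (k / n) : ℂ) * φ t (k / n) := by
    rw [H₂, Matrix.mulVec_diagonal]
    rfl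
  rw [hamiltonian, Matrix.add_mulVec, Matrix.smul_mulVec, Matrix.smul_mulVec]
  simp only [Pi.add_apply, Pi.smul_apply, h2, smul_eq_mul]
  simp only [sample]
  ring

theorem IsExactSolution.norm_residual_le (h : IsExactSolution T M ω V φ) {t C : ℝ}
    (ht : t ∈ Icc 0 T) (hC : |f₁ M t| ≤ C) :
    ‖columnMatrix n ((Complex.I * f₁ M t) •
      (H₁ n *ᵥ sample n (φ t) + sample n (iteratedDeriv 2 (φ t))))‖ ≤
      √n * (C * (supDeriv 4 T φ / n ^ 2)) := by
  have hn : (0 : ℝ) < n := Nat.cast_pos.2 (NeZero.pos n)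
  have hS := supDeriv_nonneg 4 T φ
  have hC0 : 0 ≤ C := (abs_nonneg _).trans hC
  refine norm_columnMatrix_le (by positivity) fun k => ?_
  have h1 := norm_second_diff_sub_le (s := 1 / n) (by positivity) (h.smooth t ht)
    (fun x => h.norm_iteratedDeriv_le_supDeriv (by norm_num) le_rfl ht x) (k / n)
  rw [Pi.smul_apply, Pi.add_apply, H₁_mulVec_sample (h.periodic t ht), smul_eq_mul, norm_mul,
    norm_mul, Complex.norm_I, one_mul, Complex.norm_real, Real.norm_eq_abs]
  gcongr
  generalize φ t (k / n + 1 / n) + φ t (k / n - 1 / n) - (2 : ℝ) • φ t (k / n) = w at h1 ⊢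
  have e : -((n : ℝ) ^ 2 • w) + sample n (iteratedDeriv 2 (φ t)) k =
      -((n : ℝ) ^ 2 • (w - (1 / (n : ℝ)) ^ 2 • iteratedDeriv 2 (φ t) (k / n))) := by
    rw [smul_sub, smul_smul, ← mul_pow, mul_one_div_cancel hn.ne', one_pow, one_smul, neg_sub]
    simp only [sample]
    ring
  rw [e, norm_neg, norm_smul, Real.norm_of_nonneg (by positivity)]
  calc (n : ℝ) ^ 2 * _ ≤ (n : ℝ) ^ 2 * (supDeriv 4 T φ * (1 / (n : ℝ)) ^ 4) := by gcongr
    _ = _ := by field_simp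

theorem IsExactSolution.norm_H₁_mul_columnMatrix_le (h : IsExactSolution T M ω V φ) {t : ℝ}
    (ht : t ∈ Icc 0 T) :
    ‖H₁ n * columnMatrix n (sample n (φ t))‖ ≤ √n * supDeriv 2 T φ := by
  have hn : (0 : ℝ) < n := Nat.cast_pos.2 (NeZero.pos n)
  rw [mul_columnMatrix]
  refine norm_columnMatrix_le (supDeriv_nonneg 2 T φ) fun k => ?_
  have h1 := norm_second_diff_le (s := 1 / n) (by positivity)
    ((h.smooth t ht).of_le (by norm_num))
    (fun x => h.norm_iteratedDeriv_le_supDeriv (by norm_num) (by norm_num) ht x) (k / n)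
  rw [H₁_mulVec_sample (h.periodic t ht), norm_neg, norm_smul, Real.norm_of_nonneg (by positivity)]
  calc (n : ℝ) ^ 2 * _ ≤ (n : ℝ) ^ 2 * (supDeriv 2 T φ * (1 / (n : ℝ)) ^ 2) := by gcongr
    _ = _ := by field_simp

/-- Convergence of the space discretization. -/
theorem IsModel.norm_propagator_mul_sub_le (h : IsModel m K T M ω V)
    (hφ : IsExactSolution T M ω V φ) (hm : 0 < m) (hT : 0 < T) {t : ℝ} (ht : t ∈ Icc 0 T) :
    ‖propagator (hamiltonian n M ω V) T t * columnMatrix n (sample n (φ 0)) -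
      columnMatrix n (sample n (φ t))‖ ≤
      √n * (modelConst m K * (supDeriv 4 T φ / n ^ 2)) * t := by
  obtain ⟨_, _, h1⟩ := h.c2Bound_f₁ hm hT
  exact (h.isPropagator hm hT).norm_mul_sub_le (fun t _ => isSelfAdjoint_hamiltonian t)
    (fun t ht => hφ.hasDerivWithinAt_columnMatrix ht)
    (fun t ht => hφ.norm_residual_le ht (h1.bound₀ t ht)) ht

/-- Regularity of the semi-discretized solution. -/
theorem IsModel.norm_H₁_mul_propagator_le (h : IsModel m K T M ω V)
    (hφ : IsExactSolution T M ω V φ) (hm : 0 < m) (hT : 0 < T) {t : ℝ} (ht : t ∈ Icc 0 T) :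
    ‖H₁ n * (propagator (hamiltonian n M ω V) T t * columnMatrix n (sample n (φ 0)))‖ ≤
      √n * (4 * modelConst m K * (T * supDeriv 4 T φ) + supDeriv 2 T φ) := by
  have hn : (0 : ℝ) < n := Nat.cast_pos.2 (NeZero.pos n)
  have hS := supDeriv_nonneg 4 T φ
  have hC : 0 ≤ modelConst m K := zero_le_one.trans (h.splitBounds (n := n) hm).one_le
  have h1 := h.norm_propagator_mul_sub_le (n := n) hφ hm hT ht
  have h2 := hφ.norm_H₁_mul_columnMatrix_le (n := n) ht
  set Ψ := propagator (hamiltonian n M ω V) T t * columnMatrix n (sample n (φ 0))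
  set Φ := columnMatrix n (sample n (φ t))
  -- The norm 4n² of the Laplacian cancels the n⁻² of the space error, and the exact nodal values
  -- contribute S₂.
  have e : H₁ n * Ψ = H₁ n * (Ψ - Φ) + H₁ n * Φ := by rw [mul_sub, sub_add_cancel]
  rw [e]
  refine (norm_add_le _ _).trans ?_
  have h3 : ‖H₁ n * (Ψ - Φ)‖ ≤ √n * (4 * modelConst m K * (T * supDeriv 4 T φ)) :=
    calc ‖H₁ n * (Ψ - Φ)‖ ≤ ‖H₁ n‖ * ‖Ψ - Φ‖ := norm_mul_le _ _
      _ ≤ (4 * (n : ℝ) ^ 2) * (√n * (modelConst m K * (supDeriv 4 T φ / n ^ 2)) * T) := by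
          gcongr
          · exact norm_H₁_le
          · refine h1.trans ?_
            gcongr
            exact ht.2
      _ = _ := by field_simp
  linarith

end Semidiscrete

/-! ### Step counts -/

/-- The factor of the power of the time step in the local error of a scheme. -/
noncomputable def Scheme.weight (σ : Scheme) (C a b : ℝ) : ℝ :=
  match σ with
  | .standard₁ => 3 * C ^ 3 * (a + b)
  | .generalized₁ => C ^ 3 * (√(a * b) + b)
  | .standard₂ | .generalized₂ => 5 * C ^ 5 * (a + b)

/-- `L` steps suffice for the accuracy `δ` if the local errors have weight `w`. -/
def Scheme.Resolves (σ : Scheme) (T δ w L : ℝ) : Prop :=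
  match σ with
  | .standard₁ | .generalized₁ => T ^ 2 / δ * w ≤ L
  | .standard₂ | .generalized₂ => T ^ 3 / δ * w ≤ L ^ 2

theorem Scheme.mul_localError_le (σ : Scheme) {T δ C a b L : ℝ} (hδ : 0 < δ) (hL : 0 < L)
    (h : σ.Resolves T δ (σ.weight C a b) L) : L * σ.localError C a b (T / L) ≤ δ := by
  have first : ∀ w, T ^ 2 / δ * w ≤ L → L * (w * (T / L) ^ 2) ≤ δ := fun w hw => by
    have e : L * (w * (T / L) ^ 2) = T ^ 2 / δ * w * δ / L := by field_simp
    rw [e, div_le_iff₀ hL, mul_comm δ]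
    gcongr
  have second : ∀ w, T ^ 3 / δ * w ≤ L ^ 2 → L * (w * (T / L) ^ 3) ≤ δ := fun w hw => by
    have e : L * (w * (T / L) ^ 3) = T ^ 3 / δ * w * δ / L ^ 2 := by field_simp
    rw [e, div_le_iff₀ (by positivity), mul_comm δ]
    gcongr
  cases σ
  · exact first _ h
  · exact first _ h
  · exact second _ h
  · exact second _ h

/-- Ensures a step size of at most 1, as the second-order standard formula requires, and L > 0 when
T > 0. -/
theorem Scheme.Resolves.le_steps {σ : Scheme} {T ε L : ℝ} (hε : 0 < ε) (hT : ε ≤ T) (hL : 0 ≤ L)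
    (h : σ.Resolves T ε 1 L) : T ≤ L := by
  have hT0 := hε.trans_le hT
  have first : T ^ 2 / ε * 1 ≤ L → T ≤ L := fun h => by
    refine le_trans ?_ h
    rw [mul_one, le_div_iff₀ hε, sq]
    gcongr
  have second : T ^ 3 / ε * 1 ≤ L ^ 2 → T ≤ L := fun h => by
    refine le_of_sq_le_sq (le_trans ?_ h) hL
    rw [mul_one, le_div_iff₀ hε, pow_succ T 2]
    gcongr
  cases σ
  · exact first h
  · exact first h
  · exact second h
  · exact second h

/-- Homogeneity removes the factor √n between the Euclidean and the rescaled norm. -/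
theorem Scheme.localError_mul (σ : Scheme) {C a b h r : ℝ} (hr : 0 ≤ r) :
    σ.localError C (r * a) (r * b) h = r * σ.localError C a b h := by
  have e : √(r * a * (r * b)) = r * √(a * b) := by
    rw [show r * a * (r * b) = r ^ 2 * (a * b) by ring, Real.sqrt_mul (sq_nonneg r),
      Real.sqrt_sq hr]
  cases σ <;> simp only [Scheme.localError, e] <;> ring

theorem rpow_three_halves_sq {x : ℝ} (hx : 0 ≤ x) : (x ^ (3 / 2 : ℝ)) ^ 2 = x ^ 3 := by
  rw [← Real.rpow_natCast, ← Real.rpow_mul hx, ← Real.rpow_natCast]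
  norm_num

theorem rpow_half_sq {x : ℝ} (hx : 0 ≤ x) : (x ^ (1 / 2 : ℝ)) ^ 2 = x := by
  rw [← Real.sqrt_eq_rpow, Real.sq_sqrt hx]

theorem rpow_five_halves {x : ℝ} (hx : 0 < x) : x ^ (5 / 2 : ℝ) = x ^ 2 * √x := by
  rw [Real.sqrt_eq_rpow, ← Real.rpow_natCast, ← Real.rpow_add hx]
  norm_num

theorem rpow_three_halves {x : ℝ} (hx : 0 < x) : x ^ (3 / 2 : ℝ) = x * √x := by
  nth_rewrite 2 [← Real.rpow_one x]
  rw [Real.sqrt_eq_rpow, ← Real.rpow_add hx]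
  norm_num

section StepCounts

variable {T ε C : ℝ} {φ : ℝ → ℝ → ℂ} {L : ℕ}

/-- The accuracy ε/2 leaves room for the space error. The constant is 2 · 3C³ · 4C = 24C⁴ from the
first-order standard formula; its square 576C⁸ exceeds the 40C⁶ needed for second order. -/
theorem Scheme.resolves_of_vecSteps_le (σ : Scheme) (hT : 0 < T) (hε : 0 < ε) (hC : 1 ≤ C)
    (hS : 1 ≤ supInit φ) (hL : 24 * C ^ 4 * vecSteps σ T ε φ ≤ L) :
    σ.Resolves T (ε / 2) (σ.weight C (4 * C * ((T + 1) * supDeriv 4 T φ + supDeriv 2 T φ))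
      (supInit φ)) L ∧ σ.Resolves T ε 1 L := by
  have hX : 0 ≤ (T + 1) * supDeriv 4 T φ + supDeriv 2 T φ := by
    have := supDeriv_nonneg 4 T φ
    have := supDeriv_nonneg 2 T φ
    positivity
  have h34 : C ^ 3 ≤ C ^ 4 := pow_le_pow_right₀ hC (by norm_num)
  have h58 : C ^ 5 ≤ C ^ 8 := pow_le_pow_right₀ hC (by norm_num)
  have h68 : C ^ 6 ≤ C ^ 8 := pow_le_pow_right₀ hC (by norm_num)
  have h4 : 1 ≤ C ^ 4 := one_le_pow₀ hC
  have h8 : 1 ≤ C ^ 8 := one_le_pow₀ hC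
  have hS0 : 0 ≤ supInit φ := by linarith
  have second : 24 * C ^ 4 * (T ^ (3 / 2 : ℝ) / ε ^ (1 / 2 : ℝ) *
        √((T + 1) * supDeriv 4 T φ + supDeriv 2 T φ + supInit φ)) ≤ L →
      T ^ 3 / (ε / 2) * (5 * C ^ 5 * (4 * C * ((T + 1) * supDeriv 4 T φ + supDeriv 2 T φ) +
        supInit φ)) ≤ (L : ℝ) ^ 2 ∧ T ^ 3 / ε * 1 ≤ (L : ℝ) ^ 2 := fun hL => by
    revert hL
    generalize (T + 1) * supDeriv 4 T φ + supDeriv 2 T φ = X at hX ⊢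
    generalize supInit φ = S at hS hS0 ⊢
    intro hL
    have h2 := pow_le_pow_left₀ (by positivity) hL 2
    rw [mul_pow, mul_pow, mul_pow, div_pow, rpow_three_halves_sq hT.le, rpow_half_sq hε.le,
      Real.sq_sqrt (by positivity)] at h2
    refine ⟨le_trans ?_ h2, le_trans ?_ h2⟩
    · have : 2 * (5 * C ^ 5 * (4 * C * X + S)) ≤ 576 * C ^ 8 * (X + S) := by
        have := mul_le_mul_of_nonneg_right h68 hX
        have := mul_le_mul_of_nonneg_right h58 hS0
        have : 0 ≤ C ^ 8 * X := by positivity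
        have : 0 ≤ C ^ 8 * S := by positivity
        nlinarith
      calc _ = T ^ 3 / ε * (2 * (5 * C ^ 5 * (4 * C * X + S))) := by field_simp
        _ ≤ T ^ 3 / ε * (576 * C ^ 8 * (X + S)) := by gcongr
        _ = _ := by ring
    · calc _ ≤ T ^ 3 / ε * (576 * C ^ 8 * (X + S)) := by
            gcongr
            nlinarith [mul_le_mul h8 (by linarith : 1 ≤ X + S) zero_le_one (by positivity)]
        _ = _ := by ring
  cases σ
  · simp only [vecSteps, Scheme.Resolves, Scheme.weight] at hL ⊢
    revert hL
    generalize (T + 1) * supDeriv 4 T φ + supDeriv 2 T φ = X at hX ⊢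
    generalize supInit φ = S at hS hS0 ⊢
    intro hL
    refine ⟨le_trans ?_ hL, le_trans ?_ hL⟩
    · have : 2 * (3 * C ^ 3 * (4 * C * X + S)) ≤ 24 * C ^ 4 * (X + S) := by
        have := mul_le_mul_of_nonneg_right h34 hS0
        have : 0 ≤ C ^ 4 * S := by positivity
        nlinarith
      calc _ = T ^ 2 / ε * (2 * (3 * C ^ 3 * (4 * C * X + S))) := by field_simp
        _ ≤ T ^ 2 / ε * (24 * C ^ 4 * (X + S)) := by gcongr
        _ = _ := by ring
    · calc _ ≤ T ^ 2 / ε * (24 * C ^ 4 * (X + S)) := by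
            gcongr
            nlinarith [mul_le_mul h4 (by linarith : 1 ≤ X + S) zero_le_one (by positivity)]
        _ = _ := by ring
  · simp only [vecSteps, Scheme.Resolves, Scheme.weight] at hL ⊢
    revert hL
    generalize (T + 1) * supDeriv 4 T φ + supDeriv 2 T φ = X at hX ⊢
    generalize supInit φ = S at hS hS0 ⊢
    intro hL
    have hXS : 0 ≤ √X * √S := by positivity
    refine ⟨le_trans ?_ hL, le_trans ?_ hL⟩
    · have h0 : √(4 * C * X * S) ≤ 2 * C * (√X * √S) := by
        rw [← Real.sqrt_mul hX, Real.sqrt_le_left (by positivity), mul_pow,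
          Real.sq_sqrt (by positivity)]
        have : C ≤ C ^ 2 := by nlinarith
        have := mul_le_mul_of_nonneg_right this (mul_nonneg hX hS0)
        nlinarith
      have : 2 * (C ^ 3 * (√(4 * C * X * S) + S)) ≤ 24 * C ^ 4 * (√X * √S + S) := by
        have h1 := mul_le_mul_of_nonneg_left h0 (by positivity : 0 ≤ C ^ 3)
        have := mul_le_mul_of_nonneg_right h34 hS0
        have : 0 ≤ C ^ 4 * S := by positivity
        have : 0 ≤ C ^ 4 * (√X * √S) := by positivity
        nlinarith
      calc _ = T ^ 2 / ε * (2 * (C ^ 3 * (√(4 * C * X * S) + S))) := by field_simp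
        _ ≤ T ^ 2 / ε * (24 * C ^ 4 * (√X * √S + S)) := by gcongr
        _ = _ := by ring
    · calc _ ≤ T ^ 2 / ε * (24 * C ^ 4 * (√X * √S + S)) := by
            gcongr
            nlinarith [mul_le_mul h4 (by linarith : 1 ≤ √X * √S + S) zero_le_one (by positivity)]
        _ = _ := by ring
  · exact second hL
  · exact second hL

theorem nodeScale_sq (hT : 0 < T) (hε : 0 < ε) :
    nodeScale T ε φ ^ 2 = T * supDeriv 4 T φ / ε := by
  have := supDeriv_nonneg 4 T φ
  rw [nodeScale, Real.sq_sqrt (by positivity)]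

/-- The upper bound on n converts the weight n² (n for the first-order generalized formula) into
powers of the node scale, and n ≥ 1 absorbs the additive 1. Here 60 = 4 · 3 · 5, and κ² + κ serves
both the quadratic and the linear dependence on κ. The accuracy is ε/4 because the initial vector
has rescaled norm at most 2. -/
theorem Scheme.resolves_of_opSteps_le (σ : Scheme) {κ : ℝ} {n : ℕ} (hT : 0 < T) (hε : 0 < ε)
    (hC : 1 ≤ C) (hκ : 0 < κ) (hn : 0 < n) (hnκ : n ≤ κ * nodeScale T ε φ)
    (hL : 60 * C ^ 3 * (κ ^ 2 + κ) * opSteps σ T ε φ ≤ L) :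
    σ.Resolves T (ε / 4) (σ.weight C (4 * n ^ 2) 1) L ∧ σ.Resolves T ε 1 L := by
  have hS := supDeriv_nonneg 4 T φ
  have hN0 : 0 ≤ nodeScale T ε φ := Real.sqrt_nonneg _
  have hn1 : (1 : ℝ) ≤ n := by exact_mod_cast hn
  have hn2 : (n : ℝ) ^ 2 ≤ κ ^ 2 * nodeScale T ε φ ^ 2 := by
    rw [← mul_pow]
    gcongr
  have hn12 : (1 : ℝ) ≤ (n : ℝ) ^ 2 := one_le_pow₀ hn1
  have h3 : 1 ≤ C ^ 3 := one_le_pow₀ hC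
  have h6 : 1 ≤ C ^ 6 := one_le_pow₀ hC
  have h56 : C ^ 5 ≤ C ^ 6 := pow_le_pow_right₀ hC (by norm_num)
  have second : 60 * C ^ 3 * (κ ^ 2 + κ) * (T ^ 2 / ε * √(supDeriv 4 T φ)) ≤ L →
      T ^ 3 / (ε / 4) * (5 * C ^ 5 * (4 * n ^ 2 + 1)) ≤ (L : ℝ) ^ 2 ∧
        T ^ 3 / ε * 1 ≤ (L : ℝ) ^ 2 := fun hL => by
    have hL' : 60 * C ^ 3 * κ * (T ^ 2 / ε * √(supDeriv 4 T φ)) ≤ L := by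
      refine le_trans ?_ hL
      gcongr
      nlinarith
    have h2 := pow_le_pow_left₀ (by positivity) hL' 2
    have e : (60 * C ^ 3 * κ * (T ^ 2 / ε * √(supDeriv 4 T φ))) ^ 2 =
        T ^ 3 / ε * (3600 * C ^ 6 * (κ ^ 2 * nodeScale T ε φ ^ 2)) := by
      rw [nodeScale_sq hT hε, mul_pow, mul_pow, mul_pow, mul_pow, Real.sq_sqrt hS]
      ring
    rw [e] at h2
    refine ⟨le_trans ?_ h2, le_trans ?_ h2⟩
    · have : 4 * (5 * C ^ 5 * (4 * (n : ℝ) ^ 2 + 1)) ≤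
          3600 * C ^ 6 * (κ ^ 2 * nodeScale T ε φ ^ 2) := by
        calc 4 * (5 * C ^ 5 * (4 * (n : ℝ) ^ 2 + 1)) ≤ 4 * (5 * C ^ 6 * (4 * n ^ 2 + n ^ 2)) := by
              gcongr
          _ = 100 * C ^ 6 * (n : ℝ) ^ 2 := by ring
          _ ≤ 3600 * C ^ 6 * (κ ^ 2 * nodeScale T ε φ ^ 2) := by
              gcongr
              norm_num
      calc _ = T ^ 3 / ε * (4 * (5 * C ^ 5 * (4 * n ^ 2 + 1))) := by field_simp
        _ ≤ _ := by gcongr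
    · gcongr
      nlinarith [mul_le_mul h6 (hn12.trans hn2) zero_le_one (by positivity)]
  cases σ
  · simp only [opSteps, Scheme.Resolves, Scheme.weight] at hL ⊢
    have h2 : T ^ 2 / ε * (60 * C ^ 3 * (κ ^ 2 * nodeScale T ε φ ^ 2)) ≤ L := by
      refine le_trans ?_ hL
      calc _ = 60 * C ^ 3 * κ ^ 2 * (T ^ 3 / ε ^ 2 * supDeriv 4 T φ) := by
            rw [nodeScale_sq hT hε]
            ring
        _ ≤ _ := by
            gcongr
            linarith
    refine ⟨le_trans ?_ h2, le_trans ?_ h2⟩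
    · have : 4 * (3 * C ^ 3 * (4 * (n : ℝ) ^ 2 + 1)) ≤
          60 * C ^ 3 * (κ ^ 2 * nodeScale T ε φ ^ 2) := by
        calc 4 * (3 * C ^ 3 * (4 * (n : ℝ) ^ 2 + 1)) ≤ 4 * (3 * C ^ 3 * (4 * n ^ 2 + n ^ 2)) := by
              gcongr
          _ = 60 * C ^ 3 * (n : ℝ) ^ 2 := by ring
          _ ≤ _ := by gcongr
      calc _ = T ^ 2 / ε * (4 * (3 * C ^ 3 * (4 * n ^ 2 + 1))) := by field_simp
        _ ≤ _ := by gcongr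
    · gcongr
      nlinarith [mul_le_mul h3 (hn12.trans hn2) zero_le_one (by positivity)]
  · simp only [opSteps, Scheme.Resolves, Scheme.weight] at hL ⊢
    have h2 : T ^ 2 / ε * (60 * C ^ 3 * (κ * nodeScale T ε φ)) ≤ L := by
      refine le_trans ?_ hL
      have e : nodeScale T ε φ = √T * √(supDeriv 4 T φ) / √ε := by
        rw [nodeScale, Real.sqrt_div (by positivity), Real.sqrt_mul hT.le]
      calc _ = 60 * C ^ 3 * κ * (T ^ (5 / 2 : ℝ) / ε ^ (3 / 2 : ℝ) * √(supDeriv 4 T φ)) := by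
            rw [e, rpow_five_halves hT, rpow_three_halves hε]
            ring
        _ ≤ _ := by
            gcongr
            nlinarith
    refine ⟨le_trans ?_ h2, le_trans ?_ h2⟩
    · have hsq : √(4 * (n : ℝ) ^ 2 * 1) = 2 * n := by
        rw [show 4 * (n : ℝ) ^ 2 * 1 = (2 * n) ^ 2 by ring, Real.sqrt_sq (by positivity)]
      have : 4 * (C ^ 3 * (2 * (n : ℝ) + 1)) ≤ 60 * C ^ 3 * (κ * nodeScale T ε φ) := by
        calc 4 * (C ^ 3 * (2 * (n : ℝ) + 1)) ≤ 4 * (C ^ 3 * (2 * n + n)) := by gcongr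
          _ = 12 * C ^ 3 * (n : ℝ) := by ring
          _ ≤ _ := by
              gcongr
              norm_num
      calc _ = T ^ 2 / ε * (4 * (C ^ 3 * (2 * n + 1))) := by
            rw [hsq]
            field_simp
        _ ≤ _ := by gcongr
    · gcongr
      nlinarith [mul_le_mul h3 (hn1.trans hnκ) zero_le_one (by positivity)]
  · exact second hL
  · exact second hL

end StepCounts

/-! ### Error bounds -/

section Errors

variable {n : ℕ} [NeZero n] {m K T : ℝ} {M ω V : ℝ → ℝ} {φ : ℝ → ℝ → ℂ} {L : ℕ}

theorem starNorm_mulVec_sub_le (X Y : Matrix (Fin n) (Fin n) ℂ) (w : Fin n → ℂ) :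
    starNorm (X *ᵥ w - Y *ᵥ w) ≤ ‖X - Y‖ * starNorm w := by
  rw [← Matrix.sub_mulVec, starNorm_eq, starNorm_eq, ← mul_columnMatrix, ← mul_div_assoc]
  gcongr
  exact norm_mul_le _ _

theorem starNorm_sub_le (u v w : Fin n → ℂ) :
    starNorm (u - w) ≤ starNorm (u - v) + starNorm (v - w) := by
  simp only [starNorm_eq, ← add_div]
  gcongr
  rw [← sub_add_sub_cancel u v w, map_add]
  exact norm_add_le _ _

theorem totalError_le (σ : Scheme) :
    totalError σ n M ω V T φ L ≤ vecTimeError σ n M ω V T φ L + spaceError n M ω V T φ :=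
  starNorm_sub_le _ _ _

theorem IsModel.spaceError_le (h : IsModel m K T M ω V) (hφ : IsExactSolution T M ω V φ)
    (hm : 0 < m) (hT : 0 < T) :
    spaceError n M ω V T φ ≤ modelConst m K * (supDeriv 4 T φ / n ^ 2) * T := by
  have hn : 0 < √(n : ℝ) := Real.sqrt_pos.2 (Nat.cast_pos.2 (NeZero.pos n))
  rw [spaceError, starNorm_eq, map_sub, ← mul_columnMatrix, div_le_iff₀ hn]
  refine (h.norm_propagator_mul_sub_le hφ hm hT ⟨hT.le, le_rfl⟩).trans (le_of_eq ?_)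
  ring

theorem IsModel.opTimeError_le (h : IsModel m K T M ω V) (hm : 0 < m) (hT : 0 < T) (σ : Scheme)
    (hL : 0 < L) (hTL : T ≤ L) :
    opTimeError σ n M ω V T L ≤ L * σ.localError (modelConst m K) (4 * n ^ 2) 1 (T / L) := by
  obtain ⟨_, _, h1⟩ := h.c2Bound_f₁ hm hT
  obtain ⟨_, _, h2⟩ := h.c2Bound_f₂ hm hT
  have hU := h.isPropagator (n := n) hm hT
  have hone : ‖(1 : Matrix (Fin n) (Fin n) ℂ)‖ ≤ 1 := CStarRing.norm_one.le
  have key := σ.norm_evolution_mul_sub_le (h.splitBounds hm) hT.le hL hTL h1 h2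
    (h.isTrajectory_mul hm hT (n := n) 1 (a := 4 * n ^ 2) (b := 1) (fun t ht => by
      rw [mul_one]
      refine (norm_mul_le _ _).trans ?_
      rw [CStarRing.norm_of_mem_unitary
        (hU.mem_unitary (fun t _ => isSelfAdjoint_hamiltonian t) ht), mul_one]
      exact norm_H₁_le) hone)
  rw [hU.1, mul_one, mul_one, mul_one] at key
  exact key

theorem IsModel.vecTimeError_le (h : IsModel m K T M ω V) (hφ : IsExactSolution T M ω V φ)
    (hm : 0 < m) (hT : 0 < T) (σ : Scheme) (hL : 0 < L) (hTL : T ≤ L) :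
    vecTimeError σ n M ω V T φ L ≤ L * σ.localError (modelConst m K)
      (4 * modelConst m K * ((T + 1) * supDeriv 4 T φ + supDeriv 2 T φ)) (supInit φ) (T / L) := by
  obtain ⟨_, _, h1⟩ := h.c2Bound_f₁ hm hT
  obtain ⟨_, _, h2⟩ := h.c2Bound_f₂ hm hT
  have hn : 0 < √(n : ℝ) := Real.sqrt_pos.2 (Nat.cast_pos.2 (NeZero.pos n))
  have hC := (h.splitBounds (n := n) hm).one_le
  have key := σ.norm_evolution_mul_sub_le (h.splitBounds hm) hT.le hL hTL h1 h2
    (h.isTrajectory_mul hm hT (n := n) (columnMatrix n (sample n (φ 0)))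
      (a := √n * (4 * modelConst m K * ((T + 1) * supDeriv 4 T φ + supDeriv 2 T φ)))
      (b := √n * supInit φ) (fun t ht => by
        refine (h.norm_H₁_mul_propagator_le hφ hm hT ht).trans ?_
        have h4 := supDeriv_nonneg 4 T φ
        have h2 := supDeriv_nonneg 2 T φ
        gcongr
        nlinarith [mul_nonneg (zero_le_one.trans hC) h4, mul_le_mul_of_nonneg_right hC h2])
      (norm_columnMatrix_le ((norm_nonneg _).trans (hφ.norm_le_supInit hT.le 0))
        fun k => hφ.norm_le_supInit hT.le _))
  rw [Scheme.localError_mul σ hn.le, (h.isPropagator hm hT).1, one_mul] at key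
  rw [vecTimeError, starNorm_eq, map_sub, ← mul_columnMatrix, ← mul_columnMatrix, div_le_iff₀ hn]
  refine key.trans (le_of_eq (by ring))

end Errors

end TrotterSchrodinger

/-! ### Choice of the constants and conclusion -/

open TrotterSchrodinger in
theorem mainTheorem2 (m K : ℝ) (hm : 0 < m) :
    ∃ c > 0, ∃ Cvec > 0, ∀ κ ≥ c, ∃ Cop > 0,
      ∀ (T : ℝ) (M ω V : ℝ → ℝ) (φ : ℝ → ℝ → ℂ), 0 < T →
        IsModel m K T M ω V → IsExactSolution T M ω V φ →
        ∃ ε₀ > 0, ∀ ε : ℝ, 0 < ε → ε < ε₀ →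
          ∀ n : ℕ, 0 < n → c * nodeScale T ε φ ≤ n →
            spaceError n M ω V T φ ≤ ε ∧
            (∀ (σ : Scheme) (L : ℕ), Cvec * vecSteps σ T ε φ ≤ L →
              vecTimeError σ n M ω V T φ L ≤ ε ∧ totalError σ n M ω V T φ L ≤ ε) ∧
            (n ≤ κ * nodeScale T ε φ →
              ∀ (σ : Scheme) (L : ℕ), Cop * opSteps σ T ε φ ≤ L →
                opTimeError σ n M ω V T L ≤ ε ∧ totalError σ n M ω V T φ L ≤ ε) := by
  -- No model has a negative bound K, and then any constants will do; otherwise the model constant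
  -- is at least 1.
  rcases lt_or_ge K 0 with hK | hK
  · exact ⟨1, one_pos, 1, one_pos, fun _ _ => ⟨1, one_pos, fun T M ω V φ _ hM _ =>
      absurd hM.nonneg (not_le.2 hK)⟩⟩
  have hC : 1 ≤ modelConst m K := by
    have : 0 ≤ 2 * (1 / m + K / m ^ 2 + 2 * K ^ 2 / m ^ 3) + 32 * K ^ 3 + 8 * K + 2 * K ^ 2 := by
      positivity
    rw [modelConst]
    linarith
  set C := modelConst m K with hCdef
  refine ⟨2 * C, by linarith, 24 * C ^ 4, by positivity, fun κ hκ => ?_⟩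
  have hκ0 : 0 < κ := by linarith
  refine ⟨60 * C ^ 3 * (κ ^ 2 + κ), by positivity, fun T M ω V φ hT hM hφ => ?_⟩
  have hS := supDeriv_nonneg 4 T φ
  -- This threshold gives ε ≤ T, for step sizes at most 1, and ε S₄ ≤ T. The latter and the lower
  -- bound on n imply S₄ ≤ n, as the Riemann sum bound requires.
  refine ⟨T / (supDeriv 4 T φ + 1), by positivity, fun ε hε hεT n hn hcn => ?_⟩
  have : NeZero n := ⟨hn.ne'⟩
  have hn' : (0 : ℝ) < n := Nat.cast_pos.2 hn
  rw [lt_div_iff₀ (by positivity)] at hεT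
  have hεT' : ε ≤ T := by nlinarith
  have hN : 4 * C ^ 2 * (T * supDeriv 4 T φ) ≤ ε * (n : ℝ) ^ 2 := by
    have h := pow_le_pow_left₀ (show 0 ≤ 2 * C * nodeScale T ε φ from
      mul_nonneg (by linarith) (Real.sqrt_nonneg _)) hcn 2
    rw [mul_pow, nodeScale_sq hT hε] at h
    calc 4 * C ^ 2 * (T * supDeriv 4 T φ) = ε * ((2 * C) ^ 2 * (T * supDeriv 4 T φ / ε)) := by
          field_simp
          ring
      _ ≤ _ := by gcongr
  have hTS : 0 ≤ T * supDeriv 4 T φ := by positivity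
  have hspace : spaceError n M ω V T φ ≤ ε / 2 := by
    refine (hM.spaceError_le hφ hm hT).trans ?_
    rw [← hCdef, show C * (supDeriv 4 T φ / n ^ 2) * T = C * (T * supDeriv 4 T φ) / n ^ 2 by ring,
      div_le_iff₀ (by positivity)]
    have : C ≤ C ^ 2 := by nlinarith
    nlinarith [mul_le_mul_of_nonneg_right this hTS]
  have hS4 : supDeriv 4 T φ ≤ n := by
    refine le_of_sq_le_sq ?_ hn'.le
    have h1 : ε * supDeriv 4 T φ ^ 2 ≤ T * supDeriv 4 T φ := by nlinarith
    have h2 : 1 ≤ C ^ 2 := one_le_pow₀ hC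
    have h3 : ε * supDeriv 4 T φ ^ 2 ≤ ε * (n : ℝ) ^ 2 := by nlinarith
    exact le_of_mul_le_mul_left h3 hε
  refine ⟨by linarith, fun σ L hL => ?_, fun hnκ σ L hL => ?_⟩
  · obtain ⟨r1, r2⟩ := σ.resolves_of_vecSteps_le hT hε hC (hφ.one_le_supInit hT.le) hL
    have hTL := r2.le_steps hε hεT' (Nat.cast_nonneg L)
    have hL0 : 0 < L := by exact_mod_cast hT.trans_le hTL
    have h1 := (hM.vecTimeError_le (n := n) hφ hm hT σ hL0 hTL).trans
      (σ.mul_localError_le (half_pos hε) (hT.trans_le hTL) r1)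
    have h3 : totalError σ n M ω V T φ L ≤ vecTimeError σ n M ω V T φ L + spaceError n M ω V T φ :=
      totalError_le σ
    exact ⟨by linarith, by linarith⟩
  · obtain ⟨r1, r2⟩ := σ.resolves_of_opSteps_le hT hε hC hκ0 hn hnκ hL
    have hTL := r2.le_steps hε hεT' (Nat.cast_nonneg L)
    have hL0 : 0 < L := by exact_mod_cast hT.trans_le hTL
    have h1 := (hM.opTimeError_le (n := n) hm hT σ hL0 hTL).trans
      (σ.mul_localError_le (by positivity) (hT.trans_le hTL) r1)
    have h2 : vecTimeError σ n M ω V T φ L ≤ ε / 4 * 2 :=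
      (starNorm_mulVec_sub_le _ _ _).trans (mul_le_mul h1 (hφ.starNorm_sample_le hT.le hn hS4)
        (by rw [starNorm_eq]; positivity) (by positivity))
    have h3 : totalError σ n M ω V T φ L ≤ vecTimeError σ n M ω V T φ L + spaceError n M ω V T φ :=
      totalError_le σ
    exact ⟨by linarith, by linarith⟩
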